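/- Fix $\alpha>0$ and write $\mathbb{R}^2_+=[0,\infty)^2$. Consider the system $$\omega_t+\mathbf{u}\cdot\nabla\omega=\frac{\rho}{x_1},\qquad \rho_t+\mathbf{u}\cdot\nabla\rho=0\qquad(\mathbf{x}\in\mathbb{R}^2_+),$$ where $\mathbf{u}=(-x_1Q,\;x_2Q)$, $$Q(\mathbf{x},t)=\iint_{\mathbf{x}+S_\alpha}\frac{y_1y_2}{|\mathbf{y}|^4}\,\omega(\mathbf{y},t)\,d\mathbf{y},\qquad S_\alpha=\{x_1\ge 0,\ 0\le x_2\le\alpha x_1\}.$$ Let $\mathcal{X}$ be the class of functions on $\mathbb{R}^2_+$ that are restrictions of compactly supported functions $\tilde f\in C^1(\mathbb{R}^2)$ with $\operatorname{supp}\tilde f\subseteq\{x_1>0\}$, with the norm $\sup_{\mathbb{R}^2_+}|f|+\sup_{\mathbb{R}^2_+}|\nabla f|$ (near $x_1=0$, where $\rho$ vanishes, $\rho/x_1$ is read as $0$). A solution on a time interval $I$ is a pair $\omega,\rho\in C(I,\mathcal{X})$ that satisfies the system at every point of $\mathbb{R}^2_+\times I$. (i) For all $\omega_0,\rho_0\in\mathcal{X}$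 there exist $T=T(\omega_0,\rho_0,\alpha)>0$ and a solution $(\omega,\rho)$ on $[0,T]$ with $\omega(\cdot,0)=\omega_0$ and $\rho(\cdot,0)=\rho_0$. It is unique: for every $0<T'\le T$, each solution on $[0,T']$ with the same initial data coincides with $(\omega,\rho)$ on $[0,T']$. (ii) Let $0<T<\infty$ and let $(\omega,\rho)$ be a solution on $[0,T)$ with $\omega(\cdot,0)\ge 0$ and $\rho(\cdot,0)\ge 0$. If there is a $k>0$ such that $$\int_0^T\|\omega(\cdot,s)\|_{L^\infty([0,k]\times[0,\infty))}\,ds<\infty,$$ then there are $\varepsilon>0$ and a solution on $[0,T+\varepsilon)$ that coincides with $(\omega,\rho)$ on $[0,T)$. -/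

import Mathlib

namespace HyperbolicModel

/-- The closed quadrant `ℝ²₊ = [0, ∞)²`. -/
def quadrant : Set (ℝ × ℝ) := {x | 0 ≤ x.1 ∧ 0 ≤ x.2}

/-- The class `𝒳`: functions which on the closed quadrant coincide with a compactly supported
`C¹` function on `ℝ²` whose (closed) support lies in `{x₁ > 0}`. Only the values on the quadrant
are relevant. -/
def classX : Set (ℝ × ℝ → ℝ) :=
  {f | ∃ g : ℝ × ℝ → ℝ, ContDiff ℝ 1 g ∧ HasCompactSupport g ∧
    tsupport g ⊆ {x | 0 < x.1} ∧ Set.EqOn f g quadrant}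

/-- The derivative of `f` on the closed quadrant (one-sided at the boundary). -/
noncomputable def gradQ (f : ℝ × ℝ → ℝ) (x : ℝ × ℝ) : ℝ × ℝ →L[ℝ] ℝ :=
  fderivWithin ℝ f quadrant x

/-- The sector `S_α`. -/
def sector (α : ℝ) : Set (ℝ × ℝ) := {x | 0 ≤ x.1 ∧ 0 ≤ x.2 ∧ x.2 ≤ α * x.1}

/-- `Q(x) = ∬_{x + S_α} y₁ y₂ / |y|⁴ w(y) dy`, with `|y|` the Euclidean norm. -/
noncomputable def Q (α : ℝ) (w : ℝ × ℝ → ℝ) (x : ℝ × ℝ) : ℝ :=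
  ∫ y in {y : ℝ × ℝ | y - x ∈ sector α}, y.1 * y.2 / (y.1 ^ 2 + y.2 ^ 2) ^ 2 * w y

/-- The velocity field `u = (-x₁ Q, x₂ Q)` generated by the vorticity `w`. -/
noncomputable def velocity (α : ℝ) (w : ℝ × ℝ → ℝ) (x : ℝ × ℝ) : ℝ × ℝ :=
  (-(x.1 * Q α w x), x.2 * Q α w x)

/-- `f ∈ C(I, 𝒳)`: every `f t` is in `𝒳`, and `t ↦ f t` is continuous on `I` for the
`C¹` norm `sup |f| + sup |∇f|` over the closed quadrant. -/
def ContinuousIntoX (I : Set ℝ) (f : ℝ → ℝ × ℝ → ℝ) : Prop :=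
  (∀ t ∈ I, f t ∈ classX) ∧
  ∀ t ∈ I, TendstoUniformlyOn f (f t) (nhdsWithin t I) quadrant ∧
    TendstoUniformlyOn (fun s => gradQ (f s)) (gradQ (f t)) (nhdsWithin t I) quadrant

/-- `(ω, ρ)` is a classical solution, on the time interval `I`, of
`ω_t + u · ∇ω = ρ / x₁`, `ρ_t + u · ∇ρ = 0` in the closed quadrant. Elements of `𝒳` vanish
near `x₁ = 0`, where `ρ / x₁` is read as `0`. -/
structure IsSolution (α : ℝ) (I : Set ℝ) (ω ρ : ℝ → ℝ × ℝ → ℝ) : Prop where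
  vorticity_continuous : ContinuousIntoX I ω
  density_continuous : ContinuousIntoX I ρ
  vorticity_eq : ∀ t ∈ I, ∀ x ∈ quadrant,
    HasDerivWithinAt (fun s => ω s x)
      (ρ t x / x.1 - gradQ (ω t) x (velocity α (ω t) x)) I t
  density_eq : ∀ t ∈ I, ∀ x ∈ quadrant,
    HasDerivWithinAt (fun s => ρ s x) (-(gradQ (ρ t) x (velocity α (ω t) x))) I t

end HyperbolicModel

namespace HyperbolicModel
open Set Filter Topology MeasureTheory
open scoped BoundedContinuousFunction NNReal


/-! ### A maximum principle -/

/-! Along trajectories of `u` the density is constant and the vorticity grows by `ρ₀(a)` times the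
integral of `1/x₁`. So a solution is encoded by the displacement `ξ` of the flow map `a ↦ a + ξ(a)`
and the accumulated production `π(a)`, and `ω` at the image of `a` is `ω₀(a) + ρ₀(a) π(a)`. After
cutoffs away from `x₁ = 0` the pair `w = (ξ, π)` solves an autonomous differential equation in a
space of bounded `C¹` functions (`exists_lagrangian_solution`).

Picard iteration applies because `Q` gains a derivative. In the basis `(1, 0)`, `(1, α)` the
integral over the sector is an iterated integral along rays, and differentiating along one edge
leaves a difference of ray integrals of the integrand. Hence `Q` is `C^{1,1}` when the integrand is
Lipschitz, and the vorticity depends on `w` in a Lipschitz way in the sup norm even for merely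
Lipschitz data. The existence time depends only on the support and the sup norm of the data
(`exists_solution`), so continuation needs no gradient estimate.

Uniqueness and all a priori bounds come from a maximum principle instead of characteristics: at a
spatial maximum of a weighted solution the derivative along `u` vanishes, and only the source and
the change of the weight along the flow remain (`weighted_transport_le`). Suitable weights show that
the solution vanishes on superlevel sets of any quantity that does not increase along the flow. Such
quantities are `x₁ x₂`, a discounted `x₁`, and a discounted `log (k / x₁)`.

For the continuation criterion, nonnegative data keep `Q ≥ 0`, so the flow moves towards the axis
and the vorticity in `{x₁ ≥ k}` stays bounded. If `A` bounds `ω` in the strip `{x₁ ≤ k}`, then for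
`x₁ ≤ k` one has `|Q| ≤ C + (A / 2) log (k / x₁)` (`abs_Q_le`), while `log (k / x₁)` has derivative
`Q` along the flow. Gronwall's inequality with `∫ A < ∞` keeps the support away from the axis up to
time `T` (`IsSolution.exists_bounds`). This bounds `ρ / x₁`, hence `ω`. Local existence with a
uniform time, restarted shortly before `T` and glued by uniqueness, passes beyond `T`. -/

/-- A function with compact superlevel sets that starts strictly below a positive barrier stays
below it if it cannot touch it from below. -/
theorem lt_of_barrier {P : Type*} [TopologicalSpace P] {D : Set P} {T : ℝ} {h : ℝ → P → ℝ}
    {v v' : ℝ → ℝ}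
    (hcont : ContinuousOn (fun z : ℝ × P => h z.1 z.2) (Icc 0 T ×ˢ D))
    (hcpt : ∀ t ∈ Icc 0 T, ∀ c : ℝ, 0 < c → ∃ C ⊆ D, IsCompact C ∧
      ∀ᶠ s in 𝓝[Icc 0 T] t, ∀ p ∈ D, c ≤ h s p → p ∈ C)
    (hv : ∀ t ∈ Icc 0 T, HasDerivAt v (v' t) t) (hvpos : ∀ t ∈ Icc 0 T, 0 < v t)
    (h0 : ∀ p ∈ D, h 0 p < v 0)
    (hmax : ∀ t ∈ Ioc 0 T, ∀ p ∈ D, (∀ p' ∈ D, h t p' ≤ h t p) → h t p = v t →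
      ∃ d < v' t, HasDerivWithinAt (fun s => h s p) d (Icc 0 T) t) :
    ∀ t ∈ Icc 0 T, ∀ p ∈ D, h t p < v t := by
  -- The times at which the barrier is reached form a closed set, by compactness of the superlevel
  -- sets above half the barrier. At its least element `h` touches `v` at a spatial maximum, from
  -- below in time, so the left difference quotients of `h - v` are nonnegative; this contradicts `d
  -- < v'`.
  set B : Set ℝ := {t | t ∈ Icc 0 T ∧ ∃ p ∈ D, v t ≤ h t p} with hB
  have hBsub : B ⊆ Icc 0 T := fun t ht => ht.1
  have hBclosed : IsClosed B := by
    refine isClosed_of_closure_subset fun t ht => ?_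
    have htI : t ∈ Icc 0 T := closure_minimal hBsub isClosed_Icc ht
    by_contra htB
    have hno : ∀ p ∈ D, h t p < v t := fun p hp => by
      by_contra hle
      exact htB ⟨htI, p, hp, not_lt.1 hle⟩
    have hvc : ContinuousAt v t := (hv t htI).continuousAt
    obtain ⟨C, hCD, hC, hev⟩ := hcpt t htI (v t / 2) (half_pos (hvpos t htI))
    have h1 : ∀ᶠ s in 𝓝 t, v t / 2 < v s :=
      hvc.eventually (lt_mem_nhds (half_lt_self (hvpos t htI)))
    have h2 : ∀ᶠ s in 𝓝 t, ∀ p ∈ C, s ∈ Icc 0 T → p ∈ D → h s p < v s := by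
      refine hC.eventually_forall_of_forall_eventually fun p hp => ?_
      have hc : ContinuousWithinAt (fun z : ℝ × P => h z.1 z.2 - v z.1) (Icc 0 T ×ˢ D) (t, p) :=
        (hcont (t, p) ⟨htI, hCD hp⟩).sub
          (ContinuousAt.comp (x := (t, p)) hvc continuousAt_fst).continuousWithinAt
      have := hc.eventually (gt_mem_nhds (sub_neg.2 (hno p (hCD hp))))
      rw [eventually_nhdsWithin_iff] at this
      filter_upwards [this] with z hz h1 h2
      exact sub_neg.1 (hz ⟨h1, h2⟩)
    rw [eventually_nhdsWithin_iff] at hev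
    have h3 : ∀ᶠ s in 𝓝 t, s ∉ B := by
      filter_upwards [h1, h2, hev] with s hs1 hs2 hs3 hsB
      obtain ⟨hsI, p, hpD, hle⟩ := hsB
      exact (hs2 p (hs3 hsI p hpD (hs1.le.trans hle)) hsI hpD).not_ge hle
    exact (mem_closure_iff_frequently.1 ht) h3
  intro t ht p hp
  by_contra hle
  have hne : B.Nonempty := ⟨t, ht, p, hp, not_lt.1 hle⟩
  have hbdd : BddBelow B := ⟨0, fun s hs => hs.1.1⟩
  obtain ⟨ht0, q, hq, hqle⟩ : sInf B ∈ B := hBclosed.csInf_mem hne hbdd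
  set τ := sInf B with hτ
  have hτ0 : 0 < τ := by
    rcases ht0.1.eq_or_lt with h | h
    · exact absurd hqle (by rw [← h]; exact (h0 q hq).not_ge)
    · exact h
  have hbefore : ∀ s ∈ Ico 0 τ, ∀ p ∈ D, h s p < v s := fun s hs p hp => by
    by_contra hle'
    exact (csInf_le hbdd ⟨⟨hs.1, hs.2.le.trans ht0.2⟩, p, hp, not_lt.1 hle'⟩).not_gt hs.2
  have hsub : Ico 0 τ ⊆ Icc 0 T := fun s hs => ⟨hs.1, hs.2.le.trans ht0.2⟩
  have : (𝓝[Ico 0 τ] τ).NeBot := by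
    rw [← mem_closure_iff_nhdsWithin_neBot, closure_Ico hτ0.ne]
    exact ⟨hτ0.le, le_rfl⟩
  have hpath : ∀ p ∈ D, Tendsto (fun s => h s p) (𝓝[Icc 0 T] τ) (𝓝 (h τ p)) := fun p hp =>
    (hcont (τ, p) ⟨ht0, hp⟩).tendsto.comp (tendsto_nhdsWithin_iff.2
      ⟨(tendsto_nhds_of_tendsto_nhdsWithin tendsto_id).prodMk_nhds tendsto_const_nhds,
        by filter_upwards [self_mem_nhdsWithin] with s hs using ⟨hs, hp⟩⟩)
  have hle_all : ∀ p ∈ D, h τ p ≤ v τ := fun p hp => by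
    refine le_of_tendsto_of_tendsto ((hpath p hp).mono_left (nhdsWithin_mono _ hsub))
      ((hv τ ht0).continuousAt.tendsto.mono_left nhdsWithin_le_nhds) ?_
    filter_upwards [self_mem_nhdsWithin] with s hs using (hbefore s hs p hp).le
  have heq : h τ q = v τ := le_antisymm (hle_all q hq) hqle
  obtain ⟨d, hd, hder⟩ := hmax τ ⟨hτ0, ht0.2⟩ q hq (fun p hp => heq ▸ hle_all p hp) heq
  have hg : HasDerivWithinAt (fun s => h s q - v s) (d - v' τ) (Ico 0 τ) τ :=
    (hder.mono hsub).sub (hv τ ht0).hasDerivWithinAt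
  rw [hasDerivWithinAt_iff_tendsto_slope' (by simp)] at hg
  have : 0 ≤ d - v' τ := by
    refine ge_of_tendsto hg ?_
    filter_upwards [self_mem_nhdsWithin] with s hs
    rw [slope_def_field, heq, sub_self, sub_zero]
    exact div_nonneg_of_nonpos (by linarith [hbefore s hs q hq]) (by linarith [hs.2])
  linarith

/-- The barrier `(c + ε + (N + ε) t) e^{Lt}` satisfies `v' = L v + (N + ε) e^{Lt} > L v + N`,
strictly because of `ε`; then `ε → 0`. The growth condition is needed only at positive spatial
maxima. -/
theorem le_of_growth {P : Type*} [TopologicalSpace P] {D : Set P} {T : ℝ} {h : ℝ → P → ℝ}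
    {L N c : ℝ} (hL : 0 ≤ L) (hN : 0 ≤ N) (hc : 0 ≤ c)
    (hcont : ContinuousOn (fun z : ℝ × P => h z.1 z.2) (Icc 0 T ×ˢ D))
    (hcpt : ∀ t ∈ Icc 0 T, ∀ c : ℝ, 0 < c → ∃ C ⊆ D, IsCompact C ∧
      ∀ᶠ s in 𝓝[Icc 0 T] t, ∀ p ∈ D, c ≤ h s p → p ∈ C)
    (h0 : ∀ p ∈ D, h 0 p ≤ c)
    (hmax : ∀ t ∈ Ioc 0 T, ∀ p ∈ D, (∀ p' ∈ D, h t p' ≤ h t p) → 0 < h t p →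
      ∃ d ≤ L * h t p + N, HasDerivWithinAt (fun s => h s p) d (Icc 0 T) t) :
    ∀ t ∈ Icc 0 T, ∀ p ∈ D, h t p ≤ (c + N * t) * Real.exp (L * t) := by
  intro t ht p hp
  have key : ∀ ε : ℝ, 0 < ε → h t p ≤ (c + ε + (N + ε) * t) * Real.exp (L * t) := by
    intro ε hε
    refine (lt_of_barrier (v := fun t => (c + ε + (N + ε) * t) * Real.exp (L * t))
      (v' := fun t => (N + ε) * Real.exp (L * t)
        + (c + ε + (N + ε) * t) * (Real.exp (L * t) * L)) hcont hcpt ?_ ?_ ?_ ?_ t ht p hp).le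
    · intro t _
      have h1 : HasDerivAt (fun t : ℝ => c + ε + (N + ε) * t) (N + ε) t := by
        simpa using ((hasDerivAt_id t).const_mul (N + ε)).const_add (c + ε)
      have h2 : HasDerivAt (fun t : ℝ => Real.exp (L * t)) (Real.exp (L * t) * L) t := by
        simpa using ((hasDerivAt_id t).const_mul L).exp
      exact h1.mul h2
    · intro t ht
      have := ht.1
      positivity
    · intro p hp
      have := h0 p hp
      simp only [mul_zero, add_zero, Real.exp_zero, mul_one]
      linarith
    · intro t ht p hp hm heq
      have h1 : (1 : ℝ) ≤ Real.exp (L * t) := Real.one_le_exp (mul_nonneg hL ht.1.le)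
      have hpos : 0 < h t p := by
        rw [heq]
        have := ht.1
        positivity
      obtain ⟨d, hd, hder⟩ := hmax t ht p hp hm hpos
      refine ⟨d, lt_of_le_of_lt hd ?_, hder⟩
      rw [heq]
      nlinarith
  have hlim : Tendsto (fun ε : ℝ => (c + ε + (N + ε) * t) * Real.exp (L * t)) (𝓝[>] 0)
      (𝓝 ((c + 0 + (N + 0) * t) * Real.exp (L * t))) := by
    apply Tendsto.mono_left _ nhdsWithin_le_nhds
    apply Continuous.tendsto
    fun_prop
  simp only [add_zero] at hlim
  refine ge_of_tendsto hlim ?_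
  filter_upwards [self_mem_nhdsWithin] with ε hε using key ε hε

/-! ### The quadrant and the class `𝒳` -/

theorem isClosed_quadrant : IsClosed quadrant :=
  (isClosed_le continuous_const continuous_fst).inter
    (isClosed_le continuous_const continuous_snd)

theorem quadrant_eq : quadrant = Ici (0 : ℝ) ×ˢ Ici (0 : ℝ) := by
  ext ⟨a, b⟩
  simp [quadrant]

theorem uniqueDiffOn_quadrant : UniqueDiffOn ℝ quadrant := by
  rw [quadrant_eq]
  exact (uniqueDiffOn_Ici 0).prod (uniqueDiffOn_Ici 0)

/-- Derivatives within the quadrant are unique up to its boundary, so the one-sided gradient does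
not depend on the extension by which it is computed. -/
theorem gradQ_eq_fderiv {f g : ℝ × ℝ → ℝ} {x : ℝ × ℝ} (hg : DifferentiableAt ℝ g x)
    (hfg : ∀ᶠ y in 𝓝[quadrant] x, f y = g y) (hx : x ∈ quadrant) :
    gradQ f x = fderiv ℝ g x := by
  have : f =ᶠ[𝓝[quadrant] x] g := hfg
  rw [gradQ, this.fderivWithin_eq (this.self_of_nhdsWithin hx),
    hg.fderivWithin (uniqueDiffOn_quadrant x hx)]

theorem gradQ_eq_fderiv_of_eqOn {f g : ℝ × ℝ → ℝ} (hg : Differentiable ℝ g)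
    (hfg : EqOn f g quadrant) {x : ℝ × ℝ} (hx : x ∈ quadrant) :
    gradQ f x = fderiv ℝ g x :=
  gradQ_eq_fderiv (hg x) (by filter_upwards [self_mem_nhdsWithin] with y hy using hfg hy) hx

theorem gradQ_congr {f g : ℝ × ℝ → ℝ} (hfg : EqOn f g quadrant) {x : ℝ × ℝ}
    (hx : x ∈ quadrant) : gradQ f x = gradQ g x :=
  fderivWithin_congr hfg (hfg hx)

/-- The part of the quadrant off the axis `x₁ = 0`. -/
def offAxis : Set (ℝ × ℝ) := {x | 0 < x.1 ∧ 0 ≤ x.2}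

theorem offAxis_subset : offAxis ⊆ quadrant := fun _ hx => ⟨hx.1.le, hx.2⟩

theorem classX.exists_compact {f : ℝ × ℝ → ℝ} (hf : f ∈ classX) :
    ∃ C ⊆ offAxis, IsCompact C ∧ ∀ x ∈ quadrant, x ∉ C → f x = 0 := by
  obtain ⟨g, -, hcs, hsub, heq⟩ := hf
  refine ⟨tsupport g ∩ quadrant, fun x hx => ⟨hsub hx.1, hx.2.2⟩,
    hcs.isCompact.inter_right isClosed_quadrant, fun x hx hxC => ?_⟩
  rw [heq hx]
  by_contra h
  exact hxC ⟨subset_tsupport g h, hx⟩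

theorem classX.continuousOn {f : ℝ × ℝ → ℝ} (hf : f ∈ classX) : ContinuousOn f quadrant := by
  obtain ⟨g, hg, -, -, heq⟩ := hf
  exact hg.continuous.continuousOn.congr heq

theorem classX.eq_zero_of_fst_eq_zero {f : ℝ × ℝ → ℝ} (hf : f ∈ classX) {x : ℝ × ℝ}
    (hx : x ∈ quadrant) (h0 : x.1 = 0) : f x = 0 := by
  obtain ⟨C, hC, -, hz⟩ := classX.exists_compact hf
  exact hz x hx fun hxC => (hC hxC).1.ne' h0

theorem classX.exists_bound {f : ℝ × ℝ → ℝ} (hf : f ∈ classX) :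
    ∃ M, 0 ≤ M ∧ ∀ x ∈ quadrant, |f x| ≤ M ∧ ‖gradQ f x‖ ≤ M := by
  obtain ⟨g, hg, hcs, -, heq⟩ := hf
  obtain ⟨M₁, h₁⟩ := hcs.exists_bound_of_continuous hg.continuous
  obtain ⟨M₂, h₂⟩ := (hcs.fderiv (𝕜 := ℝ)).exists_bound_of_continuous
    (hg.continuous_fderiv one_ne_zero)
  refine ⟨max M₁ M₂, ((norm_nonneg _).trans (h₁ 0)).trans (le_max_left _ _), fun x hx => ⟨?_, ?_⟩⟩
  · rw [heq hx]
    exact (h₁ x).trans (le_max_left _ _)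
  · rw [gradQ_eq_fderiv_of_eqOn (hg.differentiable one_ne_zero) heq hx]
    exact (h₂ x).trans (le_max_right _ _)

/-- The velocity is tangent to both axes: a step `s` along it multiplies the coordinates by `1 - s
q` and `1 + s q`. Thus the test for an extremum along the velocity works with two-sided derivatives
at boundary points too. -/
theorem quadrant_line_mem {x : ℝ × ℝ} (hx : x ∈ quadrant) (q : ℝ) :
    ∀ᶠ s in 𝓝 (0 : ℝ), x + s • (-(x.1 * q), x.2 * q) ∈ quadrant := by
  have h1 : ∀ᶠ s in 𝓝 (0 : ℝ), 0 < 1 - s * q := by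
    apply (Continuous.tendsto (by fun_prop) (0 : ℝ)).eventually (lt_mem_nhds _)
    simp
  have h2 : ∀ᶠ s in 𝓝 (0 : ℝ), 0 < 1 + s * q := by
    apply (Continuous.tendsto (by fun_prop) (0 : ℝ)).eventually (lt_mem_nhds _)
    simp
  filter_upwards [h1, h2] with s hs1 hs2
  refine ⟨?_, ?_⟩
  · have := mul_nonneg hx.1 hs1.le
    simp only [Prod.smul_mk, smul_eq_mul, Prod.fst_add]
    linarith
  · have := mul_nonneg hx.2 hs2.le
    simp only [Prod.smul_mk, smul_eq_mul, Prod.snd_add]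
    linarith

theorem classX.hasDerivAt_line {f : ℝ × ℝ → ℝ} (hf : f ∈ classX) {x : ℝ × ℝ}
    (hx : x ∈ quadrant) (q : ℝ) :
    HasDerivAt (fun s : ℝ => f (x + s • (-(x.1 * q), x.2 * q)))
      (gradQ f x (-(x.1 * q), x.2 * q)) 0 := by
  obtain ⟨g, hg, -, -, heq⟩ := hf
  rw [gradQ_eq_fderiv_of_eqOn (hg.differentiable one_ne_zero) heq hx]
  have h1 : HasDerivAt (fun s : ℝ => x + s • (-(x.1 * q), x.2 * q)) (-(x.1 * q), x.2 * q) 0 := by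
    simpa using ((hasDerivAt_id (0 : ℝ)).smul_const (-(x.1 * q), x.2 * q)).const_add x
  have h2 : HasFDerivAt g (fderiv ℝ g x) (x + (0 : ℝ) • (-(x.1 * q), x.2 * q)) := by
    simpa using (hg.differentiable one_ne_zero x).hasFDerivAt
  refine (h2.comp_hasDerivAt (0 : ℝ) h1).congr_of_eventuallyEq ?_
  filter_upwards [quadrant_line_mem hx q] with s hs using heq hs

theorem ContinuousIntoX.continuousOn {I : Set ℝ} {f : ℝ → ℝ × ℝ → ℝ} (hf : ContinuousIntoX I f) :
    ContinuousOn (fun z : ℝ × (ℝ × ℝ) => f z.1 z.2) (I ×ˢ quadrant) := by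
  rintro ⟨t, x⟩ ⟨ht, hx⟩
  rw [Metric.continuousWithinAt_iff']
  intro ε hε
  have hu := Metric.tendstoUniformlyOn_iff.1 (hf.2 t ht).1 (ε / 2) (half_pos hε)
  have hc := Metric.continuousWithinAt_iff'.1 (classX.continuousOn (hf.1 t ht) x hx) (ε / 2)
    (half_pos hε)
  rw [nhdsWithin_prod_eq]
  filter_upwards [(hu.prod_mk hc), prod_mem_prod (f := 𝓝[I] t) self_mem_nhdsWithin
    (self_mem_nhdsWithin (s := quadrant) (a := x))] with z hz hzmem
  have h1 := hz.1 z.2 hzmem.2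
  have h2 := hz.2
  rw [dist_comm] at h1
  calc dist (f z.1 z.2) (f t x) ≤ dist (f z.1 z.2) (f t z.2) + dist (f t z.2) (f t x) :=
        dist_triangle _ _ _
    _ < ε := by linarith

theorem ContinuousIntoX.mono {I J : Set ℝ} {f : ℝ → ℝ × ℝ → ℝ} (hf : ContinuousIntoX I f)
    (hJ : J ⊆ I) : ContinuousIntoX J f :=
  ⟨fun t ht => hf.1 t (hJ ht), fun t ht =>
    ⟨fun u hu => ((hf.2 t (hJ ht)).1 u hu).filter_mono (nhdsWithin_mono _ hJ),
      fun u hu => ((hf.2 t (hJ ht)).2 u hu).filter_mono (nhdsWithin_mono _ hJ)⟩⟩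

theorem IsSolution.mono {α : ℝ} {I J : Set ℝ} {ω ρ : ℝ → ℝ × ℝ → ℝ} (h : IsSolution α I ω ρ)
    (hJ : J ⊆ I) : IsSolution α J ω ρ where
  vorticity_continuous := h.vorticity_continuous.mono hJ
  density_continuous := h.density_continuous.mono hJ
  vorticity_eq t ht x hx := (h.vorticity_eq t (hJ ht) x hx).mono hJ
  density_eq t ht x hx := (h.density_eq t (hJ ht) x hx).mono hJ

theorem ContinuousIntoX.exists_bound {I : Set ℝ} {f : ℝ → ℝ × ℝ → ℝ} (hf : ContinuousIntoX I f)
    (hI : IsCompact I) :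
    ∃ M, 0 ≤ M ∧ ∀ t ∈ I, ∀ x ∈ quadrant, |f t x| ≤ M ∧ ‖gradQ (f t) x‖ ≤ M := by
  refine hI.induction_on (p := fun J => ∃ M, 0 ≤ M ∧ ∀ t ∈ J, ∀ x ∈ quadrant,
    |f t x| ≤ M ∧ ‖gradQ (f t) x‖ ≤ M) ⟨0, le_rfl, by simp⟩ ?_ ?_ ?_
  · rintro s t hst ⟨M, hM, h⟩
    exact ⟨M, hM, fun r hr => h r (hst hr)⟩
  · rintro s t ⟨M, hM, h⟩ ⟨M', hM', h'⟩
    refine ⟨max M M', hM.trans (le_max_left _ _), fun r hr x hx => ?_⟩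
    rcases hr with hr | hr
    · exact ⟨(h r hr x hx).1.trans (le_max_left _ _), (h r hr x hx).2.trans (le_max_left _ _)⟩
    · exact ⟨(h' r hr x hx).1.trans (le_max_right _ _), (h' r hr x hx).2.trans (le_max_right _ _)⟩
  · intro t ht
    obtain ⟨M, hM, hb⟩ := classX.exists_bound (hf.1 t ht)
    have h1 := Metric.tendstoUniformlyOn_iff.1 (hf.2 t ht).1 1 one_pos
    have h2 := Metric.tendstoUniformlyOn_iff.1 (hf.2 t ht).2 1 one_pos
    refine ⟨_, h1.and h2, M + 1, by linarith, fun s hs x hx => ⟨?_, ?_⟩⟩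
    · have := hs.1 x hx
      rw [dist_comm, Real.dist_eq] at this
      have h3 := abs_sub_abs_le_abs_sub (f s x) (f t x)
      linarith [(hb x hx).1]
    · have := hs.2 x hx
      rw [dist_comm, dist_eq_norm] at this
      have h3 := norm_sub_norm_le (gradQ (f s) x) (gradQ (f t) x)
      linarith [(hb x hx).2]


/-! ### Weighted maximum principle for the transport equation -/

/-- Continuity into `𝒳` provides no common support for nearby times. Uniform convergence does
control superlevel sets, and the support at time `t` serves for every level `c > 0`. -/
theorem ContinuousIntoX.exists_compact {I : Set ℝ} {f : ℝ → ℝ × ℝ → ℝ} (hf : ContinuousIntoX I f)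
    {t : ℝ} (ht : t ∈ I) :
    ∃ C ⊆ offAxis, IsCompact C ∧ ∀ c : ℝ, 0 < c → ∀ᶠ s in 𝓝[I] t, ∀ x ∈ quadrant,
      c ≤ |f s x| → x ∈ C := by
  obtain ⟨C, hCsub, hC, hz⟩ := classX.exists_compact (hf.1 t ht)
  refine ⟨C, hCsub, hC, fun c hc => ?_⟩
  filter_upwards [Metric.tendstoUniformlyOn_iff.1 (hf.2 t ht).1 c hc] with s hs x hx hle
  by_contra hxC
  have := hs x hx
  rw [hz x hx hxC, Real.dist_eq, zero_sub, abs_neg] at this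
  exact this.not_ge hle

/-- A bound for a weighted solution of a transport equation with velocity `(-x₁ q, x₂ q)`. -/
theorem weighted_transport_le {T σ c N : ℝ} (hc : 0 ≤ c) (hN : 0 ≤ N)
    {f S q φ : ℝ → ℝ × ℝ → ℝ} (hf : ContinuousIntoX (Icc 0 T) f)
    (hder : ∀ t ∈ Icc 0 T, ∀ x ∈ quadrant, HasDerivWithinAt (fun s => f s x)
      (S t x - gradQ (f t) x (-(x.1 * q t x), x.2 * q t x)) (Icc 0 T) t)
    (hφc : ContinuousOn (fun z : ℝ × (ℝ × ℝ) => φ z.1 z.2) (Icc 0 T ×ˢ offAxis))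
    (hφ0 : ∀ t x, 0 ≤ φ t x) (hφ1 : ∀ t x, φ t x ≤ 1)
    (h0 : ∀ x ∈ offAxis, σ * (f 0 x * φ 0 x) ≤ c)
    (hφ : ∀ t ∈ Ioc 0 T, ∀ x ∈ offAxis, 0 < σ * (f t x * φ t x) → ∃ a b,
      HasDerivWithinAt (fun s => φ s x) a (Icc 0 T) t ∧
      HasDerivAt (fun s : ℝ => φ t (x + s • (-(x.1 * q t x), x.2 * q t x))) b 0 ∧
      σ * (S t x * φ t x + f t x * (a + b)) ≤ N) :
    ∀ t ∈ Icc 0 T, ∀ x ∈ offAxis, σ * (f t x * φ t x) ≤ c + N * t := by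
  have key := le_of_growth (D := offAxis) (T := T) (h := fun t x => σ * (f t x * φ t x))
    (L := 0) (N := N) (c := c) le_rfl hN hc ?_ ?_ h0 ?_
  · simpa using key
  · exact continuousOn_const.mul ((hf.continuousOn.mono
      (prod_mono_right offAxis_subset)).mul hφc)
  · intro t ht c hc
    obtain ⟨C, hCsub, hC, hev⟩ := hf.exists_compact ht
    have hσ : (0 : ℝ) < |σ| + 1 := by positivity
    refine ⟨C, hCsub, hC, ?_⟩
    filter_upwards [hev (c / (|σ| + 1)) (by positivity)] with s hs x hx hle
    refine hs x (offAxis_subset hx) ?_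
    rw [div_le_iff₀ hσ]
    calc c ≤ |σ * (f s x * φ s x)| := hle.trans (le_abs_self _)
      _ = |f s x| * (|σ| * φ s x) := by
        rw [abs_mul, abs_mul, abs_of_nonneg (hφ0 s x)]
        ring
      _ ≤ |f s x| * (|σ| + 1) := by
        refine mul_le_mul_of_nonneg_left ?_ (abs_nonneg _)
        nlinarith [hφ1 s x, abs_nonneg σ, hφ0 s x]
  · intro t ht x hx hm hpos
    have htI : t ∈ Icc 0 T := ⟨ht.1.le, ht.2⟩
    have hxq := offAxis_subset hx
    obtain ⟨a, b, ha, hb, hab⟩ := hφ t ht x hx hpos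
    have hline := classX.hasDerivAt_line (hf.1 t htI) hxq (q t x)
    have hprod := (hline.mul hb).const_mul σ
    -- Maximality along the line in the direction of the velocity makes the derivative of the
    -- product `f φ` vanish in that direction. This trades the transport term `-(u · ∇f) φ` for `f
    -- b`.
    have hmaxl : IsLocalMax (fun s : ℝ => σ * (f t (x + s • (-(x.1 * q t x), x.2 * q t x)) *
        φ t (x + s • (-(x.1 * q t x), x.2 * q t x)))) 0 := by
      have hpos1 : ∀ᶠ s in 𝓝 (0 : ℝ), 0 < (x + s • (-(x.1 * q t x), x.2 * q t x)).1 := by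
        apply (Continuous.tendsto (by fun_prop) (0 : ℝ)).eventually (lt_mem_nhds _)
        simpa using hx.1
      filter_upwards [quadrant_line_mem hxq (q t x), hpos1] with s hs hs1
      simpa using hm _ ⟨hs1, hs.2⟩
    have hzero := hmaxl.hasDerivAt_eq_zero hprod
    simp only [zero_smul, add_zero] at hzero
    refine ⟨_, ?_, ((hder t htI x hxq).mul ha).const_mul σ⟩
    simp only [zero_mul, zero_add]
    linarith

theorem smoothTransition_deriv_nonneg (s : ℝ) : 0 ≤ deriv Real.smoothTransition s :=
  Real.smoothTransition.monotone.deriv_nonneg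

theorem smoothTransition_hasDerivAt (s : ℝ) :
    HasDerivAt Real.smoothTransition (deriv Real.smoothTransition s) s :=
  ((Real.smoothTransition.contDiff (n := 1)).differentiable one_ne_zero s).hasDerivAt

/-- A function transported by `(-x₁ q, x₂ q)` keeps vanishing on `{lam > L₀}` when `lam` does not
increase along the flow. -/
theorem transport_eq_zero_of_level {T L₀ : ℝ} {f S q lam : ℝ → ℝ × ℝ → ℝ}
    (hf : ContinuousIntoX (Icc 0 T) f)
    (hder : ∀ t ∈ Icc 0 T, ∀ x ∈ quadrant, HasDerivWithinAt (fun s => f s x)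
      (S t x - gradQ (f t) x (-(x.1 * q t x), x.2 * q t x)) (Icc 0 T) t)
    (hlamc : ContinuousOn (fun z : ℝ × (ℝ × ℝ) => lam z.1 z.2) (Icc 0 T ×ˢ offAxis))
    (h0 : ∀ x ∈ offAxis, L₀ < lam 0 x → f 0 x = 0)
    (hS : ∀ t ∈ Icc 0 T, ∀ x ∈ offAxis, L₀ < lam t x → S t x = 0)
    (hlam : ∀ t ∈ Ioc 0 T, ∀ x ∈ offAxis, L₀ < lam t x → f t x ≠ 0 → ∃ a b,
      HasDerivWithinAt (fun s => lam s x) a (Icc 0 T) t ∧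
      HasDerivAt (fun s : ℝ => lam t (x + s • (-(x.1 * q t x), x.2 * q t x))) b 0 ∧
      a + b ≤ 0) :
    ∀ t ∈ Icc 0 T, ∀ x ∈ offAxis, L₀ < lam t x → f t x = 0 := by
  -- The weight is positive exactly where `lam > L₀`, and it is monotone in `lam`, so it does not
  -- increase along the flow. The bound `0` with both signs of `σ` forces `f` to vanish there.
  have key : ∀ σ : ℝ, ∀ t ∈ Icc 0 T, ∀ x ∈ offAxis,
      σ * (f t x * Real.smoothTransition (lam t x - L₀)) ≤ 0 := by
    intro σ
    have := weighted_transport_le (σ := σ) (c := 0) (N := 0)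
      (φ := fun t x => Real.smoothTransition (lam t x - L₀)) le_rfl le_rfl hf hder
      (Real.smoothTransition.continuous.comp_continuousOn (hlamc.sub continuousOn_const))
      (fun _ _ => Real.smoothTransition.nonneg _) (fun _ _ => Real.smoothTransition.le_one _) ?_ ?_
    · simpa using this
    · intro x hx
      rcases le_or_gt (lam 0 x) L₀ with h | h
      · rw [Real.smoothTransition.zero_of_nonpos (by linarith)]
        simp
      · rw [h0 x hx h]
        simp
    · intro t ht x hx hpos
      have hgt : L₀ < lam t x := by
        by_contra hle
        rw [Real.smoothTransition.zero_of_nonpos (by linarith)] at hpos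
        simp at hpos
      have hne : f t x ≠ 0 := fun h => by simp [h] at hpos
      obtain ⟨a, b, ha, hb, hab⟩ := hlam t ht x hx hgt hne
      have hψ := smoothTransition_hasDerivAt (lam t x - L₀)
      refine ⟨deriv Real.smoothTransition (lam t x - L₀) * a,
        deriv Real.smoothTransition (lam t x - L₀) * b, ?_, ?_, ?_⟩
      · exact hψ.comp_hasDerivWithinAt (h := fun s => lam s x - L₀) t (ha.sub_const _)
      · have hψ' : HasDerivAt Real.smoothTransition (deriv Real.smoothTransition (lam t x - L₀))
            (lam t (x + (0 : ℝ) • (-(x.1 * q t x), x.2 * q t x)) - L₀) := by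
          simpa using hψ
        exact hψ'.comp (h := fun s : ℝ =>
          lam t (x + s • (-(x.1 * q t x), x.2 * q t x)) - L₀) (0 : ℝ) (hb.sub_const L₀)
      · rw [hS t ⟨ht.1.le, ht.2⟩ x hx hgt, zero_mul, zero_add, ← mul_add, ← mul_assoc]
        have hσf : 0 < σ * f t x := by
          rw [← mul_assoc] at hpos
          exact pos_of_mul_pos_left hpos (Real.smoothTransition.nonneg _)
        rw [← mul_assoc]
        exact mul_nonpos_of_nonneg_of_nonpos
          (mul_nonneg hσf.le (smoothTransition_deriv_nonneg _)) hab
  intro t ht x hx hgt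
  have hpos : 0 < Real.smoothTransition (lam t x - L₀) :=
    Real.smoothTransition.pos_of_pos (by linarith)
  have h1 := key 1 t ht x hx
  have h2 := key (-1) t ht x hx
  have : f t x * Real.smoothTransition (lam t x - L₀) = 0 := by linarith
  exact (mul_eq_zero.1 this).resolve_right hpos.ne'

/-- Solutions keep vanishing on `{lam > L₀}` when `lam` does not increase along the flow. -/
theorem IsSolution.eq_zero_of_level {α T L₀ : ℝ} {ω ρ lam : ℝ → ℝ × ℝ → ℝ}
    (h : IsSolution α (Icc 0 T) ω ρ)
    (hlamc : ContinuousOn (fun z : ℝ × (ℝ × ℝ) => lam z.1 z.2) (Icc 0 T ×ˢ offAxis))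
    (h0 : ∀ x ∈ offAxis, L₀ < lam 0 x → ω 0 x = 0 ∧ ρ 0 x = 0)
    (hlam : ∀ t ∈ Ioc 0 T, ∀ x ∈ offAxis, L₀ < lam t x → (ω t x ≠ 0 ∨ ρ t x ≠ 0) → ∃ a b,
      HasDerivWithinAt (fun s => lam s x) a (Icc 0 T) t ∧
      HasDerivAt (fun s : ℝ => lam t (x + s • velocity α (ω t) x)) b 0 ∧
      a + b ≤ 0) :
    ∀ t ∈ Icc 0 T, ∀ x ∈ offAxis, L₀ < lam t x → ω t x = 0 ∧ ρ t x = 0 := by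
  -- The density comes first: once it vanishes on the superlevel set, so does the source of the
  -- vorticity equation.
  have hρ := transport_eq_zero_of_level (S := fun _ _ => 0) (q := fun t x => Q α (ω t) x)
    h.density_continuous (fun t ht x hx => by simpa [velocity] using h.density_eq t ht x hx)
    hlamc (fun x hx hl => (h0 x hx hl).2) (fun _ _ _ _ _ => rfl)
    (fun t ht x hx hl hne => hlam t ht x hx hl (Or.inr hne))
  have hω := transport_eq_zero_of_level (S := fun t x => ρ t x / x.1)
    (q := fun t x => Q α (ω t) x)
    h.vorticity_continuous (fun t ht x hx => h.vorticity_eq t ht x hx)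
    hlamc (fun x hx hl => (h0 x hx hl).1)
    (fun t ht x hx hl => by rw [hρ t ht x hx hl, zero_div])
    (fun t ht x hx hl hne => hlam t ht x hx hl (Or.inl hne))
  exact fun t ht x hx hl => ⟨hω t ht x hx hl, hρ t ht x hx hl⟩

/-- The product `x₁ x₂` is conserved along the flow. -/
theorem IsSolution.eq_zero_of_prod_gt {α T c₀ : ℝ} {ω ρ : ℝ → ℝ × ℝ → ℝ}
    (h : IsSolution α (Icc 0 T) ω ρ)
    (h0 : ∀ x ∈ quadrant, c₀ < x.1 * x.2 → ω 0 x = 0 ∧ ρ 0 x = 0) :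
    ∀ t ∈ Icc 0 T, ∀ x ∈ offAxis, c₀ < x.1 * x.2 → ω t x = 0 ∧ ρ t x = 0 := by
  refine h.eq_zero_of_level (lam := fun _ x => x.1 * x.2) (by fun_prop)
    (fun x hx => h0 x (offAxis_subset hx)) fun t ht x hx _ _ => ⟨0, 0, ?_, ?_, by simp⟩
  · exact hasDerivWithinAt_const _ _ _
  · have h1 : HasDerivAt (fun s : ℝ => x.1 + s * (velocity α (ω t) x).1)
        (velocity α (ω t) x).1 0 := by
      simpa using ((hasDerivAt_id (0 : ℝ)).mul_const _).const_add x.1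
    have h2 : HasDerivAt (fun s : ℝ => x.2 + s * (velocity α (ω t) x).2)
        (velocity α (ω t) x).2 0 := by
      simpa using ((hasDerivAt_id (0 : ℝ)).mul_const _).const_add x.2
    refine (h1.mul h2).congr_deriv ?_
    simp only [zero_mul, add_zero, velocity]
    ring


/-! ### Bounds for the nonlocal operator `Q` -/

/-- The kernel of `Q`. -/
noncomputable def kern (y : ℝ × ℝ) : ℝ := y.1 * y.2 / (y.1 ^ 2 + y.2 ^ 2) ^ 2

theorem Q_eq (α : ℝ) (w : ℝ × ℝ → ℝ) (x : ℝ × ℝ) :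
    Q α w x = ∫ y in {y : ℝ × ℝ | y - x ∈ sector α}, kern y * w y := rfl

theorem kern_nonneg {y : ℝ × ℝ} (hy : y ∈ quadrant) : 0 ≤ kern y :=
  div_nonneg (mul_nonneg hy.1 hy.2) (by positivity)

theorem measurable_kern : Measurable kern := by
  unfold kern
  fun_prop

theorem measurableSet_sector_add (α : ℝ) (x : ℝ × ℝ) :
    MeasurableSet {y : ℝ × ℝ | y - x ∈ sector α} := by
  have : IsClosed {y : ℝ × ℝ | y - x ∈ sector α} := by
    refine IsClosed.preimage (f := fun y : ℝ × ℝ => y - x) (by fun_prop) ?_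
    exact (isClosed_le continuous_const continuous_fst).inter
      ((isClosed_le continuous_const continuous_snd).inter
        (isClosed_le continuous_snd (by fun_prop)))
  exact this.measurableSet

theorem sector_add_subset {α : ℝ} {x : ℝ × ℝ} (hx : x ∈ quadrant) :
    {y : ℝ × ℝ | y - x ∈ sector α} ⊆ Ici x.1 ×ˢ Ici (0 : ℝ) := by
  rintro y ⟨h1, h2, -⟩
  simp only [Prod.fst_sub, Prod.snd_sub, sub_nonneg] at h1 h2
  exact ⟨h1, hx.2.trans h2⟩

theorem sector_add_subset_quadrant {α : ℝ} {x : ℝ × ℝ} (hx : x ∈ quadrant) :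
    {y : ℝ × ℝ | y - x ∈ sector α} ⊆ quadrant := fun _ hy =>
  ⟨hx.1.trans (sector_add_subset hx hy).1, (sector_add_subset hx hy).2⟩

theorem Q_congr {α : ℝ} {w w' : ℝ × ℝ → ℝ} (h : EqOn w w' quadrant) {x : ℝ × ℝ}
    (hx : x ∈ quadrant) : Q α w x = Q α w' x :=
  setIntegral_congr_fun (measurableSet_sector_add α x) fun y hy => by
    simp only [h (sector_add_subset_quadrant hx hy)]

theorem velocity_congr {α : ℝ} {w w' : ℝ × ℝ → ℝ} (h : EqOn w w' quadrant) {x : ℝ × ℝ}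
    (hx : x ∈ quadrant) : velocity α w x = velocity α w' x := by
  rw [velocity, velocity, Q_congr h hx]

/-- In the second variable the kernel has the primitive `-(a / 2) / (a ^ 2 + b ^ 2)`. The resulting
mass `1 / (2a)` of a vertical line is the origin of the logarithm in the bound for `Q`. -/
theorem lintegral_kern_slice {a : ℝ} (ha : 0 < a) :
    ∫⁻ b in Ici (0 : ℝ), ENNReal.ofReal (kern (a, b)) = ENNReal.ofReal (1 / (2 * a)) := by
  have hder : ∀ b ∈ Ici (0 : ℝ), HasDerivAt (fun b => -(a / 2) / (a ^ 2 + b ^ 2)) (kern (a, b)) b := by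
    intro b _
    have hne : a ^ 2 + b ^ 2 ≠ 0 := by positivity
    have h1 : HasDerivAt (fun b : ℝ => a ^ 2 + b ^ 2) (2 * b) b := by
      simpa using (hasDerivAt_pow 2 b).const_add (a ^ 2)
    refine ((hasDerivAt_const b (-(a / 2))).div h1 hne).congr_deriv ?_
    simp only [kern]
    field_simp
    ring
  have hpos : ∀ b ∈ Ioi (0 : ℝ), 0 ≤ kern (a, b) := fun b hb =>
    kern_nonneg ⟨ha.le, (mem_Ioi.1 hb).le⟩
  have hlim : Tendsto (fun b => -(a / 2) / (a ^ 2 + b ^ 2)) atTop (𝓝 0) := by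
    apply Tendsto.div_atTop tendsto_const_nhds
    exact tendsto_atTop_add_const_left _ _ (tendsto_pow_atTop two_ne_zero)
  have hint := integrableOn_Ioi_deriv_of_nonneg' hder hpos hlim
  have hval := integral_Ioi_of_hasDerivAt_of_nonneg' hder hpos hlim
  rw [setLIntegral_congr Ioi_ae_eq_Ici.symm, ← ofReal_integral_eq_lintegral_ofReal hint
    ((ae_restrict_iff' measurableSet_Ioi).2 (Eventually.of_forall hpos)), hval]
  congr 1
  field_simp
  ring

theorem lintegral_kern_strip {a b : ℝ} (ha : 0 < a) (hab : a ≤ b) :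
    ∫⁻ y in Ico a b ×ˢ Ici (0 : ℝ), ENNReal.ofReal (kern y) =
      ENNReal.ofReal (Real.log (b / a) / 2) := by
  rw [Measure.volume_eq_prod, setLIntegral_prod _ measurable_kern.ennreal_ofReal.aemeasurable]
  have h1 : ∫⁻ r in Ico a b, ∫⁻ s in Ici (0 : ℝ), ENNReal.ofReal (kern (r, s)) =
      ∫⁻ r in Ico a b, ENNReal.ofReal (1 / (2 * r)) :=
    setLIntegral_congr_fun measurableSet_Ico fun r hr => lintegral_kern_slice (ha.trans_le hr.1)
  rw [h1, setLIntegral_congr Ico_ae_eq_Ioc]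
  have hcont : ContinuousOn (fun r : ℝ => 1 / (2 * r)) (uIcc a b) := by
    refine continuousOn_const.div (by fun_prop) fun r hr => ?_
    rw [uIcc_of_le hab] at hr
    have := ha.trans_le hr.1
    positivity
  have hint : IntegrableOn (fun r : ℝ => 1 / (2 * r)) (Ioc a b) :=
    (intervalIntegrable_iff_integrableOn_Ioc_of_le hab).1 hcont.intervalIntegrable
  rw [← ofReal_integral_eq_lintegral_ofReal hint ((ae_restrict_iff' measurableSet_Ioc).2
    (Eventually.of_forall fun r hr => by have := ha.trans hr.1; simp only [Pi.zero_apply]; positivity)),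
    ← intervalIntegral.integral_of_le hab]
  have h2 : ∫ r in a..b, 1 / (2 * r) = ∫ r in a..b, (1 / 2) * r⁻¹ := by
    congr 1
    ext r
    rw [one_div, mul_inv]
    ring
  rw [h2, intervalIntegral.integral_const_mul, integral_inv_of_pos ha (ha.trans_le hab)]
  congr 1
  ring

/-- The majorant of the kernel on `{y₁ y₂ ≤ c₀}`. -/
noncomputable def tailConst (k c₀ : ℝ) : ℝ :=
  (∫⁻ y in Ici k ×ˢ Ici (0 : ℝ), ENNReal.ofReal (c₀ / (y.1 ^ 2 + y.2 ^ 2) ^ 2)).toReal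

theorem tailConst_nonneg (k c₀ : ℝ) : 0 ≤ tailConst k c₀ := ENNReal.toReal_nonneg

/-- The kernel itself has infinite mass on `{y₁ ≥ k}`, by the logarithm above. On `{y₁ y₂ ≤ c₀}` it
is at most `c₀ / |y| ^ 4`, which is integrable there. With `m = 1 + 1 / k ^ 2`, both `1 + y₁ ^ 2`
and `1 + y₂ ^ 2` are at most `m |y| ^ 2`, which gives a product majorant. -/
theorem lintegral_tail_lt_top {k c₀ : ℝ} (hk : 0 < k) (hc₀ : 0 ≤ c₀) :
    ∫⁻ y in Ici k ×ˢ Ici (0 : ℝ), ENNReal.ofReal (c₀ / (y.1 ^ 2 + y.2 ^ 2) ^ 2) < ⊤ := by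
  set m : ℝ := 1 + 1 / k ^ 2 with hm
  have hint : Integrable (fun y : ℝ × ℝ => c₀ * m ^ 2 * ((1 + y.1 ^ 2)⁻¹ * (1 + y.2 ^ 2)⁻¹)) :=
    (integrable_inv_one_add_sq.mul_prod integrable_inv_one_add_sq).const_mul _
  refine lt_of_le_of_lt ?_ (hint.integrableOn (s := Ici k ×ˢ Ici (0 : ℝ))).lintegral_lt_top
  refine setLIntegral_mono (by fun_prop) fun y hy => ENNReal.ofReal_le_ofReal ?_
  have hy1 : k ≤ y.1 := hy.1
  have hy1' : 0 < y.1 := hk.trans_le hy1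
  have hk2 : (1 : ℝ) ≤ 1 / k ^ 2 * y.1 ^ 2 := by
    rw [one_div, inv_mul_eq_div, le_div_iff₀ (by positivity), one_mul]
    exact pow_le_pow_left₀ hk.le hy1 2
  have hk0 : 0 ≤ 1 / k ^ 2 := by positivity
  have h1 : 1 + y.1 ^ 2 ≤ m * (y.1 ^ 2 + y.2 ^ 2) := by
    have := mul_nonneg hk0 (sq_nonneg y.2)
    nlinarith [sq_nonneg y.2]
  have h2 : 1 + y.2 ^ 2 ≤ m * (y.1 ^ 2 + y.2 ^ 2) := by
    have := mul_nonneg hk0 (sq_nonneg y.2)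
    nlinarith [sq_nonneg y.1]
  have h3 : (1 + y.1 ^ 2) * (1 + y.2 ^ 2) ≤ m ^ 2 * (y.1 ^ 2 + y.2 ^ 2) ^ 2 := by
    rw [← mul_pow, pow_two (m * (y.1 ^ 2 + y.2 ^ 2))]
    exact mul_le_mul h1 h2 (by positivity) (by positivity)
  rw [← mul_inv, ← div_eq_mul_inv, div_le_div_iff₀ (by positivity) (by positivity), mul_assoc]
  exact mul_le_mul_of_nonneg_left h3 hc₀

/-- The domain of integration is split at `y₁ = k`. Beyond `k` the restriction `y₁ y₂ ≤ c₀` on the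
support makes the kernel integrable; between `x₁` and `k` the kernel has mass at most `log (k / x₁)
/ 2`. The aperture plays no role, as `x + S_α` lies in `{y₁ ≥ x₁, y₂ ≥ 0}`. The bound by `A` is
almost everywhere because `A` will be an essential supremum. -/
theorem abs_Q_le {α k A B c₀ : ℝ} (hk : 0 < k) (hA : 0 ≤ A) (hB : 0 ≤ B) (hc₀ : 0 ≤ c₀)
    {w : ℝ × ℝ → ℝ} {x : ℝ × ℝ} (hx : x ∈ offAxis)
    (hwA : ∀ᵐ y : ℝ × ℝ, y ∈ Icc 0 k ×ˢ Ici (0 : ℝ) → |w y| ≤ A)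
    (hwB : ∀ y ∈ quadrant, k ≤ y.1 → |w y| ≤ B)
    (hwc : ∀ y ∈ offAxis, c₀ < y.1 * y.2 → w y = 0) :
    |Q α w x| ≤ tailConst k c₀ * B + A / 2 * max 0 (Real.log (k / x.1)) := by
  have hbound : ∫⁻ y in {y : ℝ × ℝ | y - x ∈ sector α}, ‖kern y * w y‖ₑ ≤
      ENNReal.ofReal (tailConst k c₀ * B + A / 2 * max 0 (Real.log (k / x.1))) := by
    have hsub : {y : ℝ × ℝ | y - x ∈ sector α} ⊆
        (Ici k ×ˢ Ici (0 : ℝ)) ∪ (Ico x.1 k ×ˢ Ici (0 : ℝ)) := by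
      intro y hy
      obtain ⟨h1, h2⟩ := sector_add_subset (offAxis_subset hx) hy
      rcases le_or_gt k y.1 with h | h
      · exact Or.inl ⟨h, h2⟩
      · exact Or.inr ⟨⟨h1, h⟩, h2⟩
    have htail : ∫⁻ y in Ici k ×ˢ Ici (0 : ℝ), ‖kern y * w y‖ₑ ≤
        ENNReal.ofReal (tailConst k c₀ * B) := by
      rw [ENNReal.ofReal_mul (tailConst_nonneg _ _), tailConst,
        ENNReal.ofReal_toReal (lintegral_tail_lt_top hk hc₀).ne, ← lintegral_mul_const _ (by fun_prop)]
      refine setLIntegral_mono (by fun_prop) fun y hy => ?_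
      have hy1 : 0 < y.1 := hk.trans_le hy.1
      have hyo : y ∈ offAxis := ⟨hy1, hy.2⟩
      rw [← ENNReal.ofReal_mul (by positivity), ← ofReal_norm, norm_mul,
        Real.norm_of_nonneg (kern_nonneg (offAxis_subset hyo)), Real.norm_eq_abs]
      apply ENNReal.ofReal_le_ofReal
      rcases le_or_gt (y.1 * y.2) c₀ with h | h
      · refine mul_le_mul ?_ (hwB y (offAxis_subset hyo) hy.1) (abs_nonneg _) (by positivity)
        exact div_le_div_of_nonneg_right h (by positivity)
      · rw [hwc y hyo h, abs_zero, mul_zero]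
        positivity
    have hstrip : ∫⁻ y in Ico x.1 k ×ˢ Ici (0 : ℝ), ‖kern y * w y‖ₑ ≤
        ENNReal.ofReal (A / 2 * max 0 (Real.log (k / x.1))) := by
      rcases le_or_gt k x.1 with h | h
      · rw [Ico_eq_empty h.not_gt, empty_prod]
        simp
      · calc ∫⁻ y in Ico x.1 k ×ˢ Ici (0 : ℝ), ‖kern y * w y‖ₑ
            ≤ ∫⁻ y in Ico x.1 k ×ˢ Ici (0 : ℝ), ENNReal.ofReal (kern y) * ENNReal.ofReal A := by
              refine setLIntegral_mono_ae
                (measurable_kern.ennreal_ofReal.mul_const _).aemeasurable ?_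
              filter_upwards [hwA] with y hy hys
              have hyq : y ∈ quadrant := ⟨hx.1.le.trans hys.1.1, hys.2⟩
              rw [← ENNReal.ofReal_mul (kern_nonneg hyq), ← ofReal_norm, norm_mul,
                Real.norm_of_nonneg (kern_nonneg hyq), Real.norm_eq_abs]
              apply ENNReal.ofReal_le_ofReal
              exact mul_le_mul_of_nonneg_left (hy ⟨⟨hyq.1, hys.1.2.le⟩, hyq.2⟩) (kern_nonneg hyq)
          _ = ENNReal.ofReal (Real.log (k / x.1) / 2) * ENNReal.ofReal A := by
              rw [lintegral_mul_const _ measurable_kern.ennreal_ofReal,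
                lintegral_kern_strip hx.1 h.le]
          _ ≤ ENNReal.ofReal (A / 2 * max 0 (Real.log (k / x.1))) := by
              rw [← ENNReal.ofReal_mul' hA]
              apply ENNReal.ofReal_le_ofReal
              nlinarith [le_max_right 0 (Real.log (k / x.1))]
    calc ∫⁻ y in {y : ℝ × ℝ | y - x ∈ sector α}, ‖kern y * w y‖ₑ
        ≤ ∫⁻ y in (Ici k ×ˢ Ici (0 : ℝ)) ∪ (Ico x.1 k ×ˢ Ici (0 : ℝ)), ‖kern y * w y‖ₑ :=
          lintegral_mono_set hsub
      _ ≤ _ := lintegral_union_le _ _ _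
      _ ≤ _ := add_le_add htail hstrip
      _ = _ := (ENNReal.ofReal_add (mul_nonneg (tailConst_nonneg _ _) hB)
          (mul_nonneg (by positivity) (le_max_left _ _))).symm
  have hnn : 0 ≤ tailConst k c₀ * B + A / 2 * max 0 (Real.log (k / x.1)) :=
    add_nonneg (mul_nonneg (tailConst_nonneg _ _) hB)
      (mul_nonneg (by positivity) (le_max_left _ _))
  rw [Q_eq, ← Real.norm_eq_abs]
  refine (ENNReal.ofReal_le_ofReal_iff hnn).1 ?_
  rw [ofReal_norm]
  exact (enorm_integral_le_lintegral_enorm _).trans hbound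

theorem Q_nonneg {α : ℝ} {w : ℝ × ℝ → ℝ} (hw : ∀ y ∈ quadrant, 0 ≤ w y) {x : ℝ × ℝ}
    (hx : x ∈ quadrant) : 0 ≤ Q α w x :=
  setIntegral_nonneg (measurableSet_sector_add α x) fun y hy =>
    mul_nonneg (kern_nonneg (sector_add_subset_quadrant hx hy))
      (hw y (sector_add_subset_quadrant hx hy))

theorem classX.integrableOn_kern_mul {α : ℝ} {w : ℝ × ℝ → ℝ} (hw : w ∈ classX) {x : ℝ × ℝ}
    (hx : x ∈ quadrant) :
    IntegrableOn (fun y => kern y * w y) {y : ℝ × ℝ | y - x ∈ sector α} := by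
  obtain ⟨g, hg, hcs, hsub, heq⟩ := hw
  have hcont : Continuous (fun y => kern y * g y) := by
    refine continuous_iff_continuousAt.2 fun y => ?_
    by_cases hy : y ∈ tsupport g
    · have hy1 : 0 < y.1 := hsub hy
      refine ContinuousAt.mul ?_ hg.continuous.continuousAt
      unfold kern
      exact ContinuousAt.div (by fun_prop) (by fun_prop) (by positivity)
    · have : (fun y => kern y * g y) =ᶠ[𝓝 y] fun _ => 0 := by
        filter_upwards [notMem_tsupport_iff_eventuallyEq.1 hy] with z hz
        rw [hz]
        simp
      exact continuousAt_const.congr this.symm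
  have hint : Integrable (fun y => kern y * g y) :=
    hcont.integrable_of_hasCompactSupport hcs.mul_left
  refine hint.integrableOn.congr_fun (fun y hy => ?_) (measurableSet_sector_add α x)
  simp only [heq (sector_add_subset_quadrant hx hy)]

theorem Q_sub {α : ℝ} {w w' : ℝ × ℝ → ℝ} (hw : w ∈ classX) (hw' : w' ∈ classX) {x : ℝ × ℝ}
    (hx : x ∈ quadrant) : Q α w x - Q α w' x = Q α (fun y => w y - w' y) x := by
  simp only [Q_eq]
  rw [← integral_sub (classX.integrableOn_kern_mul hw hx) (classX.integrableOn_kern_mul hw' hx)]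
  simp only [mul_sub]


/-! ### Support of solutions and uniqueness -/

theorem classX.exists_box {f : ℝ × ℝ → ℝ} (hf : f ∈ classX) :
    ∃ δ R : ℝ, 0 < δ ∧ δ ≤ 1 ∧ 1 ≤ R ∧
      ∀ x ∈ quadrant, f x ≠ 0 → δ ≤ x.1 ∧ x.1 ≤ R ∧ x.2 ≤ R := by
  obtain ⟨C, hCsub, hC, hz⟩ := classX.exists_compact hf
  obtain ⟨r, hr⟩ := hC.isBounded.subset_closedBall 0
  have hmem : ∀ x ∈ quadrant, f x ≠ 0 → x ∈ C := fun x hx hne => by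
    by_contra h
    exact hne (hz x hx h)
  obtain ⟨δ, hδ, hδC⟩ : ∃ δ > 0, ∀ x ∈ C, δ ≤ x.1 := by
    rcases C.eq_empty_or_nonempty with h | h
    · exact ⟨1, one_pos, by simp [h]⟩
    · obtain ⟨y, hy, hmin⟩ := hC.exists_isMinOn h continuous_fst.continuousOn
      exact ⟨y.1, (hCsub hy).1, fun x hx => hmin hx⟩
  refine ⟨min δ 1, max r 1, lt_min hδ one_pos, min_le_right _ _, le_max_right _ _,
    fun x hx hne => ?_⟩
  have hxC := hmem x hx hne
  have hnorm : ‖x‖ ≤ r := by simpa using hr hxC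
  exact ⟨(min_le_left _ _).trans (hδC x hxC),
    ((le_abs_self _).trans ((norm_fst_le x).trans hnorm)).trans (le_max_left _ _),
    ((le_abs_self _).trans ((norm_snd_le x).trans hnorm)).trans (le_max_left _ _)⟩

theorem classX.exists_box_pair {f g : ℝ × ℝ → ℝ} (hf : f ∈ classX) (hg : g ∈ classX) :
    ∃ δ R : ℝ, 0 < δ ∧ δ ≤ 1 ∧ 1 ≤ R ∧
      ∀ x ∈ quadrant, ¬ (δ ≤ x.1 ∧ x.1 ≤ R ∧ x.2 ≤ R) → f x = 0 ∧ g x = 0 := by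
  obtain ⟨δ₁, R₁, hδ₁, hδ₁', hR₁, hb₁⟩ := classX.exists_box hf
  obtain ⟨δ₂, R₂, hδ₂, hδ₂', hR₂, hb₂⟩ := classX.exists_box hg
  refine ⟨min δ₁ δ₂, max R₁ R₂, lt_min hδ₁ hδ₂, (min_le_left _ _).trans hδ₁',
    hR₁.trans (le_max_left _ _), fun x hx hn => ⟨?_, ?_⟩⟩ <;> by_contra hne
  · obtain ⟨h1, h2, h3⟩ := hb₁ x hx hne
    exact hn ⟨(min_le_left _ _).trans h1, h2.trans (le_max_left _ _), h3.trans (le_max_left _ _)⟩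
  · obtain ⟨h1, h2, h3⟩ := hb₂ x hx hne
    exact hn ⟨(min_le_right _ _).trans h1, h2.trans (le_max_right _ _), h3.trans (le_max_right _ _)⟩

theorem hasDerivAt_fst_line (x v : ℝ × ℝ) : HasDerivAt (fun s : ℝ => (x + s • v).1) v.1 0 := by
  simpa using ((hasDerivAt_id (0 : ℝ)).mul_const v.1).const_add x.1

/-- Solutions vanish near the axis `x₁ = 0`; `A` bounds the vorticity on `{x₁ ≤ k}` and `B` on
`{x₁ ≥ k}`. -/
theorem IsSolution.eq_zero_of_log_gt {α T k c₀ B L₀ : ℝ} (hk : 0 < k) (hB : 0 ≤ B)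
    (hc₀ : 0 ≤ c₀) (hL₀ : 0 ≤ L₀) {A a : ℝ → ℝ} {ω ρ : ℝ → ℝ × ℝ → ℝ}
    (h : IsSolution α (Icc 0 T) ω ρ)
    (hA : ∀ t ∈ Icc 0 T, 0 ≤ A t) (ha : ∀ t ∈ Icc 0 T, 0 ≤ a t) (ha0 : a 0 = 0)
    (hader : ∀ t ∈ Icc 0 T, HasDerivWithinAt a (A t) (Icc 0 T) t)
    (hwA : ∀ t ∈ Icc 0 T, ∀ᵐ y : ℝ × ℝ, y ∈ Icc 0 k ×ˢ Ici (0 : ℝ) → |ω t y| ≤ A t)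
    (hwB : ∀ t ∈ Icc 0 T, ∀ y ∈ quadrant, k ≤ y.1 → |ω t y| ≤ B)
    (hwc : ∀ t ∈ Icc 0 T, ∀ y ∈ offAxis, c₀ < y.1 * y.2 → ω t y = 0)
    (h0 : ∀ x ∈ offAxis, L₀ < Real.log (k / x.1) → ω 0 x = 0 ∧ ρ 0 x = 0) :
    ∀ t ∈ Icc 0 T, ∀ x ∈ offAxis,
      L₀ < Real.log (k / x.1) * Real.exp (-(a t / 2)) - tailConst k c₀ * B * t →
      ω t x = 0 ∧ ρ t x = 0 := by
  have hC₁ : 0 ≤ tailConst k c₀ * B := mul_nonneg (tailConst_nonneg _ _) hB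
  -- Along the flow `log (k / x₁)` has derivative `Q`, at most `C + (A / 2) log (k / x₁)`. The
  -- integrating factor `e^{-a/2}` absorbs the second term and the linear term in `t` absorbs the
  -- first.
  refine h.eq_zero_of_level (lam := fun t x =>
    Real.log (k / x.1) * Real.exp (-(a t / 2)) - tailConst k c₀ * B * t) ?_ ?_ ?_
  · have hac : ContinuousOn (fun z : ℝ × (ℝ × ℝ) => a z.1) (Icc 0 T ×ˢ offAxis) :=
      ContinuousOn.comp (t := Icc 0 T) (fun t ht => (hader t ht).continuousWithinAt)
        continuousOn_fst fun z hz => hz.1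
    have hlog : ContinuousOn (fun z : ℝ × (ℝ × ℝ) => Real.log (k / z.2.1))
        (Icc 0 T ×ˢ offAxis) := by
      refine ContinuousOn.log (continuousOn_const.div (by fun_prop) fun z hz => hz.2.1.ne')
        fun z hz => (div_pos hk hz.2.1).ne'
    exact (hlog.mul (Real.continuous_exp.comp_continuousOn (hac.div_const 2).neg)).sub
      (by fun_prop)
  · intro x hx hl
    apply h0 x hx
    simpa [ha0] using hl
  · intro t ht x hx hl _
    have htI : t ∈ Icc 0 T := ⟨ht.1.le, ht.2⟩
    have hx1 := hx.1
    set e := Real.exp (-(a t / 2)) with he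
    have he0 : 0 < e := Real.exp_pos _
    have he1 : e ≤ 1 := Real.exp_le_one_iff.2 (by linarith [ha t htI])
    refine ⟨Real.log (k / x.1) * (e * (-(A t / 2))) - tailConst k c₀ * B,
      Q α (ω t) x * e, ?_, ?_, ?_⟩
    · have h1 := ((hader t htI).div_const 2).fun_neg.exp.const_mul (Real.log (k / x.1))
      have h2 : HasDerivWithinAt (fun s : ℝ => tailConst k c₀ * B * s) (tailConst k c₀ * B)
          (Icc 0 T) t := by
        simpa using ((hasDerivAt_id t).const_mul (tailConst k c₀ * B)).hasDerivWithinAt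
      exact h1.sub h2
    · have h1 := hasDerivAt_fst_line x (velocity α (ω t) x)
      have h2 : HasDerivAt (fun s : ℝ => Real.log (k / (x + s • velocity α (ω t) x).1))
          (Q α (ω t) x) 0 := by
        have h3 := (((hasDerivAt_const (0 : ℝ) k).div h1 (by simpa using hx1.ne'))).log
          (by simpa using ⟨hk.ne', hx1.ne'⟩)
        refine h3.congr_deriv ?_
        simp only [velocity, zero_smul, add_zero, Pi.div_apply]
        field_simp
        ring
      exact (h2.mul_const e).sub_const _
    -- Since `L₀ ≥ 0`, the relevant points have `x₁ < k`, and the maximum with `0` in the bound for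
    -- `Q` disappears.
    · have hlogpos : 0 < Real.log (k / x.1) := by
        by_contra hneg
        have : Real.log (k / x.1) * e ≤ 0 :=
          mul_nonpos_of_nonpos_of_nonneg (not_lt.1 hneg) he0.le
        have := mul_nonneg hC₁ ht.1.le
        linarith
      have hQ := abs_Q_le (α := α) hk (hA t htI) hB hc₀ hx (hwA t htI) (hwB t htI) (hwc t htI)
      rw [max_eq_right hlogpos.le] at hQ
      have hQ' := (le_abs_self _).trans hQ
      have h1 := mul_le_mul_of_nonneg_right hQ' he0.le
      have h2 := mul_le_mul_of_nonneg_left he1 hC₁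
      linarith

/-- The logarithm of `x₁` grows along the flow at the rate `-Q ≤ N`, so `x₁ e^{-Nt}` does not
increase. A lower bound for `Q` on the support is enough. -/
theorem IsSolution.eq_zero_of_fst_gt {α T N R₀ : ℝ} {ω ρ : ℝ → ℝ × ℝ → ℝ}
    (h : IsSolution α (Icc 0 T) ω ρ)
    (hQ : ∀ t ∈ Icc 0 T, ∀ x ∈ offAxis, (ω t x ≠ 0 ∨ ρ t x ≠ 0) → -N ≤ Q α (ω t) x)
    (h0 : ∀ x ∈ offAxis, R₀ < x.1 → ω 0 x = 0 ∧ ρ 0 x = 0) :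
    ∀ t ∈ Icc 0 T, ∀ x ∈ offAxis, R₀ < x.1 * Real.exp (-(N * t)) → ω t x = 0 ∧ ρ t x = 0 := by
  refine h.eq_zero_of_level (lam := fun t x => x.1 * Real.exp (-(N * t))) (by fun_prop)
    (fun x hx hl => h0 x hx (by simpa using hl)) fun t ht x hx _ hne =>
    ⟨x.1 * (Real.exp (-(N * t)) * (-N)), -(x.1 * Q α (ω t) x) * Real.exp (-(N * t)), ?_, ?_, ?_⟩
  · have h1 : HasDerivAt (fun s : ℝ => -(N * s)) (-N) t := by
      simpa using ((hasDerivAt_id t).const_mul N).fun_neg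
    exact (h1.exp.const_mul x.1).hasDerivWithinAt
  · exact (hasDerivAt_fst_line x (velocity α (ω t) x)).mul_const _
  · have h1 := hQ t ⟨ht.1.le, ht.2⟩ x hx hne
    have h2 : 0 ≤ x.1 * Real.exp (-(N * t)) := mul_nonneg hx.1.le (Real.exp_pos _).le
    nlinarith [mul_nonneg h2 (by linarith : 0 ≤ N + Q α (ω t) x)]

theorem ae_of_forall_quadrant {k : ℝ} {p : ℝ × ℝ → Prop} (h : ∀ y ∈ quadrant, p y) :
    ∀ᵐ y : ℝ × ℝ, y ∈ Icc 0 k ×ˢ Ici (0 : ℝ) → p y :=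
  Eventually.of_forall fun y hy => h y ⟨hy.1.1, hy.2⟩

/-- A common support box for all times, without sign conditions, is what makes the constants in the
uniqueness proof finite. The distance to the axis comes before the bound for `x₁`, since it bounds
the logarithm in `Q`; conservation of `x₁ x₂` then bounds `x₂`. -/
theorem IsSolution.exists_box {α T : ℝ} {ω ρ : ℝ → ℝ × ℝ → ℝ}
    (hT : 0 ≤ T) (h : IsSolution α (Icc 0 T) ω ρ) :
    ∃ δ R : ℝ, 0 < δ ∧ δ ≤ 1 ∧ 1 ≤ R ∧ ∀ t ∈ Icc 0 T, ∀ x ∈ quadrant,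
      (ω t x ≠ 0 ∨ ρ t x ≠ 0) → δ ≤ x.1 ∧ x.1 ≤ R ∧ x.2 ≤ R := by
  have h0T : (0 : ℝ) ∈ Icc 0 T := ⟨le_rfl, hT⟩
  obtain ⟨δ, R, hδ0, hδ1, hR1, hb'⟩ := classX.exists_box_pair
    (h.vorticity_continuous.1 0 h0T) (h.density_continuous.1 0 h0T)
  obtain ⟨M, hM, hMb⟩ := h.vorticity_continuous.exists_bound isCompact_Icc
  set c₀ := R * R with hc₀
  have hc₀0 : 0 ≤ c₀ := by positivity
  have hprod := h.eq_zero_of_prod_gt (c₀ := c₀) fun x hx hlt => hb' x hx fun ⟨_, h2, h3⟩ =>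
    hlt.not_ge (mul_le_mul h2 h3 hx.2 (by positivity))
  set L₀ := Real.log (1 / δ) with hL₀
  have hL₀0 : 0 ≤ L₀ := Real.log_nonneg ((one_le_div hδ0).2 hδ1)
  have hlog := h.eq_zero_of_log_gt (k := 1) (c₀ := c₀) (B := M) (L₀ := L₀) (A := fun _ => M)
    (a := fun t => M * t) one_pos hM hc₀0 hL₀0 (fun _ _ => hM)
    (fun t ht => mul_nonneg hM ht.1) (mul_zero M)
    (fun t _ => by simpa using ((hasDerivAt_id t).const_mul M).hasDerivWithinAt)
    (fun t ht => ae_of_forall_quadrant fun y hy => (hMb t ht y hy).1)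
    (fun t ht y hy _ => (hMb t ht y hy).1) (fun t ht y hy hlt => (hprod t ht y hy hlt).1)
    (fun x hx hlt => hb' x (offAxis_subset hx) fun ⟨h1, _, _⟩ => hlt.not_ge
      (Real.log_le_log (div_pos one_pos hx.1) (div_le_div_of_nonneg_left zero_le_one hδ0 h1)))
  set C₁ := tailConst 1 c₀ * M with hC₁
  have hC₁0 : 0 ≤ C₁ := mul_nonneg (tailConst_nonneg _ _) hM
  -- For `x₁ < δ'` the discounted logarithm exceeds `L₀` at every time up to `T`; the worst case `t
  -- = T` determines the exponent.
  set δ' := Real.exp (-((L₀ + C₁ * T) * Real.exp (M * T / 2))) with hδ'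
  have hδ'0 : 0 < δ' := Real.exp_pos _
  have hδ'1 : δ' ≤ 1 := by
    rw [hδ', Real.exp_le_one_iff, neg_nonpos]
    positivity
  have hleft : ∀ t ∈ Icc 0 T, ∀ x ∈ offAxis, (ω t x ≠ 0 ∨ ρ t x ≠ 0) → δ' ≤ x.1 := by
    intro t ht x hx hne
    by_contra hlt
    rw [not_le] at hlt
    have hgt : L₀ < Real.log (1 / x.1) * Real.exp (-(M * t / 2)) - C₁ * t := by
      have h1 : (L₀ + C₁ * T) * Real.exp (M * T / 2) < Real.log (1 / x.1) := by
        rw [one_div, Real.log_inv, lt_neg]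
        exact (Real.log_lt_iff_lt_exp hx.1).2 hlt
      have h2 : L₀ + C₁ * T < Real.log (1 / x.1) * Real.exp (-(M * T / 2)) := by
        rw [Real.exp_neg, ← div_eq_mul_inv, lt_div_iff₀ (Real.exp_pos _)]
        exact h1
      have h3 : Real.exp (-(M * T / 2)) ≤ Real.exp (-(M * t / 2)) :=
        Real.exp_le_exp.2 (by nlinarith [ht.2])
      have h4 : 0 ≤ Real.log (1 / x.1) := le_trans (by positivity) h1.le
      have h5 := mul_le_mul_of_nonneg_left h3 h4
      have h6 := mul_le_mul_of_nonneg_left ht.2 hC₁0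
      linarith
    obtain ⟨h1, h2⟩ := hlog t ht x hx hgt
    rcases hne with hne | hne
    · exact hne h1
    · exact hne h2
  set N := C₁ + M / 2 * Real.log (1 / δ') with hN
  have hright := h.eq_zero_of_fst_gt (N := N) (R₀ := R) (fun t ht x hx hne => by
      have hQ := abs_Q_le (α := α) (w := ω t) one_pos hM hM hc₀0 hx
        (ae_of_forall_quadrant fun y hy => (hMb t ht y hy).1)
        (fun y hy _ => (hMb t ht y hy).1) (fun y hy hlt => (hprod t ht y hy hlt).1)
      have hx1 := hleft t ht x hx hne
      have h1 : max 0 (Real.log (1 / x.1)) ≤ Real.log (1 / δ') :=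
        max_le (Real.log_nonneg ((one_le_div hδ'0).2 hδ'1))
          (Real.log_le_log (div_pos one_pos hx.1)
            (div_le_div_of_nonneg_left zero_le_one hδ'0 hx1))
      have h2 := mul_le_mul_of_nonneg_left h1 (by positivity : 0 ≤ M / 2)
      have h3 := neg_abs_le (Q α (ω t) x)
      linarith) (fun x hx hlt => hb' x (offAxis_subset hx) fun ⟨_, h2, _⟩ => hlt.not_ge h2)
  have hN0 : 0 ≤ N := by
    have := Real.log_nonneg ((one_le_div hδ'0).2 hδ'1)
    positivity
  set R' := max (R * Real.exp (N * T)) (c₀ / δ') with hR'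
  refine ⟨δ', R', hδ'0, hδ'1, ?_, fun t ht x hx hne => ?_⟩
  · refine le_trans ?_ (le_max_left _ _)
    nlinarith [Real.one_le_exp (mul_nonneg hN0 hT)]
  · have hxo : x ∈ offAxis := by
      refine ⟨lt_of_le_of_ne hx.1 fun h0 => ?_, hx.2⟩
      rcases hne with hne | hne
      · exact hne (classX.eq_zero_of_fst_eq_zero (h.vorticity_continuous.1 t ht) hx h0.symm)
      · exact hne (classX.eq_zero_of_fst_eq_zero (h.density_continuous.1 t ht) hx h0.symm)
    have hx1 := hleft t ht x hxo hne
    refine ⟨hx1, ?_, ?_⟩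
    · refine le_trans ?_ (le_max_left _ _)
      by_contra hlt
      rw [not_le] at hlt
      have h1 : R < x.1 * Real.exp (-(N * t)) := by
        rw [Real.exp_neg, ← div_eq_mul_inv, lt_div_iff₀ (Real.exp_pos _)]
        refine lt_of_le_of_lt ?_ hlt
        exact mul_le_mul_of_nonneg_left (Real.exp_le_exp.2
          (mul_le_mul_of_nonneg_left ht.2 hN0)) (by linarith)
      obtain ⟨h2, h3⟩ := hright t ht x hxo h1
      rcases hne with hne | hne
      · exact hne h2
      · exact hne h3
    · refine le_trans ?_ (le_max_right _ _)
      rw [le_div_iff₀ hδ'0]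
      have h1 : x.1 * x.2 ≤ c₀ := by
        by_contra hlt
        obtain ⟨h2, h3⟩ := hprod t ht x hxo (not_le.1 hlt)
        rcases hne with hne | hne
        · exact hne h2
        · exact hne h3
      nlinarith [hx.2]


theorem norm_velocity_sub_le {α R κ : ℝ} {w w' : ℝ × ℝ → ℝ} {x : ℝ × ℝ} (hx : x ∈ quadrant)
    (h1 : x.1 ≤ R) (h2 : x.2 ≤ R) (hQ : |Q α w x - Q α w' x| ≤ κ) :
    ‖velocity α w x - velocity α w' x‖ ≤ R * κ := by
  have hR : 0 ≤ R := hx.1.trans h1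
  rw [Prod.norm_def]
  refine max_le ?_ ?_
  · have : (velocity α w x - velocity α w' x).1 = -(x.1 * (Q α w x - Q α w' x)) := by
      simp only [velocity, Prod.fst_sub]
      ring
    rw [this, norm_neg, norm_mul, Real.norm_of_nonneg hx.1]
    exact mul_le_mul h1 hQ (abs_nonneg _) hR
  · have : (velocity α w x - velocity α w' x).2 = x.2 * (Q α w x - Q α w' x) := by
      simp only [velocity, Prod.snd_sub]
      ring
    rw [this, norm_mul, Real.norm_of_nonneg hx.2]
    exact mul_le_mul h2 hQ (abs_nonneg _) hR

theorem abs_add_mul_le_of_mem {s r a b m : ℝ} (hs : s ∈ Icc (-1 : ℝ) 1) (hr : r ∈ Icc (-1 : ℝ) 1)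
    (ha : |a| ≤ m) (hb : |b| ≤ m) : |s * a + r * b| ≤ 2 * m := by
  have hs' : |s| ≤ 1 := abs_le.2 hs
  have hr' : |r| ≤ 1 := abs_le.2 hr
  calc |s * a + r * b| ≤ |s * a| + |r * b| := abs_add_le _ _
    _ = |s| * |a| + |r| * |b| := by rw [abs_mul, abs_mul]
    _ ≤ 1 * m + 1 * m := add_le_add (mul_le_mul hs' ha (abs_nonneg _) zero_le_one)
        (mul_le_mul hr' hb (abs_nonneg _) zero_le_one)
    _ = 2 * m := by ring

/-- Uniqueness of solutions on a compact time interval. -/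
theorem IsSolution.unique {α T : ℝ} (hT : 0 ≤ T) {ω ρ ω' ρ' : ℝ → ℝ × ℝ → ℝ}
    (h : IsSolution α (Icc 0 T) ω ρ) (h' : IsSolution α (Icc 0 T) ω' ρ')
    (hω : EqOn (ω 0) (ω' 0) quadrant) (hρ : EqOn (ρ 0) (ρ' 0) quadrant) :
    ∀ t ∈ Icc 0 T, EqOn (ω t) (ω' t) quadrant ∧ EqOn (ρ t) (ρ' t) quadrant := by
  obtain ⟨δ₁, R₁, hδ₁, hδ₁', hR₁, hb₁⟩ := h.exists_box hT
  obtain ⟨δ₂, R₂, hδ₂, hδ₂', hR₂, hb₂⟩ := h'.exists_box hT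
  obtain ⟨M₁, hM₁, hMω⟩ := h'.vorticity_continuous.exists_bound isCompact_Icc
  obtain ⟨M₂, hM₂, hMρ⟩ := h'.density_continuous.exists_bound isCompact_Icc
  set δ := min δ₁ δ₂ with hδ
  set R := max R₁ R₂ with hR
  set M := max M₁ M₂ with hM
  have hδ0 : 0 < δ := lt_min hδ₁ hδ₂
  have hδ1 : δ ≤ 1 := (min_le_left _ _).trans hδ₁'
  have hR1 : 1 ≤ R := hR₁.trans (le_max_left _ _)
  have hM0 : 0 ≤ M := hM₁.trans (le_max_left _ _)
  have hbox : ∀ t ∈ Icc 0 T, ∀ x ∈ quadrant, (ω t x - ω' t x ≠ 0 ∨ ρ t x - ρ' t x ≠ 0) →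
      δ ≤ x.1 ∧ x.1 ≤ R ∧ x.2 ≤ R := by
    intro t ht x hx hne
    have : (ω t x ≠ 0 ∨ ρ t x ≠ 0) ∨ (ω' t x ≠ 0 ∨ ρ' t x ≠ 0) := by
      by_contra hcon
      push Not at hcon
      obtain ⟨⟨h1, h2⟩, h3, h4⟩ := hcon
      simp [h1, h2, h3, h4] at hne
    rcases this with hne | hne
    · obtain ⟨h1, h2, h3⟩ := hb₁ t ht x hx hne
      exact ⟨(min_le_left _ _).trans h1, h2.trans (le_max_left _ _), h3.trans (le_max_left _ _)⟩
    · obtain ⟨h1, h2, h3⟩ := hb₂ t ht x hx hne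
      exact ⟨(min_le_right _ _).trans h1, h2.trans (le_max_right _ _), h3.trans (le_max_right _ _)⟩
  set c₀ := R * R with hc₀
  have hc₀0 : 0 ≤ c₀ := by positivity
  set K := tailConst 1 c₀ + 1 / 2 * Real.log (1 / δ) with hK
  have hlog0 : 0 ≤ Real.log (1 / δ) := Real.log_nonneg ((one_le_div hδ0).2 hδ1)
  have hK0 : 0 ≤ K := add_nonneg (tailConst_nonneg _ _) (by positivity)
  -- Two extra variables `s, r ∈ [-1, 1]` linearize absolute values: the maximum of `s (ω - ω') + r
  -- (ρ - ρ')` over them is `|ω - ω'| + |ρ - ρ'|`, while the function remains differentiable in time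
  -- and along the velocity. In `L`, `1 / δ` comes from the source and `2 M R K` from the difference
  -- of the velocities.
  have key := le_of_growth (P := (ℝ × ℝ) × (ℝ × ℝ)) (T := T)
    (D := quadrant ×ˢ (Icc (-1 : ℝ) 1 ×ˢ Icc (-1 : ℝ) 1))
    (h := fun t p => p.2.1 * (ω t p.1 - ω' t p.1) + p.2.2 * (ρ t p.1 - ρ' t p.1))
    (L := 1 / δ + 2 * (M * (R * K))) (N := 0) (c := 0) (by positivity) le_rfl le_rfl ?_ ?_ ?_ ?_
  · intro t ht
    have hval : ∀ x ∈ quadrant, ∀ s ∈ Icc (-1 : ℝ) 1, ∀ r ∈ Icc (-1 : ℝ) 1,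
        s * (ω t x - ω' t x) + r * (ρ t x - ρ' t x) ≤ 0 := fun x hx s hs r hr => by
      simpa using key t ht (x, (s, r)) ⟨hx, hs, hr⟩
    have hm0 : (0 : ℝ) ∈ Icc (-1 : ℝ) 1 := by norm_num
    have hm1 : (1 : ℝ) ∈ Icc (-1 : ℝ) 1 := by norm_num
    have hm2 : (-1 : ℝ) ∈ Icc (-1 : ℝ) 1 := by norm_num
    refine ⟨fun x hx => ?_, fun x hx => ?_⟩
    · have h1 := hval x hx 1 hm1 0 hm0
      have h2 := hval x hx (-1) hm2 0 hm0
      linarith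
    · have h1 := hval x hx 0 hm0 1 hm1
      have h2 := hval x hx 0 hm0 (-1) hm2
      linarith
  · have hc : ∀ {f : ℝ → ℝ × ℝ → ℝ}, ContinuousIntoX (Icc 0 T) f →
        ContinuousOn (fun z : ℝ × ((ℝ × ℝ) × (ℝ × ℝ)) => f z.1 z.2.1)
          (Icc 0 T ×ˢ (quadrant ×ˢ (Icc (-1 : ℝ) 1 ×ˢ Icc (-1 : ℝ) 1))) := fun hf =>
      hf.continuousOn.comp (f := fun z : ℝ × ((ℝ × ℝ) × (ℝ × ℝ)) => (z.1, z.2.1))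
        (by fun_prop) fun z hz => ⟨hz.1, hz.2.1⟩
    exact ((by fun_prop : Continuous fun z : ℝ × ((ℝ × ℝ) × (ℝ × ℝ)) => z.2.2.1).continuousOn.mul
      ((hc h.vorticity_continuous).sub (hc h'.vorticity_continuous))).add
      ((by fun_prop : Continuous fun z : ℝ × ((ℝ × ℝ) × (ℝ × ℝ)) => z.2.2.2).continuousOn.mul
      ((hc h.density_continuous).sub (hc h'.density_continuous)))
  · intro t ht c hc
    obtain ⟨C₁, hC₁s, hC₁, he₁⟩ := h.vorticity_continuous.exists_compact ht
    obtain ⟨C₂, hC₂s, hC₂, he₂⟩ := h'.vorticity_continuous.exists_compact ht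
    obtain ⟨C₃, hC₃s, hC₃, he₃⟩ := h.density_continuous.exists_compact ht
    obtain ⟨C₄, hC₄s, hC₄, he₄⟩ := h'.density_continuous.exists_compact ht
    have hc4 : 0 < c / 4 := by positivity
    refine ⟨(C₁ ∪ C₂ ∪ (C₃ ∪ C₄)) ×ˢ (Icc (-1 : ℝ) 1 ×ˢ Icc (-1 : ℝ) 1), prod_mono_left ?_,
      ((hC₁.union hC₂).union (hC₃.union hC₄)).prod (isCompact_Icc.prod isCompact_Icc), ?_⟩
    · exact (union_subset (union_subset hC₁s hC₂s) (union_subset hC₃s hC₄s)).trans offAxis_subset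
    · filter_upwards [he₁ _ hc4, he₂ _ hc4, he₃ _ hc4, he₄ _ hc4] with s h1 h2 h3 h4
      rintro ⟨x, p, r⟩ ⟨hx, hp, hr⟩ hle
      refine ⟨?_, hp, hr⟩
      by_contra hn
      simp only [mem_union, not_or] at hn
      obtain ⟨⟨n1, n2⟩, n3, n4⟩ := hn
      have a1 := not_le.1 (fun hh => n1 (h1 x hx hh))
      have a2 := not_le.1 (fun hh => n2 (h2 x hx hh))
      have a3 := not_le.1 (fun hh => n3 (h3 x hx hh))
      have a4 := not_le.1 (fun hh => n4 (h4 x hx hh))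
      have hp' : |p| ≤ 1 := abs_le.2 hp
      have hr' : |r| ≤ 1 := abs_le.2 hr
      have b1 : |ω s x - ω' s x| < c / 2 := (abs_sub _ _).trans_lt (by linarith)
      have b2 : |ρ s x - ρ' s x| < c / 2 := (abs_sub _ _).trans_lt (by linarith)
      have b3 : p * (ω s x - ω' s x) ≤ |ω s x - ω' s x| := (le_abs_self _).trans
        (by rw [abs_mul]; exact mul_le_of_le_one_left (abs_nonneg _) hp')
      have b4 : r * (ρ s x - ρ' s x) ≤ |ρ s x - ρ' s x| := (le_abs_self _).trans
        (by rw [abs_mul]; exact mul_le_of_le_one_left (abs_nonneg _) hr')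
      simp only at hle
      linarith
  · rintro ⟨x, p, r⟩ ⟨hx, -, -⟩
    simp [hω hx, hρ hx]
  · rintro t ht ⟨x, p, r⟩ ⟨hx, hp, hr⟩ hm hpos
    simp only at hx hp hr hm hpos ⊢
    have htI : t ∈ Icc 0 T := ⟨ht.1.le, ht.2⟩
    set m := p * (ω t x - ω' t x) + r * (ρ t x - ρ' t x) with hmdef
    have hm0 : (0 : ℝ) ∈ Icc (-1 : ℝ) 1 := by norm_num
    have hm1 : (1 : ℝ) ∈ Icc (-1 : ℝ) 1 := by norm_num
    have hm2 : (-1 : ℝ) ∈ Icc (-1 : ℝ) 1 := by norm_num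
    -- Comparing the maximum with the parameters `(±1, 0)` and `(0, ±1)` turns it into a bound for
    -- both differences on the whole quadrant, as the nonlocal operator requires.
    have hωm : ∀ y ∈ quadrant, |ω t y - ω' t y| ≤ m := fun y hy => by
      have h1 := hm (y, (1, 0)) ⟨hy, hm1, hm0⟩
      have h2 := hm (y, (-1, 0)) ⟨hy, hm2, hm0⟩
      simp only at h1 h2
      exact abs_le.2 ⟨by linarith, by linarith⟩
    have hρm : ∀ y ∈ quadrant, |ρ t y - ρ' t y| ≤ m := fun y hy => by
      have h1 := hm (y, (0, 1)) ⟨hy, hm0, hm1⟩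
      have h2 := hm (y, (0, -1)) ⟨hy, hm0, hm2⟩
      simp only at h1 h2
      exact abs_le.2 ⟨by linarith, by linarith⟩
    obtain ⟨hx1, hx2, hx3⟩ := hbox t htI x hx (by
      by_contra hcon
      push Not at hcon
      rw [hmdef, hcon.1, hcon.2] at hpos
      simp at hpos)
    have hx1' : 0 < x.1 := hδ0.trans_le hx1
    have hQ : |Q α (ω t) x - Q α (ω' t) x| ≤ K * m := by
      rw [Q_sub (h.vorticity_continuous.1 t htI) (h'.vorticity_continuous.1 t htI) hx]
      refine (abs_Q_le (k := 1) (A := m) (B := m) (c₀ := c₀) one_pos hpos.le hpos.le hc₀0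
        ⟨hx1', hx.2⟩ (ae_of_forall_quadrant hωm) (fun y hy _ => hωm y hy) ?_).trans ?_
      · intro y hy hlt
        by_contra hne
        obtain ⟨-, h2, h3⟩ := hbox t htI y (offAxis_subset hy) (Or.inl hne)
        exact hlt.not_ge (mul_le_mul h2 h3 hy.2 (by positivity))
      · have h1 : max 0 (Real.log (1 / x.1)) ≤ Real.log (1 / δ) :=
          max_le hlog0 (Real.log_le_log (div_pos one_pos hx1')
            (div_le_div_of_nonneg_left zero_le_one hδ0 hx1))
        have h2 := mul_le_mul_of_nonneg_left h1 (by positivity : 0 ≤ m / 2)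
        rw [hK]
        linarith
    have hvel := norm_velocity_sub_le hx hx2 hx3 hQ
    set u := velocity α (ω t) x with hu
    set u' := velocity α (ω' t) x with hu'
    have hgrad : ∀ {f : ℝ → ℝ × ℝ → ℝ} {M' : ℝ}, M' ≤ M →
        (∀ t ∈ Icc 0 T, ∀ x ∈ quadrant, |f t x| ≤ M' ∧ ‖gradQ (f t) x‖ ≤ M') →
        |gradQ (f t) x (u - u')| ≤ M * (R * (K * m)) := fun hle hb =>
      ((gradQ _ x).le_opNorm _).trans (mul_le_mul (((hb t htI x hx).2).trans hle) hvel
        (norm_nonneg _) hM0)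
    have hg1 := hgrad (le_max_left _ _) hMω
    have hg2 := hgrad (le_max_right _ _) hMρ
    have hE : |(ρ t x - ρ' t x) / x.1| ≤ m / δ := by
      rw [abs_div, abs_of_pos hx1']
      exact div_le_div₀ hpos.le (hρm x hx) hδ0 hx1
    have hder := (((h.vorticity_eq t htI x hx).sub (h'.vorticity_eq t htI x hx)).const_mul p).add
      (((h.density_eq t htI x hx).sub (h'.density_eq t htI x hx)).const_mul r)
    have hline := ((((classX.hasDerivAt_line (h.vorticity_continuous.1 t htI) hx (Q α (ω t) x)).sub
      (classX.hasDerivAt_line (h'.vorticity_continuous.1 t htI) hx (Q α (ω t) x))).const_mul p).add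
      (((classX.hasDerivAt_line (h.density_continuous.1 t htI) hx (Q α (ω t) x)).sub
      (classX.hasDerivAt_line (h'.density_continuous.1 t htI) hx (Q α (ω t) x))).const_mul r))
    have hmaxl : IsLocalMax (fun s : ℝ =>
        p * (ω t (x + s • (-(x.1 * Q α (ω t) x), x.2 * Q α (ω t) x)) -
          ω' t (x + s • (-(x.1 * Q α (ω t) x), x.2 * Q α (ω t) x))) +
        r * (ρ t (x + s • (-(x.1 * Q α (ω t) x), x.2 * Q α (ω t) x)) -
          ρ' t (x + s • (-(x.1 * Q α (ω t) x), x.2 * Q α (ω t) x)))) 0 := by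
      filter_upwards [quadrant_line_mem hx (Q α (ω t) x)] with s hs
      simpa using hm (_, (p, r)) ⟨hs, hp, hr⟩
    -- The differences have no derivative along the first velocity `u`, so the gradients enter only
    -- through those of the primed solution applied to `u - u'`.
    have hzero := hmaxl.hasDerivAt_eq_zero hline
    refine ⟨_, ?_, hder⟩
    have hzero' : p * (gradQ (ω t) x u - gradQ (ω' t) x u) +
        r * (gradQ (ρ t) x u - gradQ (ρ' t) x u) = 0 := hzero
    have hb := (le_abs_self _).trans (abs_add_mul_le_of_mem (s := -p) (r := -r)
      ⟨by linarith [hp.2], by linarith [hp.1]⟩ ⟨by linarith [hr.2], by linarith [hr.1]⟩ hg1 hg2)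
    have hE' : p * ((ρ t x - ρ' t x) / x.1) ≤ m / δ := by
      refine (le_abs_self _).trans ?_
      rw [abs_mul]
      exact (mul_le_of_le_one_left (abs_nonneg _) (abs_le.2 hp)).trans hE
    simp only [map_sub] at hb
    have e1 : ρ t x / x.1 - ρ' t x / x.1 = (ρ t x - ρ' t x) / x.1 := (sub_div _ _ _).symm
    have e2 : (1 / δ + 2 * (M * (R * K))) * m + 0 = m / δ + 2 * (M * (R * (K * m))) := by ring
    rw [e2]
    calc p * (ρ t x / x.1 - gradQ (ω t) x u - (ρ' t x / x.1 - gradQ (ω' t) x u')) +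
          r * (-gradQ (ρ t) x u - -gradQ (ρ' t) x u')
        = p * ((ρ t x - ρ' t x) / x.1) - (p * (gradQ (ω t) x u - gradQ (ω' t) x u) +
          r * (gradQ (ρ t) x u - gradQ (ρ' t) x u)) +
          (-p * (gradQ (ω' t) x u - gradQ (ω' t) x u') +
          -r * (gradQ (ρ' t) x u - gradQ (ρ' t) x u')) := by
          rw [← e1]
          ring
      _ ≤ m / δ + 2 * (M * (R * (K * m))) := by
          rw [hzero']
          linarith


/-! ### A priori bounds for nonnegative solutions -/

section compactInterval

variable {α T : ℝ} {ω ρ : ℝ → ℝ × ℝ → ℝ}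

theorem IsSolution.eq_zero_of_fst_eq_zero {I : Set ℝ} (h : IsSolution α I ω ρ) {t : ℝ}
    (ht : t ∈ I) {x : ℝ × ℝ} (hx : x ∈ quadrant) (h0 : x.1 = 0) : ω t x = 0 ∧ ρ t x = 0 :=
  ⟨classX.eq_zero_of_fst_eq_zero (h.vorticity_continuous.1 t ht) hx h0,
    classX.eq_zero_of_fst_eq_zero (h.density_continuous.1 t ht) hx h0⟩

theorem IsSolution.fst_pos_of_ne_zero {I : Set ℝ} (h : IsSolution α I ω ρ) {t : ℝ}
    (ht : t ∈ I) {x : ℝ × ℝ} (hx : x ∈ quadrant) (hne : ω t x ≠ 0 ∨ ρ t x ≠ 0) : 0 < x.1 := by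
  refine lt_of_le_of_ne hx.1 fun h0 => ?_
  obtain ⟨h1, h2⟩ := h.eq_zero_of_fst_eq_zero ht hx h0.symm
  rcases hne with hne | hne
  · exact hne h1
  · exact hne h2

/-- The maximum principle with constant weight; the factor `σ` provides upper and lower bounds
alike. -/
theorem IsSolution.density_le {c σ : ℝ} (hc : 0 ≤ c) (h : IsSolution α (Icc 0 T) ω ρ)
    (h0 : ∀ x ∈ quadrant, σ * ρ 0 x ≤ c) : ∀ t ∈ Icc 0 T, ∀ x ∈ quadrant, σ * ρ t x ≤ c := by
  intro t ht x hx
  rcases hx.1.eq_or_lt with h1 | h1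
  · rwa [(h.eq_zero_of_fst_eq_zero ht hx h1.symm).2, mul_zero]
  · have := weighted_transport_le (σ := σ) (c := c) (N := 0) (S := fun _ _ => 0)
      (q := fun t x => Q α (ω t) x) (φ := fun _ _ => 1) hc le_rfl h.density_continuous
      (fun t ht x hx => by simpa [velocity] using h.density_eq t ht x hx) continuousOn_const
      (fun _ _ => zero_le_one) (fun _ _ => le_rfl)
      (fun x hx => by simpa using h0 x (offAxis_subset hx))
      (fun t _ x _ _ => ⟨0, 0, hasDerivWithinAt_const _ _ _, hasDerivAt_const _ _, by simp⟩)
      t ht x ⟨h1, hx.2⟩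
    simpa using this

theorem IsSolution.density_nonneg (h : IsSolution α (Icc 0 T) ω ρ)
    (h0 : ∀ x ∈ quadrant, 0 ≤ ρ 0 x) : ∀ t ∈ Icc 0 T, ∀ x ∈ quadrant, 0 ≤ ρ t x :=
  fun t ht x hx => by
    have := h.density_le (σ := -1) le_rfl (fun x hx => by linarith [h0 x hx]) t ht x hx
    linarith

theorem IsSolution.vorticity_nonneg (h : IsSolution α (Icc 0 T) ω ρ)
    (hω0 : ∀ x ∈ quadrant, 0 ≤ ω 0 x) (hρ0 : ∀ x ∈ quadrant, 0 ≤ ρ 0 x) :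
    ∀ t ∈ Icc 0 T, ∀ x ∈ quadrant, 0 ≤ ω t x := by
  have hρ := h.density_nonneg hρ0
  intro t ht x hx
  rcases hx.1.eq_or_lt with h1 | h1
  · exact (h.eq_zero_of_fst_eq_zero ht hx h1.symm).1.ge
  · have := weighted_transport_le (σ := -1) (c := 0) (N := 0) (S := fun t x => ρ t x / x.1)
      (q := fun t x => Q α (ω t) x) (φ := fun _ _ => 1) le_rfl le_rfl h.vorticity_continuous
      (fun t ht x hx => h.vorticity_eq t ht x hx) continuousOn_const
      (fun _ _ => zero_le_one) (fun _ _ => le_rfl)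
      (fun x hx => by linarith [hω0 x (offAxis_subset hx)])
      (fun t ht x hx _ => ⟨0, 0, hasDerivWithinAt_const _ _ _, hasDerivAt_const _ _, by
        have := div_nonneg (hρ t ⟨ht.1.le, ht.2⟩ x (offAxis_subset hx)) hx.1.le
        linarith⟩)
      t ht x ⟨h1, hx.2⟩
    linarith

/-- Away from the axis the vorticity is controlled, since the flow is directed towards the axis. -/
theorem IsSolution.vorticity_le_of_le_fst {k Mω Mρ : ℝ} (hk : 0 < k) (hMω : 0 ≤ Mω) (hMρ : 0 ≤ Mρ)
    (h : IsSolution α (Icc 0 T) ω ρ) (hω : ∀ t ∈ Icc 0 T, ∀ x ∈ quadrant, 0 ≤ ω t x)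
    (hρ : ∀ t ∈ Icc 0 T, ∀ x ∈ quadrant, ρ t x ≤ Mρ) (hω0 : ∀ x ∈ quadrant, ω 0 x ≤ Mω) :
    ∀ t ∈ Icc 0 T, ∀ x ∈ quadrant, k ≤ x.1 → ω t x ≤ Mω + 2 * Mρ / k * t := by
  intro t ht x hx hkx
  have := weighted_transport_le (σ := 1) (c := Mω) (N := 2 * Mρ / k) (S := fun t x => ρ t x / x.1)
    (q := fun t x => Q α (ω t) x)
    -- The weight is `0` for `x₁ ≤ k / 2` and `1` for `x₁ ≥ k`. It increases with `x₁` and the flow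
    -- goes left, so it only decreases along the flow; where it is nonzero the source is at most `2
    -- Mρ / k`.
    (φ := fun _ x => Real.smoothTransition (2 / k * x.1 - 1)) hMω (by positivity)
    h.vorticity_continuous
    (fun t ht x hx => h.vorticity_eq t ht x hx)
    (Real.smoothTransition.continuous.comp_continuousOn (by fun_prop))
    (fun _ _ => Real.smoothTransition.nonneg _) (fun _ _ => Real.smoothTransition.le_one _)
    (fun x hx => ?_) (fun t ht x hx hpos => ?_) t ht x ⟨hk.trans_le hkx, hx.2⟩
  · rw [Real.smoothTransition.one_of_one_le] at this
    · simpa using this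
    · have : 2 / k * k ≤ 2 / k * x.1 := mul_le_mul_of_nonneg_left hkx (by positivity)
      rw [div_mul_cancel₀ _ hk.ne'] at this
      linarith
  · rw [one_mul]
    exact (mul_le_of_le_one_right
      (hω 0 ⟨le_rfl, ht.1.trans ht.2⟩ x (offAxis_subset hx)) (Real.smoothTransition.le_one _)).trans
      (hω0 x (offAxis_subset hx))
  · have htI : t ∈ Icc 0 T := ⟨ht.1.le, ht.2⟩
    have hxq := offAxis_subset hx
    have hψ := smoothTransition_hasDerivAt (2 / k * x.1 - 1)
    have hψ' : HasDerivAt Real.smoothTransition (deriv Real.smoothTransition (2 / k * x.1 - 1))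
        (2 / k * (x + (0 : ℝ) • (-(x.1 * Q α (ω t) x), x.2 * Q α (ω t) x)).1 - 1) := by
      simpa using hψ
    have hgt : 1 < 2 / k * x.1 := by
      by_contra hle
      rw [Real.smoothTransition.zero_of_nonpos (by linarith)] at hpos
      simp at hpos
    refine ⟨0, _, hasDerivWithinAt_const _ _ _,
      hψ'.comp (h := fun s : ℝ => 2 / k * (x + s • (-(x.1 * Q α (ω t) x), x.2 * Q α (ω t) x)).1 - 1)
      (0 : ℝ) (((hasDerivAt_fst_line x _).const_mul (2 / k)).sub_const 1), ?_⟩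
    have hQ : 0 ≤ Q α (ω t) x := Q_nonneg (hω t htI) hxq
    have h1 : 0 ≤ ω t x * (deriv Real.smoothTransition (2 / k * x.1 - 1) *
        (2 / k * (x.1 * Q α (ω t) x))) :=
      mul_nonneg (hω t htI x hxq) (mul_nonneg (smoothTransition_deriv_nonneg _)
        (mul_nonneg (by positivity) (mul_nonneg hxq.1 hQ)))
    have h2 : ρ t x / x.1 ≤ 2 * Mρ / k := by
      rw [div_le_div_iff₀ hx.1 hk]
      have h3 : k ≤ 2 * x.1 := by
        rw [div_mul_eq_mul_div, lt_div_iff₀ hk] at hgt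
        linarith
      calc ρ t x * k ≤ Mρ * k := mul_le_mul_of_nonneg_right (hρ t htI x hxq) hk.le
        _ ≤ Mρ * (2 * x.1) := mul_le_mul_of_nonneg_left h3 hMρ
        _ = 2 * Mρ * x.1 := by ring
    have h4 : ρ t x / x.1 * Real.smoothTransition (2 / k * x.1 - 1) ≤ 2 * Mρ / k := by
      calc _ ≤ 2 * Mρ / k * Real.smoothTransition (2 / k * x.1 - 1) :=
            mul_le_mul_of_nonneg_right h2 (Real.smoothTransition.nonneg _)
        _ ≤ _ := mul_le_of_le_one_right (by positivity) (Real.smoothTransition.le_one _)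
    linarith

theorem IsSolution.vorticity_le_of_support {δ Mω Mρ : ℝ} (hδ : 0 < δ) (hMω : 0 ≤ Mω)
    (hMρ : 0 ≤ Mρ) (h : IsSolution α (Icc 0 T) ω ρ)
    (hρ : ∀ t ∈ Icc 0 T, ∀ x ∈ quadrant, ρ t x ≤ Mρ) (hω0 : ∀ x ∈ quadrant, ω 0 x ≤ Mω)
    (hsupp : ∀ t ∈ Icc 0 T, ∀ x ∈ quadrant, ρ t x ≠ 0 → δ ≤ x.1) :
    ∀ t ∈ Icc 0 T, ∀ x ∈ quadrant, ω t x ≤ Mω + Mρ / δ * t := by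
  intro t ht x hx
  rcases hx.1.eq_or_lt with h1 | h1
  · rw [(h.eq_zero_of_fst_eq_zero ht hx h1.symm).1]
    have := ht.1
    positivity
  · have := weighted_transport_le (σ := 1) (c := Mω) (N := Mρ / δ) (S := fun t x => ρ t x / x.1)
      (q := fun t x => Q α (ω t) x) (φ := fun _ _ => 1) hMω (by positivity) h.vorticity_continuous
      (fun t ht x hx => h.vorticity_eq t ht x hx) continuousOn_const
      (fun _ _ => zero_le_one) (fun _ _ => le_rfl)
      (fun x hx => by linarith [hω0 x (offAxis_subset hx)])
      (fun t ht x hx _ => ⟨0, 0, hasDerivWithinAt_const _ _ _, hasDerivAt_const _ _, by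
        have htI : t ∈ Icc 0 T := ⟨ht.1.le, ht.2⟩
        have hxq := offAxis_subset hx
        have : ρ t x / x.1 ≤ Mρ / δ := by
          by_cases h0 : ρ t x = 0
          · rw [h0, zero_div]
            positivity
          · exact div_le_div₀ hMρ (hρ t htI x hxq) hδ (hsupp t htI x hxq h0)
        linarith⟩)
      t ht x ⟨h1, hx.2⟩
    linarith

end compactInterval

/-! ### The norm in the continuation criterion -/

/-- The essential supremum of the vorticity on `{x₁ ≤ k}`. -/
noncomputable def stripNorm (k : ℝ) (w : ℝ × ℝ → ℝ) : ℝ :=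
  (eLpNorm w ⊤ (volume.restrict (Icc 0 k ×ˢ Ici (0 : ℝ)))).toReal

theorem stripNorm_nonneg (k : ℝ) (w : ℝ × ℝ → ℝ) : 0 ≤ stripNorm k w := ENNReal.toReal_nonneg

theorem measurableSet_strip (k : ℝ) : MeasurableSet (Icc 0 k ×ˢ Ici (0 : ℝ)) :=
  measurableSet_Icc.prod measurableSet_Ici

theorem eLpNorm_strip_le {k C : ℝ} {w : ℝ × ℝ → ℝ}
    (h : ∀ᵐ y : ℝ × ℝ, y ∈ Icc 0 k ×ˢ Ici (0 : ℝ) → |w y| ≤ C) :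
    eLpNorm w ⊤ (volume.restrict (Icc 0 k ×ˢ Ici (0 : ℝ))) ≤ ENNReal.ofReal C := by
  rw [eLpNorm_exponent_top]
  refine eLpNormEssSup_le_of_ae_bound ?_
  rw [ae_restrict_iff' (measurableSet_strip k)]
  exact h

theorem stripNorm_le {k C : ℝ} (hC : 0 ≤ C) {w : ℝ × ℝ → ℝ}
    (h : ∀ᵐ y : ℝ × ℝ, y ∈ Icc 0 k ×ˢ Ici (0 : ℝ) → |w y| ≤ C) : stripNorm k w ≤ C :=
  ENNReal.toReal_le_of_le_ofReal hC (eLpNorm_strip_le h)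

/-- The assumed bound matters because `toReal` would turn an infinite norm into `0`. -/
theorem ae_le_stripNorm {k C : ℝ} {w : ℝ × ℝ → ℝ} (h : ∀ y ∈ quadrant, |w y| ≤ C) :
    ∀ᵐ y : ℝ × ℝ, y ∈ Icc 0 k ×ˢ Ici (0 : ℝ) → |w y| ≤ stripNorm k w := by
  have hfin : eLpNorm w ⊤ (volume.restrict (Icc 0 k ×ˢ Ici (0 : ℝ))) ≠ ⊤ :=
    ((eLpNorm_strip_le (ae_of_forall_quadrant h)).trans_lt ENNReal.ofReal_lt_top).ne
  have := ae_le_eLpNormEssSup (f := w) (μ := volume.restrict (Icc 0 k ×ˢ Ici (0 : ℝ)))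
  rw [ae_restrict_iff' (measurableSet_strip k)] at this
  filter_upwards [this] with y hy hmem
  have h1 := hy hmem
  rw [← eLpNorm_exponent_top] at h1
  have h2 := ENNReal.toReal_mono hfin h1
  simpa [stripNorm] using h2

/-- Continuity in time gives the strip norm a differentiable primitive, to be used in the
integrating factor. -/
theorem ContinuousIntoX.continuousOn_stripNorm {I : Set ℝ} {f : ℝ → ℝ × ℝ → ℝ}
    (hf : ContinuousIntoX I f) (k : ℝ) : ContinuousOn (fun t => stripNorm k (f t)) I := by
  intro t ht
  rw [Metric.continuousWithinAt_iff']
  intro ε hε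
  have hbd : ∀ s ∈ I, ∃ M, ∀ x ∈ quadrant, |f s x| ≤ M := fun s hs => by
    obtain ⟨M, -, hM⟩ := classX.exists_bound (hf.1 s hs)
    exact ⟨M, fun x hx => (hM x hx).1⟩
  filter_upwards [Metric.tendstoUniformlyOn_iff.1 (hf.2 t ht).1 (ε / 2) (half_pos hε),
    self_mem_nhdsWithin] with s hs hsI
  obtain ⟨Ms, hMs⟩ := hbd s hsI
  obtain ⟨Mt, hMt⟩ := hbd t ht
  have hdist : ∀ y ∈ quadrant, |f t y - f s y| ≤ ε / 2 := fun y hy => by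
    have := (hs y hy).le
    rwa [Real.dist_eq] at this
  have h1 : stripNorm k (f s) ≤ stripNorm k (f t) + ε / 2 := by
    refine stripNorm_le (add_nonneg (stripNorm_nonneg _ _) (half_pos hε).le) ?_
    filter_upwards [ae_le_stripNorm (k := k) hMt] with y hy hmem
    have h2 := hdist y ⟨hmem.1.1, hmem.2⟩
    have h3 := abs_sub_abs_le_abs_sub (f s y) (f t y)
    rw [abs_sub_comm] at h3
    linarith [hy hmem]
  have h2 : stripNorm k (f t) ≤ stripNorm k (f s) + ε / 2 := by
    refine stripNorm_le (add_nonneg (stripNorm_nonneg _ _) (half_pos hε).le) ?_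
    filter_upwards [ae_le_stripNorm (k := k) hMs] with y hy hmem
    have h2 := hdist y ⟨hmem.1.1, hmem.2⟩
    have h3 := abs_sub_abs_le_abs_sub (f t y) (f s y)
    linarith [hy hmem]
  rw [Real.dist_eq, abs_lt]
  constructor <;> linarith

/-- A primitive of the strip norm, bounded by the integral in the continuation criterion. -/
theorem ContinuousIntoX.exists_primitive {T T₁ k : ℝ} (hT₁ : 0 ≤ T₁) (hT₁T : T₁ < T)
    {f : ℝ → ℝ × ℝ → ℝ} (hf : ContinuousIntoX (Icc 0 T₁) f)
    (hfin : ∫⁻ s in Ico 0 T, eLpNorm (f s) ⊤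
      (volume.restrict (Icc 0 k ×ˢ Ici (0 : ℝ))) < ⊤) :
    ∃ a : ℝ → ℝ, a 0 = 0 ∧ ∀ t ∈ Icc 0 T₁, 0 ≤ a t ∧
      a t ≤ (∫⁻ s in Ico 0 T, eLpNorm (f s) ⊤
        (volume.restrict (Icc 0 k ×ˢ Ici (0 : ℝ)))).toReal ∧
      HasDerivWithinAt a (stripNorm k (f t)) (Icc 0 T₁) t := by
  -- Extending by the end values makes the integrand continuous on the line, so that the fundamental
  -- theorem of calculus holds at the end points too.
  set A : ℝ → ℝ := IccExtend hT₁ ((Icc 0 T₁).domRestrict fun t => stripNorm k (f t)) with hA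
  have hAc : Continuous A :=
    (continuousOn_iff_continuous_domRestrict.1 (hf.continuousOn_stripNorm k)).Icc_extend'
  have hAeq : ∀ t ∈ Icc 0 T₁, A t = stripNorm k (f t) := fun t ht => by
    rw [hA, IccExtend_of_mem _ _ ht, domRestrict_apply]
  have hA0 : ∀ t, 0 ≤ A t := fun t => stripNorm_nonneg _ _
  refine ⟨fun t => ∫ s in (0 : ℝ)..t, A s, intervalIntegral.integral_same, fun t ht =>
    ⟨intervalIntegral.integral_nonneg ht.1 fun s _ => hA0 s, ?_, ?_⟩⟩
  · refine (ENNReal.ofReal_le_iff_le_toReal hfin.ne).1 ?_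
    beta_reduce
    rw [intervalIntegral.integral_of_le ht.1, ofReal_integral_eq_lintegral_ofReal
      (hAc.integrableOn_Ioc) (Eventually.of_forall hA0)]
    calc ∫⁻ s in Ioc 0 t, ENNReal.ofReal (A s)
        ≤ ∫⁻ s in Ioc 0 t, eLpNorm (f s) ⊤ (volume.restrict (Icc 0 k ×ˢ Ici (0 : ℝ))) := by
          refine setLIntegral_mono' measurableSet_Ioc fun s hs => ?_
          rw [hAeq s ⟨hs.1.le, hs.2.trans ht.2⟩]
          exact ENNReal.ofReal_toReal_le
      _ ≤ _ := lintegral_mono_set (show Ioc 0 t ⊆ Ico 0 T from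
          fun s hs => ⟨hs.1.le, (hs.2.trans ht.2).trans_lt hT₁T⟩)
  · rw [← hAeq t ht]
    exact (hAc.integral_hasStrictDerivAt 0 t).hasDerivAt.hasDerivWithinAt

/-- Nonnegative solutions that satisfy the continuation criterion stay bounded, with support in a
fixed compact subset of `{x₁ > 0}`. -/
theorem IsSolution.exists_bounds {α T k : ℝ} {ω ρ : ℝ → ℝ × ℝ → ℝ} (hT : 0 < T) (hk : 0 < k)
    (h : IsSolution α (Ico 0 T) ω ρ) (hω0 : ∀ x ∈ quadrant, 0 ≤ ω 0 x)
    (hρ0 : ∀ x ∈ quadrant, 0 ≤ ρ 0 x)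
    (hfin : ∫⁻ s in Ico 0 T, eLpNorm (ω s) ⊤
      (volume.restrict (Icc 0 k ×ˢ Ici (0 : ℝ))) < ⊤) :
    ∃ δ R M : ℝ, 0 < δ ∧ δ ≤ 1 ∧ 1 ≤ R ∧ 0 ≤ M ∧ ∀ t ∈ Ico 0 T, ∀ x ∈ quadrant,
      |ω t x| ≤ M ∧ |ρ t x| ≤ M ∧
      (¬ (δ ≤ x.1 ∧ x.1 ≤ R ∧ x.2 ≤ R) → ω t x = 0 ∧ ρ t x = 0) := by
  have h0T : (0 : ℝ) ∈ Ico 0 T := ⟨le_rfl, hT⟩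
  obtain ⟨δ, R, hδ0, hδ1, hR1, hb'⟩ := classX.exists_box_pair
    (h.vorticity_continuous.1 0 h0T) (h.density_continuous.1 0 h0T)
  obtain ⟨Mω, hMω, hbω⟩ := classX.exists_bound (h.vorticity_continuous.1 0 h0T)
  obtain ⟨Mρ, hMρ, hbρ⟩ := classX.exists_bound (h.density_continuous.1 0 h0T)
  set c₀ := R * R with hc₀
  have hc₀0 : 0 ≤ c₀ := by positivity
  set B := Mω + 2 * Mρ / k * T with hB
  have hB0 : 0 ≤ B := by positivity
  set L₀ := max 0 (Real.log (k / δ)) with hL₀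
  have hL₀0 : 0 ≤ L₀ := le_max_left _ _
  set C₁ := tailConst k c₀ * B with hC₁
  have hC₁0 : 0 ≤ C₁ := mul_nonneg (tailConst_nonneg _ _) hB0
  set I := (∫⁻ s in Ico 0 T, eLpNorm (ω s) ⊤
      (volume.restrict (Icc 0 k ×ˢ Ici (0 : ℝ)))).toReal with hI
  -- The second entry is where `log (k / x₁) = (L₀ + C₁ T) e^{I/2}`, with `I` the integral in the
  -- criterion. The first entry only serves to keep `δ' ≤ 1`.
  set δ' := min δ (k * Real.exp (-((L₀ + C₁ * T) * Real.exp (I / 2)))) with hδ'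
  have hδ'0 : 0 < δ' := lt_min hδ0 (mul_pos hk (Real.exp_pos _))
  have hδ'1 : δ' ≤ 1 := (min_le_left _ _).trans hδ1
  set R' := max R (c₀ / δ') with hR'
  set M := max Mρ (Mω + Mρ / δ' * T) with hM
  refine ⟨δ', R', M, hδ'0, hδ'1, hR1.trans (le_max_left _ _), hMρ.trans (le_max_left _ _), ?_⟩
  intro t ht x hx
  -- The estimates are applied on the compact interval `[0, t]`; all constants above were fixed
  -- independently of `t`.
  have hsub : Icc 0 t ⊆ Ico 0 T := fun s hs => ⟨hs.1, hs.2.trans_lt ht.2⟩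
  have htt : t ∈ Icc 0 t := ⟨ht.1, le_rfl⟩
  have hs := h.mono hsub
  have hρn := hs.density_nonneg hρ0
  have hωn := hs.vorticity_nonneg hω0 hρ0
  have hρM : ∀ s ∈ Icc 0 t, ∀ x ∈ quadrant, ρ s x ≤ Mρ := fun s hst x hx => by
    have := hs.density_le (σ := 1) hMρ
      (fun x hx => by linarith [le_abs_self (ρ 0 x), (hbρ x hx).1]) s hst x hx
    linarith
  have hωM0 : ∀ x ∈ quadrant, ω 0 x ≤ Mω := fun x hx => (le_abs_self _).trans (hbω x hx).1
  have hprod := hs.eq_zero_of_prod_gt (c₀ := c₀) fun x hx hlt => hb' x hx fun ⟨_, h2, h3⟩ =>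
    hlt.not_ge (mul_le_mul h2 h3 hx.2 (by positivity))
  have hωB : ∀ s ∈ Icc 0 t, ∀ y ∈ quadrant, k ≤ y.1 → |ω s y| ≤ B := fun s hst y hy hky => by
    rw [abs_of_nonneg (hωn s hst y hy)]
    refine (hs.vorticity_le_of_le_fst hk hMω hMρ hωn hρM hωM0 s hst y hy hky).trans ?_
    have : 2 * Mρ / k * s ≤ 2 * Mρ / k * T :=
      mul_le_mul_of_nonneg_left (hst.2.trans ht.2.le) (by positivity)
    linarith
  obtain ⟨a, ha0, ha⟩ := hs.vorticity_continuous.exists_primitive ht.1 ht.2 hfin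
  have hlog := hs.eq_zero_of_log_gt (k := k) (c₀ := c₀) (B := B) (L₀ := L₀)
    (A := fun s => stripNorm k (ω s)) (a := a) hk hB0 hc₀0 hL₀0 (fun _ _ => stripNorm_nonneg _ _)
    (fun s hst => (ha s hst).1) ha0 (fun s hst => (ha s hst).2.2)
    (fun s hst => by
      obtain ⟨M', -, hM'⟩ := classX.exists_bound (hs.vorticity_continuous.1 s hst)
      exact ae_le_stripNorm fun y hy => (hM' y hy).1)
    hωB (fun s hst y hy hlt => (hprod s hst y hy hlt).1)
    (fun x hx hlt => hb' x (offAxis_subset hx) fun ⟨h1, _, _⟩ => hlt.not_ge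
      ((Real.log_le_log (div_pos hk hx.1) (div_le_div_of_nonneg_left hk.le hδ0 h1)).trans
        (le_max_right _ _)))
  -- Here `N = 0`: nonnegative vorticity gives `Q ≥ 0`, and the support does not move to the right.
  have hright := hs.eq_zero_of_fst_gt (N := 0) (R₀ := R) (fun s hst y hy _ => by
      rw [neg_zero]
      exact Q_nonneg (hωn s hst) (offAxis_subset hy))
    (fun x hx hlt => hb' x (offAxis_subset hx) fun ⟨_, h2, _⟩ => hlt.not_ge h2)
  have hleft : ∀ s ∈ Icc 0 t, ∀ y ∈ quadrant, (ω s y ≠ 0 ∨ ρ s y ≠ 0) → δ' ≤ y.1 := by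
    intro s hst y hy hne
    have hy1 := hs.fst_pos_of_ne_zero hst hy hne
    by_contra hlt
    rw [not_le] at hlt
    have hgt : L₀ < Real.log (k / y.1) * Real.exp (-(a s / 2)) - C₁ * s := by
      have h1 : (L₀ + C₁ * T) * Real.exp (I / 2) < Real.log (k / y.1) := by
        rw [Real.lt_log_iff_exp_lt (div_pos hk hy1), lt_div_iff₀ hy1, ← lt_div_iff₀' (Real.exp_pos _),
          div_eq_mul_inv, ← Real.exp_neg]
        exact hlt.trans_le (min_le_right _ _)
      have h2 : L₀ + C₁ * T < Real.log (k / y.1) * Real.exp (-(I / 2)) := by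
        rw [Real.exp_neg, ← div_eq_mul_inv, lt_div_iff₀ (Real.exp_pos _)]
        exact h1
      have h3 : Real.exp (-(I / 2)) ≤ Real.exp (-(a s / 2)) :=
        Real.exp_le_exp.2 (by linarith [(ha s hst).2.1])
      have h4 : 0 ≤ Real.log (k / y.1) := le_trans (by positivity) h1.le
      have h5 := mul_le_mul_of_nonneg_left h3 h4
      have h6 := mul_le_mul_of_nonneg_left (hst.2.trans ht.2.le) hC₁0
      linarith
    obtain ⟨h1, h2⟩ := hlog s hst y ⟨hy1, hy.2⟩ hgt
    rcases hne with hne | hne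
    · exact hne h1
    · exact hne h2
  have hωM := hs.vorticity_le_of_support hδ'0 hMω hMρ hρM hωM0
    (fun s hst y hy hne => hleft s hst y hy (Or.inr hne))
  refine ⟨?_, ?_, fun hn => ?_⟩
  · rw [abs_of_nonneg (hωn t htt x hx)]
    refine ((hωM t htt x hx).trans ?_).trans (le_max_right _ _)
    have : Mρ / δ' * t ≤ Mρ / δ' * T := mul_le_mul_of_nonneg_left ht.2.le (by positivity)
    linarith
  · rw [abs_of_nonneg (hρn t htt x hx)]
    exact (hρM t htt x hx).trans (le_max_left _ _)
  · by_contra hcon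
    have hne : ω t x ≠ 0 ∨ ρ t x ≠ 0 := by
      by_contra hcon'
      push Not at hcon'
      exact hcon hcon'
    have hx1 := hs.fst_pos_of_ne_zero htt hx hne
    have hδx := hleft t htt x hx hne
    have hxo : x ∈ offAxis := ⟨hx1, hx.2⟩
    refine hn ⟨hδx, ?_, ?_⟩
    · refine le_trans ?_ (le_max_left _ _)
      by_contra hlt
      exact hcon (hright t htt x hxo (by simpa using hlt))
    · refine le_trans ?_ (le_max_right _ _)
      rw [le_div_iff₀ hδ'0]
      have h1 : x.1 * x.2 ≤ c₀ := by
        by_contra hlt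
        exact hcon (hprod t htt x hxo (not_le.1 hlt))
      nlinarith [hx.2]


/-! ### Truncated ray integrals -/

/-- The integral of `f` along the segment from `x` to `x + ℓ v`. -/
noncomputable def ray (ℓ : ℝ) (v : ℝ × ℝ) (f : ℝ × ℝ → ℝ) (x : ℝ × ℝ) : ℝ :=
  ∫ b in (0 : ℝ)..ℓ, f (x + b • v)

section ray

variable {ℓ : ℝ} {v : ℝ × ℝ} {f g : ℝ × ℝ → ℝ}

theorem continuous_ray (hf : Continuous f) : Continuous (ray ℓ v f) := by
  unfold ray
  apply intervalIntegral.continuous_parametric_intervalIntegral_of_continuous'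
    (f := fun x b => f (x + b • v))
  fun_prop

theorem abs_ray_le (hℓ : 0 ≤ ℓ) {C : ℝ} (hC : ∀ x, |f x| ≤ C) (x : ℝ × ℝ) :
    |ray ℓ v f x| ≤ ℓ * C := by
  have := intervalIntegral.norm_integral_le_of_norm_le_const (a := 0) (b := ℓ)
    (f := fun b => f (x + b • v)) (C := C) fun b _ => hC _
  rw [sub_zero, abs_of_nonneg hℓ, mul_comm] at this
  exact this

theorem ray_sub (hf : Continuous f) (hg : Continuous g) (x : ℝ × ℝ) :
    ray ℓ v (fun y => f y - g y) x = ray ℓ v f x - ray ℓ v g x :=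
  intervalIntegral.integral_sub (Continuous.intervalIntegrable (by fun_prop) _ _)
    (Continuous.intervalIntegrable (by fun_prop) _ _)

theorem abs_ray_sub_le (hℓ : 0 ≤ ℓ) {K : ℝ} (hf : Continuous f)
    (hK : ∀ x y, |f x - f y| ≤ K * ‖x - y‖) (x y : ℝ × ℝ) :
    |ray ℓ v f x - ray ℓ v f y| ≤ ℓ * K * ‖x - y‖ := by
  unfold ray
  rw [← intervalIntegral.integral_sub (Continuous.intervalIntegrable (by fun_prop) _ _)
    (Continuous.intervalIntegrable (by fun_prop) _ _)]
  have := intervalIntegral.norm_integral_le_of_norm_le_const (a := 0) (b := ℓ)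
    (f := fun b => f (x + b • v) - f (y + b • v)) (C := K * ‖x - y‖) fun b _ => by
      simpa using hK (x + b • v) (y + b • v)
  rw [sub_zero, abs_of_nonneg hℓ, mul_comm, ← mul_assoc] at this
  exact this

/-- A shift by `s v` moves the interval of integration to `[s, s + ℓ]`, so the ray integral of a
merely continuous function is differentiable in the direction of the ray. -/
theorem hasDerivAt_ray (hf : Continuous f) (x : ℝ × ℝ) (s : ℝ) :
    HasDerivAt (fun s : ℝ => ray ℓ v f (x + s • v))
      (f (x + s • v + ℓ • v) - f (x + s • v)) s := by
  have hc : Continuous fun b : ℝ => f (x + b • v) := by fun_prop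
  have heq : (fun s : ℝ => ray ℓ v f (x + s • v)) = fun s : ℝ =>
      (∫ b in (0 : ℝ)..(s + ℓ), f (x + b • v)) - ∫ b in (0 : ℝ)..s, f (x + b • v) := by
    funext s
    rw [intervalIntegral.integral_interval_sub_left (hc.intervalIntegrable _ _)
      (hc.intervalIntegrable _ _), ray]
    have := intervalIntegral.integral_comp_add_left (a := 0) (b := ℓ)
      (fun b => f (x + b • v)) s
    rw [add_zero] at this
    rw [← this]
    simp only [add_smul, add_assoc]
  rw [heq]
  have h1 : HasDerivAt (fun s : ℝ => ∫ b in (0 : ℝ)..(s + ℓ), f (x + b • v))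
      (f (x + (s + ℓ) • v)) s := by
    exact (hc.integral_hasStrictDerivAt 0 (s + ℓ)).hasDerivAt.comp_add_const s ℓ
  have h3 := h1.sub (hc.integral_hasStrictDerivAt 0 s).hasDerivAt
  rwa [add_smul, ← add_assoc] at h3

theorem ray_comm (hf : Continuous f) {v' : ℝ × ℝ} (x : ℝ × ℝ) :
    ray ℓ v (ray ℓ v' f) x = ray ℓ v' (ray ℓ v f) x := by
  unfold ray
  rw [intervalIntegral_intervalIntegral_swap]
  · simp only [add_right_comm]
  · have hc : Continuous (Function.uncurry fun a b : ℝ => f (x + a • v + b • v')) := by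
      unfold Function.uncurry
      fun_prop
    exact (hc.continuousOn.integrableOn_compact
      (isCompact_uIcc.prod isCompact_uIcc)).mono_set (prod_mono uIoc_subset_uIcc uIoc_subset_uIcc)

end ray

/-- A function with continuous derivatives along `(1, 0)` and `(1, α)` is differentiable. -/
theorem hasFDerivAt_of_directional {α : ℝ} (hα : α ≠ 0) {f p r : ℝ × ℝ → ℝ}
    (hp : Continuous p) (hr : Continuous r)
    (hfp : ∀ x (s : ℝ), HasDerivAt (fun s : ℝ => f (x + s • ((1 : ℝ), (0 : ℝ))))
      (p (x + s • ((1 : ℝ), (0 : ℝ)))) s)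
    (hfr : ∀ x (s : ℝ), HasDerivAt (fun s : ℝ => f (x + s • ((1 : ℝ), α)))
      (r (x + s • ((1 : ℝ), α))) s) (x : ℝ × ℝ) :
    HasFDerivAt f (p x • ContinuousLinearMap.fst ℝ ℝ ℝ +
      ((r x - p x) / α) • ContinuousLinearMap.snd ℝ ℝ ℝ) x := by
  -- In the coordinates with basis `(1, 0)`, `(1, α)` the hypotheses are continuous partial
  -- derivatives; `φ` is the inverse coordinate change.
  set e : ℝ × ℝ → ℝ × ℝ := fun z => (z.1 + z.2, α * z.2) with he
  have hec : Continuous e := by fun_prop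
  set φ : ℝ × ℝ → ℝ × ℝ := fun y => (y.1 - y.2 / α, y.2 / α) with hφ
  have heφ : ∀ y, e (φ y) = y := fun y => by
    simp only [he, hφ]
    ext
    · simp
    · simp only
      field_simp
  have h1 : HasStrictFDerivAt (Function.uncurry fun a b : ℝ => f (e (a, b)))
      ((p (e (φ x)) • ContinuousLinearMap.id ℝ ℝ).coprod
        (r (e (φ x)) • ContinuousLinearMap.id ℝ ℝ)) (φ x) := by
    refine hasStrictFDerivAt_uncurry_coprod (u := φ x) (f := fun a b : ℝ => f (e (a, b)))
      (f₁ := fun a b => p (e (a, b)) • ContinuousLinearMap.id ℝ ℝ)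
      (f₂ := fun a b => r (e (a, b)) • ContinuousLinearMap.id ℝ ℝ) ?_ ?_ ?_ ?_
    · refine Eventually.of_forall fun z => ?_
      have := hfp (z.2, α * z.2) z.1
      have e1 : ∀ s : ℝ, (z.2, α * z.2) + s • ((1 : ℝ), (0 : ℝ)) = e (s, z.2) := fun s => by
        simp [he, add_comm]
      simp only [e1] at this
      exact this.hasFDerivAt.congr_fderiv (by ext; simp [Function.HasUncurry.uncurry])
    · refine Eventually.of_forall fun z => ?_
      have := hfr (z.1, 0) z.2
      have e1 : ∀ s : ℝ, (z.1, (0 : ℝ)) + s • ((1 : ℝ), α) = e (z.1, s) := fun s => by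
        simp [he, mul_comm]
      simp only [e1] at this
      exact this.hasFDerivAt.congr_fderiv (by ext; simp [Function.HasUncurry.uncurry])
    · exact ((hp.comp hec).smul continuous_const).continuousAt
    · exact ((hr.comp hec).smul continuous_const).continuousAt
  have h2 : HasFDerivAt φ ((ContinuousLinearMap.fst ℝ ℝ ℝ -
      α⁻¹ • ContinuousLinearMap.snd ℝ ℝ ℝ).prod (α⁻¹ • ContinuousLinearMap.snd ℝ ℝ ℝ)) x := by
    have h3 : φ = ((ContinuousLinearMap.fst ℝ ℝ ℝ -
      α⁻¹ • ContinuousLinearMap.snd ℝ ℝ ℝ).prod (α⁻¹ • ContinuousLinearMap.snd ℝ ℝ ℝ)) := by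
      funext y
      simp [hφ, div_eq_inv_mul]
    rw [h3]
    exact ContinuousLinearMap.hasFDerivAt _
  have h4 := h1.hasFDerivAt.comp x h2
  have h5 : (Function.uncurry fun a b : ℝ => f (e (a, b))) ∘ φ = f := by
    funext y
    exact congrArg f (heφ y)
  rw [h5, heφ] at h4
  refine h4.congr_fderiv ?_
  ext
  · simp
  · simp
    field_simp
    ring


/-! ### The operator `Q` as an iterated ray integral -/

/-- The integral of `G` over the parallelogram at `x` spanned by `ℓ (1, 0)` and `ℓ (1, α)`. -/
noncomputable def Qt (α ℓ : ℝ) (G : ℝ × ℝ → ℝ) (x : ℝ × ℝ) : ℝ :=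
  α * ray ℓ (1, 0) (ray ℓ (1, α) G) x

/-- The derivative of `Qt α ℓ G` along `(1, 0)`. -/
noncomputable def dQtFst (α ℓ : ℝ) (G : ℝ × ℝ → ℝ) (x : ℝ × ℝ) : ℝ :=
  α * (ray ℓ (1, α) G (x + ℓ • ((1 : ℝ), (0 : ℝ))) - ray ℓ (1, α) G x)

/-- The derivative of `Qt α ℓ G` along `(1, α)`. -/
noncomputable def dQtDiag (α ℓ : ℝ) (G : ℝ × ℝ → ℝ) (x : ℝ × ℝ) : ℝ :=
  α * (ray ℓ (1, 0) G (x + ℓ • ((1 : ℝ), α)) - ray ℓ (1, 0) G x)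

/-- The derivative of `Qt α ℓ G`. -/
noncomputable def dQt (α ℓ : ℝ) (G : ℝ × ℝ → ℝ) (x : ℝ × ℝ) : ℝ × ℝ →L[ℝ] ℝ :=
  dQtFst α ℓ G x • ContinuousLinearMap.fst ℝ ℝ ℝ +
    ((dQtDiag α ℓ G x - dQtFst α ℓ G x) / α) • ContinuousLinearMap.snd ℝ ℝ ℝ

/-- The operator norm of `G ↦ Qt α ℓ G` into `C¹` is at most this constant. -/
noncomputable def cQ (α ℓ : ℝ) : ℝ := α * ℓ ^ 2 + 2 * α * ℓ + 4 * ℓ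

theorem norm_fst_snd_le {α p r c : ℝ} (hα : 0 < α) (hp : |p| ≤ α * c) (hr : |r| ≤ α * c) :
    ‖p • ContinuousLinearMap.fst ℝ ℝ ℝ + ((r - p) / α) • ContinuousLinearMap.snd ℝ ℝ ℝ‖ ≤
      α * c + 2 * c := by
  refine (norm_add_le _ _).trans (add_le_add ?_ ?_)
  · rw [norm_smul]
    exact (mul_le_of_le_one_right (norm_nonneg _) (ContinuousLinearMap.norm_fst_le _ _ _)).trans hp
  · rw [norm_smul]
    refine (mul_le_of_le_one_right (norm_nonneg _)
      (ContinuousLinearMap.norm_snd_le _ _ _)).trans ?_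
    rw [Real.norm_eq_abs, abs_div, abs_of_pos hα, div_le_iff₀ hα]
    linarith [abs_sub r p]

section Qt

variable {α ℓ : ℝ} {G G' : ℝ × ℝ → ℝ}

/-- By Fubini either edge of the parallelogram can be the outer ray, so `hasDerivAt_ray` gives both
directional derivatives while `G` is only continuous. -/
theorem hasFDerivAt_Qt (hα : 0 < α) (hG : Continuous G) (x : ℝ × ℝ) :
    HasFDerivAt (Qt α ℓ G) (dQt α ℓ G x) x := by
  refine hasFDerivAt_of_directional hα.ne' (p := dQtFst α ℓ G) (r := dQtDiag α ℓ G) ?_ ?_ ?_ ?_ x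
  · have := continuous_ray (ℓ := ℓ) (v := (1, α)) hG
    unfold dQtFst
    fun_prop
  · have := continuous_ray (ℓ := ℓ) (v := (1, 0)) hG
    unfold dQtDiag
    fun_prop
  · exact fun x s => (hasDerivAt_ray (continuous_ray hG) x s).const_mul α
  · have : Qt α ℓ G = fun x => α * ray ℓ (1, α) (ray ℓ (1, 0) G) x := by
      funext x
      rw [Qt, ray_comm hG]
    rw [this]
    exact fun x s => (hasDerivAt_ray (continuous_ray hG) x s).const_mul α

theorem cQ_nonneg (hα : 0 < α) (hℓ : 0 ≤ ℓ) : 0 ≤ cQ α ℓ := by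
  unfold cQ
  positivity

theorem abs_Qt_le (hα : 0 < α) (hℓ : 0 ≤ ℓ) {C : ℝ} (hC : ∀ x, |G x| ≤ C) (x : ℝ × ℝ) :
    |Qt α ℓ G x| ≤ cQ α ℓ * C := by
  have hC0 : 0 ≤ C := (abs_nonneg _).trans (hC 0)
  rw [Qt, abs_mul, abs_of_pos hα]
  have h1 := mul_le_mul_of_nonneg_left
    (abs_ray_le (v := (1, 0)) hℓ (fun y => abs_ray_le (v := (1, α)) hℓ hC y) x) hα.le
  refine h1.trans ?_
  have h2 : 0 ≤ (2 * α * ℓ + 4 * ℓ) * C := by positivity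
  unfold cQ
  nlinarith

theorem norm_dQt_le (hα : 0 < α) (hℓ : 0 ≤ ℓ) {C : ℝ} (hC : ∀ x, |G x| ≤ C) (x : ℝ × ℝ) :
    ‖dQt α ℓ G x‖ ≤ cQ α ℓ * C := by
  have hC0 : 0 ≤ C := (abs_nonneg _).trans (hC 0)
  have hdiff : ∀ {v : ℝ × ℝ} (y z : ℝ × ℝ),
      |α * (ray ℓ v G y - ray ℓ v G z)| ≤ α * (2 * ℓ * C) := fun {v} y z => by
    rw [abs_mul, abs_of_pos hα]
    refine mul_le_mul_of_nonneg_left ?_ hα.le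
    have h1 := abs_ray_le (v := v) hℓ hC y
    have h2 := abs_ray_le (v := v) hℓ hC z
    linarith [abs_sub (ray ℓ v G y) (ray ℓ v G z)]
  refine (norm_fst_snd_le hα (hdiff _ _) (hdiff _ _)).trans ?_
  have h2 : 0 ≤ α * ℓ ^ 2 * C := by positivity
  unfold cQ
  nlinarith

/-- The directional derivatives are differences of ray integrals of `G` and inherit its Lipschitz
continuity. This is the gain of one derivative on which the Picard argument rests. -/
theorem norm_dQt_sub_le (hα : 0 < α) (hℓ : 0 ≤ ℓ) {K : ℝ} (hK0 : 0 ≤ K) (hG : Continuous G)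
    (hK : ∀ x y, |G x - G y| ≤ K * ‖x - y‖) (x y : ℝ × ℝ) :
    ‖dQt α ℓ G x - dQt α ℓ G y‖ ≤ cQ α ℓ * K * ‖x - y‖ := by
  have hdiff : ∀ {v : ℝ × ℝ} (z : ℝ × ℝ),
      |α * (ray ℓ v G (x + z) - ray ℓ v G x) - α * (ray ℓ v G (y + z) - ray ℓ v G y)| ≤
        α * (2 * ℓ * K * ‖x - y‖) := fun {v} z => by
    rw [← mul_sub, abs_mul, abs_of_pos hα]
    refine mul_le_mul_of_nonneg_left ?_ hα.le
    have h1 := abs_ray_sub_le (v := v) hℓ hG hK (x + z) (y + z)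
    have h2 := abs_ray_sub_le (v := v) hℓ hG hK x y
    rw [add_sub_add_right_eq_sub] at h1
    have h3 := abs_sub (ray ℓ v G (x + z) - ray ℓ v G (y + z)) (ray ℓ v G x - ray ℓ v G y)
    have h4 : ray ℓ v G (x + z) - ray ℓ v G x - (ray ℓ v G (y + z) - ray ℓ v G y) =
      ray ℓ v G (x + z) - ray ℓ v G (y + z) - (ray ℓ v G x - ray ℓ v G y) := by ring
    rw [h4]
    linarith
  have heq : dQt α ℓ G x - dQt α ℓ G y =
      (dQtFst α ℓ G x - dQtFst α ℓ G y) • ContinuousLinearMap.fst ℝ ℝ ℝ +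
      (((dQtDiag α ℓ G x - dQtDiag α ℓ G y) - (dQtFst α ℓ G x - dQtFst α ℓ G y)) / α) •
        ContinuousLinearMap.snd ℝ ℝ ℝ := by
    unfold dQt
    module
  rw [heq]
  refine (norm_fst_snd_le hα (hdiff _) (hdiff _)).trans ?_
  have h2 : 0 ≤ α * ℓ ^ 2 * K * ‖x - y‖ := by positivity
  unfold cQ
  nlinarith

theorem Qt_sub (hG : Continuous G) (hG' : Continuous G') (x : ℝ × ℝ) :
    Qt α ℓ (fun y => G y - G' y) x = Qt α ℓ G x - Qt α ℓ G' x := by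
  have : ray ℓ (1, α) (fun y => G y - G' y) =
      fun y => ray ℓ (1, α) G y - ray ℓ (1, α) G' y := funext fun y => ray_sub hG hG' y
  rw [Qt, this, ray_sub (continuous_ray hG) (continuous_ray hG')]
  simp only [Qt]
  ring

theorem dQt_sub (hG : Continuous G) (hG' : Continuous G') (x : ℝ × ℝ) :
    dQt α ℓ (fun y => G y - G' y) x = dQt α ℓ G x - dQt α ℓ G' x := by
  simp only [dQt, dQtFst, dQtDiag, ray_sub hG hG']
  module

/-- On the quadrant, `Q` is given by an iterated ray integral. -/
theorem Q_eq_Qt (hα : 0 < α) (hℓ : 0 ≤ ℓ) (hG : Continuous G) {w : ℝ × ℝ → ℝ}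
    (hGw : ∀ y ∈ quadrant, G y = kern y * w y) (hsupp : ∀ y : ℝ × ℝ, ℓ < y.1 → G y = 0)
    {x : ℝ × ℝ} (hx : x ∈ quadrant) : Q α w x = Qt α ℓ G x := by
  have h1 : Q α w x = ∫ y in {y : ℝ × ℝ | y - x ∈ sector α}, G y := by
    rw [Q_eq]
    exact setIntegral_congr_fun (measurableSet_sector_add α x) fun y hy =>
      (hGw y (sector_add_subset_quadrant hx hy)).symm
  -- The map `z ↦ x + z₁ (1, 0) + z₂ (1, α)` carries the quadrant onto `x + S_α` with Jacobian `α`.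
  set φ : ℝ × ℝ → ℝ × ℝ := fun z => x + (z.1 + z.2, α * z.2) with hφ
  set L : ℝ × ℝ →L[ℝ] ℝ × ℝ := (ContinuousLinearMap.fst ℝ ℝ ℝ +
    ContinuousLinearMap.snd ℝ ℝ ℝ).prod (α • ContinuousLinearMap.snd ℝ ℝ ℝ) with hL
  have hφL : φ = fun z => x + L z := by
    funext z
    simp [hφ, hL]
  have himage : φ '' (Ici (0 : ℝ) ×ˢ Ici (0 : ℝ)) = {y : ℝ × ℝ | y - x ∈ sector α} := by
    ext y
    constructor
    · rintro ⟨z, ⟨hz1, hz2⟩, rfl⟩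
      simp only [mem_Ici] at hz1 hz2
      simp only [hφ, mem_ofPred_eq, add_sub_cancel_left, sector]
      exact ⟨by linarith, by positivity, by nlinarith⟩
    · rintro ⟨hy1, hy2, hy3⟩
      simp only [Prod.fst_sub, Prod.snd_sub] at hy1 hy2 hy3
      refine ⟨(y.1 - x.1 - (y.2 - x.2) / α, (y.2 - x.2) / α), ⟨?_, ?_⟩, ?_⟩
      · simp only [mem_Ici, sub_nonneg]
        rw [div_le_iff₀ hα]
        linarith
      · simp only [mem_Ici]
        positivity
      · simp only [hφ]
        ext
        · simp
        · simp only [Prod.snd_add]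
          field_simp
          ring
  have hinj : InjOn φ (Ici (0 : ℝ) ×ˢ Ici (0 : ℝ)) := by
    intro z _ z' _ h
    simp only [hφ, add_right_inj, Prod.mk.injEq] at h
    have h2 : z.2 = z'.2 := mul_left_cancel₀ hα.ne' h.2
    exact Prod.ext (by linarith [h.1]) h2
  have hdet : L.det = α := by
    have : L.det = LinearMap.det (L : ℝ × ℝ →ₗ[ℝ] ℝ × ℝ) := rfl
    rw [this, ← LinearMap.det_toMatrix (Module.Basis.finTwoProd ℝ), Matrix.det_fin_two]
    simp [LinearMap.toMatrix_apply, hL]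
  have h2 := integral_image_eq_integral_abs_det_fderiv_smul volume
    (measurableSet_Ici.prod measurableSet_Ici)
    (fun z _ => (show HasFDerivAt φ L z by
      rw [hφL]
      exact L.hasFDerivAt.const_add x).hasFDerivWithinAt) hinj G
  rw [himage, hdet, abs_of_pos hα] at h2
  rw [h1, h2]
  -- Since `G` vanishes for `y₁ > ℓ` and `y₁ = x₁ + z₁ + z₂` with `x₁ ≥ 0`, only `z₁, z₂ ≤ ℓ`
  -- contribute.
  have h3 : ∫ z in Ici (0 : ℝ) ×ˢ Ici (0 : ℝ), α • G (φ z) =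
      ∫ z in Icc 0 ℓ ×ˢ Icc 0 ℓ, α • G (φ z) := by
    refine (setIntegral_eq_of_subset_of_forall_sdiff_eq_zero
      (measurableSet_Ici.prod measurableSet_Ici)
      (prod_mono Icc_subset_Ici_self Icc_subset_Ici_self) ?_)
    rintro z ⟨⟨hz1, hz2⟩, hz3⟩
    simp only [mem_Ici] at hz1 hz2
    rw [hsupp, smul_zero]
    have hx1 := hx.1
    by_contra hle
    simp only [hφ, Prod.fst_add, not_lt] at hle
    exact hz3 ⟨⟨hz1, by linarith⟩, ⟨hz2, by linarith⟩⟩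
  have hφc : Continuous φ := by fun_prop
  rw [h3, Measure.volume_eq_prod, setIntegral_prod _ ?_]
  · simp only [Qt, ray, smul_eq_mul]
    rw [← intervalIntegral.integral_const_mul, intervalIntegral.integral_of_le hℓ,
      integral_Icc_eq_integral_Ioc]
    refine setIntegral_congr_fun measurableSet_Ioc fun a _ => ?_
    rw [← intervalIntegral.integral_const_mul, intervalIntegral.integral_of_le hℓ,
      integral_Icc_eq_integral_Ioc]
    refine setIntegral_congr_fun measurableSet_Ioc fun b _ => ?_
    congr 2
    ext
    · simp [hφ, add_assoc]
    · simp [hφ, mul_comm]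
  · have hc : Continuous fun z => α • G (φ z) := by fun_prop
    exact hc.continuousOn.integrableOn_compact
      (isCompact_Icc.prod isCompact_Icc)

end Qt


/-! ### Bounded `C¹` functions -/

section C1b

variable (V W : Type*) [NormedAddCommGroup V] [NormedSpace ℝ V] [NormedAddCommGroup W]
  [NormedSpace ℝ W]

/-- A submodule of a normed space, with the module structure that underlies the norm. -/
def submoduleOf {A : Type*} [NormedAddCommGroup A] [NormedSpace ℝ A] (p : A → Prop) (h0 : p 0)
    (hadd : ∀ a b, p a → p b → p (a + b)) (hsmul : ∀ (c : ℝ) a, p a → p (c • a)) :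
    Submodule ℝ A where
  carrier := {a | p a}
  add_mem' := fun ha hb => hadd _ _ ha hb
  zero_mem' := h0
  smul_mem' := hsmul

/-- Bounded functions with a bounded continuous derivative, as pairs (function, derivative). -/
noncomputable def c1bSubmodule :=
  submoduleOf (A := (V →ᵇ W) × (V →ᵇ (V →L[ℝ] W))) (fun p => ∀ x, HasFDerivAt p.1 (p.2 x) x)
    (fun x => by simpa using! hasFDerivAt_const (0 : W) x)
    (fun _ _ ha hb x => (ha x).add (hb x))
    (fun c _ ha x => (ha x).const_smul c)

variable {V W}

/-- Uniform limits of functions and derivatives again form such a pair; this yields the completeness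
that Picard iteration needs. -/
theorem isClosed_c1bSubmodule :
    IsClosed {p : (V →ᵇ W) × (V →ᵇ (V →L[ℝ] W)) | p ∈ c1bSubmodule V W} := by
  refine IsSeqClosed.isClosed fun u p hu hlim x => ?_
  have h1 : Tendsto (fun n => (u n).1) atTop (𝓝 p.1) := (continuous_fst.tendsto p).comp hlim
  have h2 : Tendsto (fun n => (u n).2) atTop (𝓝 p.2) := (continuous_snd.tendsto p).comp hlim
  refine hasFDerivAt_of_tendstoUniformly (f := fun n => (u n).1) (f' := fun n => (u n).2)
    (l := atTop) (BoundedContinuousFunction.tendsto_iff_tendstoUniformly.1 h2)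
    (fun n x => hu n x) (fun x => ?_) x
  exact (BoundedContinuousFunction.tendsto_iff_tendstoUniformly.1 h1).tendsto_at x

variable (V W) in
/-- The space of bounded functions with a bounded continuous derivative. -/
def C1b : Type _ := c1bSubmodule V W

noncomputable instance : NormedAddCommGroup (C1b V W) :=
  inferInstanceAs (NormedAddCommGroup (c1bSubmodule V W))

noncomputable instance : NormedSpace ℝ (C1b V W) :=
  inferInstanceAs (NormedSpace ℝ (c1bSubmodule V W))

instance [CompleteSpace W] : CompleteSpace (C1b V W) :=
  isClosed_c1bSubmodule.completeSpace_coe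

namespace C1b

/-- The underlying function. -/
noncomputable def toFun (w : C1b V W) : V → W := w.1.1

/-- The derivative. -/
noncomputable def der (w : C1b V W) : V → V →L[ℝ] W := w.1.2

theorem hasFDerivAt (w : C1b V W) (x : V) : HasFDerivAt w.toFun (w.der x) x := w.2 x

theorem continuous_der (w : C1b V W) : Continuous w.der := w.1.2.continuous

theorem norm_toFun_le (w : C1b V W) (x : V) : ‖w.toFun x‖ ≤ ‖w‖ :=
  (w.1.1.norm_coe_le_norm x).trans (norm_fst_le w.1)

theorem norm_der_le (w : C1b V W) (x : V) : ‖w.der x‖ ≤ ‖w‖ :=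
  (w.1.2.norm_coe_le_norm x).trans (norm_snd_le w.1)

@[simp] theorem sub_toFun (w w' : C1b V W) (x : V) : (w - w').toFun x = w.toFun x - w'.toFun x :=
  rfl

@[simp] theorem sub_der (w w' : C1b V W) (x : V) : (w - w').der x = w.der x - w'.der x := rfl

@[simp] theorem zero_toFun (x : V) : (0 : C1b V W).toFun x = 0 := rfl

theorem norm_le {w : C1b V W} {C : ℝ} (hC : 0 ≤ C) (h : ∀ x, ‖w.toFun x‖ ≤ C)
    (h' : ∀ x, ‖w.der x‖ ≤ C) : ‖w‖ ≤ C :=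
  max_le ((BoundedContinuousFunction.norm_le hC).2 h) ((BoundedContinuousFunction.norm_le hC).2 h')

/-- Constructor from a bounded function with bounded continuous derivative. -/
noncomputable def mk (f : V → W) (f' : V → V →L[ℝ] W) (C : ℝ) (h : ∀ x, HasFDerivAt f (f' x) x)
    (hc : Continuous f') (hf : ∀ x, ‖f x‖ ≤ C) (hf' : ∀ x, ‖f' x‖ ≤ C) : C1b V W :=
  ⟨(BoundedContinuousFunction.ofNormedAddCommGroup f
      (continuous_iff_continuousAt.2 fun x => (h x).continuousAt) C hf,
    BoundedContinuousFunction.ofNormedAddCommGroup f' hc C hf'), h⟩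

theorem norm_toFun_sub_le (w : C1b V W) (x y : V) :
    ‖w.toFun x - w.toFun y‖ ≤ ‖w‖ * ‖x - y‖ :=
  Convex.norm_image_sub_le_of_norm_hasFDerivWithin_le (s := univ)
    (fun z _ => (w.hasFDerivAt z).hasFDerivWithinAt) (fun z _ => w.norm_der_le z) convex_univ
    (mem_univ y) (mem_univ x)

/-- Evaluation, as a continuous linear map. -/
noncomputable def evalL (x : V) : C1b V W →L[ℝ] W :=
  LinearMap.mkContinuous ⟨⟨fun w => w.toFun x, fun _ _ => rfl⟩, fun _ _ => rfl⟩ 1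
    fun w => (w.norm_toFun_le x).trans_eq (one_mul _).symm

@[simp] theorem evalL_apply (x : V) (w : C1b V W) : evalL x w = w.toFun x := rfl

theorem norm_evalL_sub_le (x y : V) : ‖(evalL x - evalL y : C1b V W →L[ℝ] W)‖ ≤ ‖x - y‖ :=
  ContinuousLinearMap.opNorm_le_bound _ (norm_nonneg _) fun w => by
    rw [mul_comm]
    exact w.norm_toFun_sub_le x y

/-- Near `(w, x)` the evaluation is `w(z₂) + (z₁ - w)(z₂)`. Replacing `z₂` by `x` in the second term
costs at most `‖z₁ - w‖ ‖z₂ - x‖`, which is of second order. -/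
theorem hasFDerivAt_eval (z : C1b V W × V) :
    HasFDerivAt (fun z : C1b V W × V => z.1.toFun z.2) ((evalL z.2).coprod (z.1.der z.2)) z := by
  obtain ⟨w, x⟩ := z
  have h1 : HasFDerivAt (fun z : C1b V W × V => w.toFun z.2)
      ((w.der x).comp (ContinuousLinearMap.snd ℝ (C1b V W) V)) (w, x) :=
    (w.hasFDerivAt x).comp (w, x) hasFDerivAt_snd
  have h2 : HasFDerivAt (fun z : C1b V W × V => (z.1 - w).toFun z.2)
      ((evalL x).comp (ContinuousLinearMap.fst ℝ (C1b V W) V)) (w, x) := by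
    refine HasFDerivAt.of_isLittleO ?_
    rw [Asymptotics.isLittleO_iff]
    intro c hc
    have hev : ∀ᶠ z : C1b V W × V in 𝓝 (w, x), ‖z.2 - x‖ < c := by
      have : Tendsto (fun z : C1b V W × V => ‖z.2 - x‖) (𝓝 (w, x)) (𝓝 ‖x - x‖) :=
        Continuous.tendsto (by fun_prop) (w, x)
      rw [sub_self, norm_zero] at this
      exact this.eventually (gt_mem_nhds hc)
    filter_upwards [hev] with z hz
    have e1 : (z.1 - w).toFun z.2 - (w - w).toFun x -
        ((evalL x).comp (ContinuousLinearMap.fst ℝ (C1b V W) V)) (z - (w, x)) =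
        (z.1 - w).toFun z.2 - (z.1 - w).toFun x := by
      simp
    rw [e1]
    calc ‖(z.1 - w).toFun z.2 - (z.1 - w).toFun x‖ ≤ ‖z.1 - w‖ * ‖z.2 - x‖ :=
          norm_toFun_sub_le _ _ _
      _ ≤ ‖z - (w, x)‖ * c := mul_le_mul (norm_fst_le (z - (w, x))) hz.le (norm_nonneg _)
          (norm_nonneg _)
      _ = c * ‖z - (w, x)‖ := mul_comm _ _
  have h3 := h2.add h1
  refine (h3.congr_fderiv ?_).congr_of_eventuallyEq (Eventually.of_forall fun z => ?_)
  · ext z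
    · simp
    · simp
  · simp

/-- The evaluation map is `C¹` jointly. -/
theorem contDiff_eval : ContDiff ℝ 1 (fun z : C1b V W × V => z.1.toFun z.2) := by
  refine contDiff_one_iff_hasFDerivAt.2 ⟨_, ?_, hasFDerivAt_eval⟩
  have hcont1 : Continuous fun z : C1b V W × V => (evalL z.2 : C1b V W →L[ℝ] W) := by
    refine Continuous.comp (g := fun x : V => (evalL x : C1b V W →L[ℝ] W)) ?_ continuous_snd
    refine (LipschitzWith.of_dist_le_mul (K := 1) fun x y => ?_).continuous
    simpa [dist_eq_norm] using norm_evalL_sub_le x y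
  have hcont2 : Continuous fun z : C1b V W × V => z.1.der z.2 := by
    have : Continuous fun z : (V →ᵇ (V →L[ℝ] W)) × V => z.1 z.2 := continuous_eval
    exact this.comp (f := fun z : C1b V W × V => (z.1.1.2, z.2)) (by fun_prop)
  exact hcont1.continuousLinearMapCoprod hcont2

end C1b

end C1b


/-! ### Velocity fields with Lipschitz derivative -/

section C11

variable {V W : Type*} [NormedAddCommGroup V] [NormedSpace ℝ V] [NormedAddCommGroup W]
  [NormedSpace ℝ W]

/-- `b` is bounded with a bounded and Lipschitz derivative `b'`, all with constant `β`. -/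
structure C11With (β : ℝ) (b : V → W) (b' : V → V →L[ℝ] W) : Prop where
  hasFDerivAt : ∀ x, HasFDerivAt b (b' x) x
  norm_le : ∀ x, ‖b x‖ ≤ β
  norm_der_le : ∀ x, ‖b' x‖ ≤ β
  norm_der_sub_le : ∀ x y, ‖b' x - b' y‖ ≤ β * ‖x - y‖

theorem norm_sub_le_of_norm_hasFDerivAt_le {β : ℝ} {b : V → W} {b' : V → V →L[ℝ] W}
    (h : ∀ x, HasFDerivAt b (b' x) x) (hβ : ∀ x, ‖b' x‖ ≤ β) (x y : V) :
    ‖b x - b y‖ ≤ β * ‖x - y‖ :=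
  Convex.norm_image_sub_le_of_norm_hasFDerivWithin_le (s := univ)
    (fun z _ => (h z).hasFDerivWithinAt) (fun z _ => hβ z) convex_univ (mem_univ y) (mem_univ x)

theorem exists_c11With_of_contDiff {b : V → W} (hb : ContDiff ℝ 2 b) (hs : HasCompactSupport b) :
    ∃ β, 0 ≤ β ∧ C11With β b (fderiv ℝ b) := by
  have hd : ContDiff ℝ 1 (fderiv ℝ b) := hb.fderiv_right (by norm_num)
  have hds : HasCompactSupport (fderiv ℝ b) := hs.fderiv (𝕜 := ℝ)
  obtain ⟨C₀, hC₀⟩ := hs.exists_bound_of_continuous hb.continuous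
  obtain ⟨C₁, hC₁⟩ := hds.exists_bound_of_continuous hd.continuous
  obtain ⟨C₂, hC₂⟩ := hd.lipschitzWith_of_hasCompactSupport hds (by norm_num)
  refine ⟨max (max C₀ C₁) C₂, le_max_of_le_right C₂.2,
    fun x => (hb.differentiable (by norm_num) x).hasFDerivAt, fun x => ?_, fun x => ?_,
    fun x y => ?_⟩
  · exact (hC₀ x).trans ((le_max_left _ _).trans (le_max_left _ _))
  · exact (hC₁ x).trans ((le_max_right _ _).trans (le_max_left _ _))
  · rw [← dist_eq_norm, ← dist_eq_norm]
    exact (hC₂.dist_le_mul x y).trans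
      (mul_le_mul_of_nonneg_right (le_max_right _ _) dist_nonneg)

/-- The derivative of `q • e + e₀`. -/
def smulAddDer (q : V → ℝ) (q' : V → V →L[ℝ] ℝ) (e : V → W) (e' e₀' : V → V →L[ℝ] W) (x : V) :
    V →L[ℝ] W :=
  q x • e' x + (q' x).smulRight (e x) + e₀' x

variable {β : ℝ} {e e₀ : V → W} {e' e₀' : V → V →L[ℝ] W} {q : V → ℝ} {q' : V → V →L[ℝ] ℝ}

theorem hasFDerivAt_smul_add (he : C11With β e e') (he₀ : C11With β e₀ e₀')
    (hq : ∀ x, HasFDerivAt q (q' x) x) (x : V) :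
    HasFDerivAt (fun x => q x • e x + e₀ x) (smulAddDer q q' e e' e₀' x) x :=
  ((hq x).smul (he.hasFDerivAt x)).add (he₀.hasFDerivAt x)

theorem norm_smul_add_le (he : C11With β e e') (he₀ : C11With β e₀ e₀') {γ : ℝ}
    (hq : ∀ x, |q x| ≤ γ) (x : V) : ‖q x • e x + e₀ x‖ ≤ β * (2 * γ + 1) := by
  have hγ : 0 ≤ γ := (abs_nonneg _).trans (hq x)
  have hβ : 0 ≤ β := (norm_nonneg _).trans (he.norm_le x)
  refine (norm_add_le _ _).trans ?_
  have h1 : ‖q x • e x‖ ≤ γ * β := by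
    rw [norm_smul]
    exact mul_le_mul (hq x) (he.norm_le x) (norm_nonneg _) hγ
  nlinarith [he₀.norm_le x, mul_nonneg hγ hβ]

theorem norm_smul_add_smulRight_le {β : ℝ} {A : V →L[ℝ] W} {B : V →L[ℝ] ℝ} {c : W} {s γ : ℝ}
    (hs : |s| ≤ γ) (hB : ‖B‖ ≤ γ) (hA : ‖A‖ ≤ β) (hc : ‖c‖ ≤ β) :
    ‖s • A + B.smulRight c‖ ≤ β * (2 * γ) := by
  have hγ : 0 ≤ γ := (abs_nonneg _).trans hs
  refine (norm_add_le _ _).trans ?_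
  rw [norm_smul, ContinuousLinearMap.norm_smulRight_apply, Real.norm_eq_abs]
  have h1 := mul_le_mul hs hA (norm_nonneg _) hγ
  have h2 := mul_le_mul hB hc (norm_nonneg _) hγ
  linarith

theorem norm_smulAddDer_le (he : C11With β e e') (he₀ : C11With β e₀ e₀') {γ : ℝ}
    (hq : ∀ x, |q x| ≤ γ) (hq' : ∀ x, ‖q' x‖ ≤ γ) (x : V) :
    ‖smulAddDer q q' e e' e₀' x‖ ≤ β * (2 * γ + 1) := by
  refine (norm_add_le _ _).trans ?_
  have := norm_smul_add_smulRight_le (hq x) (hq' x) (he.norm_der_le x) (he.norm_le x)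
  linarith [he₀.norm_der_le x]

theorem norm_smulAddDer_sub_le (he : C11With β e e') (he₀ : C11With β e₀ e₀') {γ : ℝ}
    (hq : C11With γ q q') (x y : V) :
    ‖smulAddDer q q' e e' e₀' x - smulAddDer q q' e e' e₀' y‖ ≤ β * (4 * γ + 1) * ‖x - y‖ := by
  have heq : smulAddDer q q' e e' e₀' x - smulAddDer q q' e e' e₀' y =
      ((q x - q y) • e' x + (q' x - q' y).smulRight (e x)) +
      (q y • (e' x - e' y) + (q' y).smulRight (e x - e y)) + (e₀' x - e₀' y) := by
    ext z
    simp only [smulAddDer, add_apply, sub_apply,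
      smul_apply, ContinuousLinearMap.smulRight_apply]
    module
  have h1 := norm_smul_add_smulRight_le
    (norm_sub_le_of_norm_hasFDerivAt_le hq.hasFDerivAt hq.norm_der_le x y)
    (hq.norm_der_sub_le x y) (he.norm_der_le x) (he.norm_le x)
  have h2 := norm_smul_add_smulRight_le (hq.norm_le y)
    (hq.norm_der_le y) (he.norm_der_sub_le x y)
    (norm_sub_le_of_norm_hasFDerivAt_le he.hasFDerivAt he.norm_der_le x y)
  have h3 := he₀.norm_der_sub_le x y
  rw [heq]
  refine (norm_add₃_le).trans ?_
  linarith

theorem norm_smul_sub_smul_le (he : C11With β e e') {p : V → ℝ} {γ : ℝ}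
    (hq : ∀ x, |q x - p x| ≤ γ) (x : V) :
    ‖(q x • e x + e₀ x) - (p x • e x + e₀ x)‖ ≤ β * (2 * γ) := by
  have hγ : 0 ≤ γ := (abs_nonneg _).trans (hq x)
  have hβ : 0 ≤ β := (norm_nonneg _).trans (he.norm_le x)
  rw [add_sub_add_right_eq_sub, ← sub_smul, norm_smul]
  have := mul_le_mul (hq x) (he.norm_le x) (norm_nonneg _) hγ
  rw [Real.norm_eq_abs]
  nlinarith

theorem norm_smulAddDer_sub_smulAddDer_le (he : C11With β e e') {p : V → ℝ} {p' : V → V →L[ℝ] ℝ}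
    {γ : ℝ} (hq : ∀ x, |q x - p x| ≤ γ) (hq' : ∀ x, ‖q' x - p' x‖ ≤ γ) (x : V) :
    ‖smulAddDer q q' e e' e₀' x - smulAddDer p p' e e' e₀' x‖ ≤ β * (2 * γ) := by
  have heq : smulAddDer q q' e e' e₀' x - smulAddDer p p' e e' e₀' x =
      (q x - p x) • e' x + (q' x - p' x).smulRight (e x) := by
    ext z
    simp only [smulAddDer, add_apply, sub_apply,
      smul_apply, ContinuousLinearMap.smulRight_apply]
    module
  rw [heq]
  exact norm_smul_add_smulRight_le (hq x) (hq' x) (he.norm_der_le x) (he.norm_le x)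

end C11

theorem c11With_Qt {α ℓ C K : ℝ} (hα : 0 < α) (hℓ : 0 ≤ ℓ) (hK0 : 0 ≤ K) {G : ℝ × ℝ → ℝ}
    (hG : Continuous G) (hC : ∀ x, |G x| ≤ C) (hK : ∀ x y, |G x - G y| ≤ K * ‖x - y‖) :
    C11With (cQ α ℓ * (C + K)) (Qt α ℓ G) (dQt α ℓ G) := by
  have hC0 : 0 ≤ C := (abs_nonneg _).trans (hC 0)
  have hc := cQ_nonneg hα hℓ
  have h1 : cQ α ℓ * C ≤ cQ α ℓ * (C + K) := by nlinarith
  have h2 : cQ α ℓ * K ≤ cQ α ℓ * (C + K) := by nlinarith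
  exact ⟨hasFDerivAt_Qt hα hG, fun x => (abs_Qt_le hα hℓ hC x).trans h1,
    fun x => (norm_dQt_le hα hℓ hC x).trans h1,
    fun x y => (norm_dQt_sub_le hα hℓ hK0 hG hK x y).trans
      (mul_le_mul_of_nonneg_right h2 (norm_nonneg _))⟩

/-! ### Flow maps close to the identity -/

section flow

variable {V P : Type*} [NormedAddCommGroup V] [NormedSpace ℝ V] [NormedAddCommGroup P]
  [NormedSpace ℝ P]

/-- The map `a ↦ a + ξ(a)`, with `ξ` the first component of `w`. -/
noncomputable def flow (w : C1b V (V × P)) (a : V) : V := a + (w.toFun a).1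

/-- The derivative of `flow w`. -/
noncomputable def flowDer (w : C1b V (V × P)) (a : V) : V →L[ℝ] V :=
  ContinuousLinearMap.id ℝ V + (ContinuousLinearMap.fst ℝ V P).comp (w.der a)

/-- The inverse of `flow w`. -/
noncomputable def invFlow (w : C1b V (V × P)) : V → V := Function.invFun (flow w)

variable {w w' : C1b V (V × P)}

theorem hasFDerivAt_flow (w : C1b V (V × P)) (a : V) : HasFDerivAt (flow w) (flowDer w a) a :=
  (hasFDerivAt_id a).add (w.hasFDerivAt a).fst

theorem continuous_flow (w : C1b V (V × P)) : Continuous (flow w) :=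
  continuous_iff_continuousAt.2 fun a => (hasFDerivAt_flow w a).continuousAt

theorem continuous_flowDer (w : C1b V (V × P)) : Continuous (flowDer w) :=
  continuous_const.add (continuous_const.clm_comp w.continuous_der)

theorem norm_fst_der_le (w : C1b V (V × P)) (a : V) :
    ‖(ContinuousLinearMap.fst ℝ V P).comp (w.der a)‖ ≤ ‖w‖ := by
  refine (ContinuousLinearMap.opNorm_comp_le _ _).trans ?_
  exact (mul_le_of_le_one_left (norm_nonneg _) (ContinuousLinearMap.norm_fst_le _ _ _)).trans
    (w.norm_der_le a)

theorem norm_flowDer_le (hw : ‖w‖ ≤ 1 / 2) (a : V) : ‖flowDer w a‖ ≤ 2 := by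
  refine (norm_add_le _ _).trans ?_
  linarith [norm_fst_der_le w a, ContinuousLinearMap.norm_id_le (𝕜 := ℝ) (E := V)]

theorem norm_flowDer_sub_le (w w' : C1b V (V × P)) (a : V) :
    ‖flowDer w a - flowDer w' a‖ ≤ ‖w - w'‖ := by
  have : flowDer w a - flowDer w' a =
      (ContinuousLinearMap.fst ℝ V P).comp ((w - w').der a) := by
    simp only [flowDer, C1b.sub_der, ContinuousLinearMap.comp_sub]
    abel
  rw [this]
  exact norm_fst_der_le _ a

theorem norm_flow_sub_flow_le (w w' : C1b V (V × P)) (a : V) :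
    ‖flow w a - flow w' a‖ ≤ ‖w - w'‖ := by
  have : flow w a - flow w' a = ((w - w').toFun a).1 := by
    simp [flow]
  rw [this]
  exact (norm_fst_le _).trans ((w - w').norm_toFun_le a)

theorem norm_flow_sub_self_le (w : C1b V (V × P)) (a : V) : ‖flow w a - a‖ ≤ ‖w‖ := by
  rw [flow, add_sub_cancel_left]
  exact (norm_fst_le _).trans (w.norm_toFun_le a)

/-- The displacement has Lipschitz constant at most `1 / 2`, so the perturbed identity shrinks
distances at most by the factor two. -/
theorem norm_sub_le_flow (hw : ‖w‖ ≤ 1 / 2) (a b : V) :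
    ‖a - b‖ ≤ 2 * ‖flow w a - flow w b‖ := by
  have h1 : a - b = (flow w a - flow w b) - ((w.toFun a).1 - (w.toFun b).1) := by
    simp only [flow]
    abel
  have h2 : ‖(w.toFun a).1 - (w.toFun b).1‖ ≤ 1 / 2 * ‖a - b‖ :=
    ((norm_fst_le (w.toFun a - w.toFun b)).trans (w.norm_toFun_sub_le a b)).trans
      (mul_le_mul_of_nonneg_right hw (norm_nonneg _))
  have h3 := norm_sub_le (flow w a - flow w b) ((w.toFun a).1 - (w.toFun b).1)
  rw [← h1] at h3
  linarith

theorem injective_flow (hw : ‖w‖ ≤ 1 / 2) : Function.Injective (flow w) := fun a b hab => by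
  have := norm_sub_le_flow hw a b
  rw [hab, sub_self, norm_zero, mul_zero] at this
  exact sub_eq_zero.1 (norm_le_zero_iff.1 this)

/-- A preimage of `x` is a fixed point of the contraction `a ↦ x - ξ(a)`. -/
theorem surjective_flow [CompleteSpace V] (hw : ‖w‖ ≤ 1 / 2) :
    Function.Surjective (flow w) := fun x => by
  have hc : ContractingWith (1 / 2) fun a => x - (w.toFun a).1 := by
    refine ⟨by rw [← NNReal.coe_lt_coe]; norm_num, LipschitzWith.of_dist_le_mul fun a b => ?_⟩
    rw [dist_eq_norm, dist_eq_norm, sub_sub_sub_cancel_left, ← norm_neg, neg_sub]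
    refine ((norm_fst_le (w.toFun a - w.toFun b)).trans (w.norm_toFun_sub_le a b)).trans ?_
    exact mul_le_mul_of_nonneg_right (by simpa using hw) (norm_nonneg _)
  refine ⟨hc.fixedPoint, ?_⟩
  have := hc.fixedPoint_isFixedPt
  rw [flow]
  nth_rewrite 1 [← this]
  simp

theorem flow_invFlow [CompleteSpace V] (hw : ‖w‖ ≤ 1 / 2) (x : V) : flow w (invFlow w x) = x :=
  Function.rightInverse_invFun (surjective_flow hw) x

theorem invFlow_flow (hw : ‖w‖ ≤ 1 / 2) (a : V) : invFlow w (flow w a) = a :=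
  Function.leftInverse_invFun (injective_flow hw) a

theorem norm_invFlow_sub_le [CompleteSpace V] (hw : ‖w‖ ≤ 1 / 2) (hw' : ‖w'‖ ≤ 1 / 2) (x x' : V) :
    ‖invFlow w x - invFlow w' x'‖ ≤ 2 * (‖x - x'‖ + ‖w - w'‖) := by
  refine (norm_sub_le_flow hw _ _).trans (mul_le_mul_of_nonneg_left ?_ (by norm_num))
  rw [flow_invFlow hw]
  nth_rewrite 1 [← flow_invFlow hw' x']
  have h1 : x - flow w (invFlow w' x') = (x - x') - (flow w (invFlow w' x') -
    flow w' (invFlow w' x')) := by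
    rw [flow_invFlow hw' x']
    abel
  have h2 := norm_flow_sub_flow_le w w' (invFlow w' x')
  have h3 := norm_sub_le (x - x') (flow w (invFlow w' x') - flow w' (invFlow w' x'))
  rw [← h1] at h3
  rw [flow_invFlow hw']
  linarith

end flow


/-! ### The Lagrangian evolution equation -/

/-- An integral curve of an autonomous Lipschitz field, with a uniform lower bound for its
existence time. -/
theorem exists_integral_curve {E : Type*} [NormedAddCommGroup E] [NormedSpace ℝ E]
    [CompleteSpace E] {F : E → E} {r τ L : ℝ} {K : ℝ≥0} (hτ : 0 < τ) (hr : 0 ≤ r)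
    (hK : LipschitzOnWith K F (Metric.closedBall 0 r))
    (hL : ∀ x ∈ Metric.closedBall (0 : E) r, ‖F x‖ ≤ L) (hLτ : L * τ ≤ r) :
    ∃ w : ℝ → E, Continuous w ∧ w 0 = 0 ∧ (∀ t, ‖w t‖ ≤ r) ∧
      ∀ t ∈ Ioo (-τ) τ, HasDerivAt w (F (w t)) t := by
  have hL0 : 0 ≤ L := (norm_nonneg _).trans (hL 0 (Metric.mem_closedBall_self hr))
  lift L to ℝ≥0 using hL0
  lift r to ℝ≥0 using hr
  have h0 : (0 : ℝ) ∈ Icc (-τ) τ := ⟨by linarith, hτ.le⟩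
  have hf : IsPicardLindelof (fun _ => F) (⟨0, h0⟩ : Icc (-τ) τ) 0 r 0 L K := by
    refine ⟨fun _ _ => hK, fun _ _ => continuousOn_const, fun _ _ => hL, ?_⟩
    simp only [sub_zero, zero_sub, neg_neg, max_self, NNReal.coe_zero]
    exact hLτ
  have hx : (0 : E) ∈ Metric.closedBall (0 : E) ((0 : ℝ≥0) : ℝ) :=
    Metric.mem_closedBall_self le_rfl
  obtain ⟨w, hw⟩ := ODE.FunSpace.exists_isFixedPt_next hf hx
  have hmem : ∀ t, w.compProj t ∈ Metric.closedBall (0 : E) r :=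
    fun t => w.compProj_mem_closedBall hf.mul_max_le
  -- The curve is extended by its end values, so it is continuous and stays in the ball for all
  -- times.
  refine ⟨w.compProj, w.continuous_compProj, ?_, fun t => by simpa using hmem t, fun t ht => ?_⟩
  · have := ODE.FunSpace.compProj_of_mem (α := w) h0
    rw [this, ← hw, ODE.FunSpace.next_apply₀]
  · have h1 := ODE.hasDerivWithinAt_picard_Icc (f := fun _ => F) (α := w.compProj) h0
      hf.continuousOn_uncurry w.continuous_compProj.continuousOn (fun t _ => hmem t) 0
      (Ioo_subset_Icc_self ht)
    refine (h1.congr_of_mem (fun t' ht' => ?_) (Ioo_subset_Icc_self ht)).hasDerivAt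
      (Icc_mem_nhds ht.1 ht.2)
    nth_rw 1 [← hw]
    rw [ODE.FunSpace.compProj_of_mem ht', ODE.FunSpace.next_apply]

/-- The state space: displacements together with the vorticity production per unit density. -/
abbrev LagrangianSpace : Type := C1b (ℝ × ℝ) ((ℝ × ℝ) × ℝ)

/-- The vorticity that results from the initial vorticity `h₀` and the initial density `h₁`. -/
noncomputable def vort (h₀ h₁ : ℝ × ℝ → ℝ) (w : LagrangianSpace) (x : ℝ × ℝ) : ℝ :=
  h₀ (invFlow w x) + h₁ (invFlow w x) * (w.toFun (invFlow w x)).2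

section vort

variable {h₀ h₁ k : ℝ × ℝ → ℝ} {M Λ κ : ℝ} {w w' : LagrangianSpace}

theorem abs_vort_le (h₀M : ∀ x, |h₀ x| ≤ M) (h₁M : ∀ x, |h₁ x| ≤ M) (hw : ‖w‖ ≤ 1 / 2)
    (x : ℝ × ℝ) : |vort h₀ h₁ w x| ≤ 2 * M := by
  have hM : 0 ≤ M := (abs_nonneg _).trans (h₀M 0)
  have h1 : |(w.toFun (invFlow w x)).2| ≤ 1 :=
    (norm_snd_le (w.toFun (invFlow w x))).trans ((w.norm_toFun_le _).trans (hw.trans (by norm_num)))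
  have h2 := abs_add_le (h₀ (invFlow w x)) (h₁ (invFlow w x) * (w.toFun (invFlow w x)).2)
  rw [abs_mul] at h2
  have h3 := mul_le_mul (h₁M (invFlow w x)) h1 (abs_nonneg _) hM
  rw [vort]
  linarith [h₀M (invFlow w x)]

/-- Composition with the inverse flow is Lipschitz in `w` for the sup norm as soon as the data are
Lipschitz; a corresponding estimate in `C¹` would require more. The operator `Qt` supplies the
missing derivative. -/
theorem abs_vort_sub_le (h₁M : ∀ x, |h₁ x| ≤ M) (h₀Λ : ∀ x y, |h₀ x - h₀ y| ≤ Λ * ‖x - y‖)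
    (h₁Λ : ∀ x y, |h₁ x - h₁ y| ≤ Λ * ‖x - y‖) (hΛ : 0 ≤ Λ) (hw : ‖w‖ ≤ 1 / 2)
    (hw' : ‖w'‖ ≤ 1 / 2) (x x' : ℝ × ℝ) :
    |vort h₀ h₁ w x - vort h₀ h₁ w' x'| ≤ (3 * Λ + 2 * M) * (‖x - x'‖ + ‖w - w'‖) := by
  have hM : 0 ≤ M := (abs_nonneg _).trans (h₁M 0)
  set S := ‖x - x'‖ + ‖w - w'‖ with hS
  set y := invFlow w x with hy
  set y' := invFlow w' x' with hy'
  have hyy : ‖y - y'‖ ≤ 2 * S := norm_invFlow_sub_le hw hw' x x'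
  have hS0 : 0 ≤ S := by positivity
  have e0 : |h₀ y - h₀ y'| ≤ Λ * (2 * S) :=
    (h₀Λ y y').trans (mul_le_mul_of_nonneg_left hyy hΛ)
  have e1 : |h₁ y - h₁ y'| ≤ Λ * (2 * S) :=
    (h₁Λ y y').trans (mul_le_mul_of_nonneg_left hyy hΛ)
  have e2 : |(w.toFun y).2 - (w'.toFun y').2| ≤ 2 * S := by
    have a1 : ‖w.toFun y - w.toFun y'‖ ≤ S :=
      (w.norm_toFun_sub_le y y').trans (by nlinarith [norm_nonneg w, norm_nonneg (y - y')])
    have a2 : ‖w.toFun y' - w'.toFun y'‖ ≤ S :=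
      ((w - w').norm_toFun_le y').trans (by rw [hS]; linarith [norm_nonneg (x - x')])
    have a3 := norm_snd_le (w.toFun y - w'.toFun y')
    have a4 := norm_sub_le_norm_sub_add_norm_sub (w.toFun y) (w.toFun y') (w'.toFun y')
    rw [Prod.snd_sub, Real.norm_eq_abs] at a3
    linarith
  have e3 : |(w'.toFun y').2| ≤ 1 / 2 :=
    (norm_snd_le (w'.toFun y')).trans ((w'.norm_toFun_le _).trans hw')
  have heq : vort h₀ h₁ w x - vort h₀ h₁ w' x' = (h₀ y - h₀ y') +
      h₁ y * ((w.toFun y).2 - (w'.toFun y').2) + (h₁ y - h₁ y') * (w'.toFun y').2 := by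
    simp only [vort, ← hy, ← hy']
    ring
  have b1 := mul_le_mul (h₁M y) e2 (abs_nonneg _) hM
  have b2 := mul_le_mul e1 e3 (abs_nonneg _) (by positivity)
  rw [← abs_mul] at b1 b2
  rw [heq]
  refine (abs_add_three _ _ _).trans ?_
  linarith

theorem abs_mul_vort_le (h₀M : ∀ x, |h₀ x| ≤ M) (h₁M : ∀ x, |h₁ x| ≤ M) (hk : ∀ x, |k x| ≤ κ)
    (hw : ‖w‖ ≤ 1 / 2) (x : ℝ × ℝ) : |k x * vort h₀ h₁ w x| ≤ 2 * κ * M := by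
  rw [abs_mul]
  have := mul_le_mul (hk x) (abs_vort_le h₀M h₁M hw x) (abs_nonneg _)
    ((abs_nonneg _).trans (hk x))
  linarith

theorem abs_mul_vort_sub_le (h₀M : ∀ x, |h₀ x| ≤ M) (h₁M : ∀ x, |h₁ x| ≤ M)
    (h₀Λ : ∀ x y, |h₀ x - h₀ y| ≤ Λ * ‖x - y‖)
    (h₁Λ : ∀ x y, |h₁ x - h₁ y| ≤ Λ * ‖x - y‖) (hΛ : 0 ≤ Λ) (hk : ∀ x, |k x| ≤ κ)
    (hkΛ : ∀ x y, |k x - k y| ≤ κ * ‖x - y‖) (hw : ‖w‖ ≤ 1 / 2)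
    (hw' : ‖w'‖ ≤ 1 / 2) (x x' : ℝ × ℝ) :
    |k x * vort h₀ h₁ w x - k x' * vort h₀ h₁ w' x'| ≤
      κ * (3 * Λ + 4 * M) * (‖x - x'‖ + ‖w - w'‖) := by
  have hM : 0 ≤ M := (abs_nonneg _).trans (h₁M 0)
  have hκ : 0 ≤ κ := (abs_nonneg _).trans (hk 0)
  have heq : k x * vort h₀ h₁ w x - k x' * vort h₀ h₁ w' x' =
    k x * (vort h₀ h₁ w x - vort h₀ h₁ w' x') + (k x - k x') * vort h₀ h₁ w' x' := by ring
  have b1 := mul_le_mul (hk x) (abs_vort_sub_le h₁M h₀Λ h₁Λ hΛ hw hw' x x') (abs_nonneg _) hκ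
  have b2 := mul_le_mul (hkΛ x x') (abs_vort_le h₀M h₁M hw' x') (abs_nonneg _) (by positivity)
  rw [← abs_mul] at b1 b2
  rw [heq]
  refine (abs_add_le _ _).trans ?_
  have h3 : 0 ≤ κ * M * ‖w - w'‖ := by positivity
  nlinarith

end vort

/-- The Lagrangian form of the model, solved on a time interval whose length depends only on bounds
for the data, not on their moduli of continuity. -/
theorem exists_lagrangian_solution {α ℓ β κ M Λ r τ : ℝ} (hα : 0 < α) (hℓ : 0 ≤ ℓ)
    {e e₀ : ℝ × ℝ → (ℝ × ℝ) × ℝ} {e' e₀' : ℝ × ℝ → ℝ × ℝ →L[ℝ] (ℝ × ℝ) × ℝ}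
    (he : C11With β e e') (he₀ : C11With β e₀ e₀') {h₀ h₁ k : ℝ × ℝ → ℝ}
    (h₀M : ∀ x, |h₀ x| ≤ M) (h₁M : ∀ x, |h₁ x| ≤ M)
    (h₀Λ : ∀ x y, |h₀ x - h₀ y| ≤ Λ * ‖x - y‖)
    (h₁Λ : ∀ x y, |h₁ x - h₁ y| ≤ Λ * ‖x - y‖) (hΛ : 0 ≤ Λ) (hk : ∀ x, |k x| ≤ κ)
    (hkΛ : ∀ x y, |k x - k y| ≤ κ * ‖x - y‖) (hr : 0 ≤ r) (hr' : r ≤ 1 / 2) (hτ : 0 < τ)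
    (hτr : 2 * (β * (2 * (cQ α ℓ * (2 * κ * M)) + 1)) * τ ≤ r) :
    ∃ w w' : ℝ → LagrangianSpace, Continuous w ∧ Continuous w' ∧ w 0 = 0 ∧ (∀ t, ‖w t‖ ≤ r) ∧
      (∀ t ∈ Ioo (-τ) τ, HasDerivAt w (w' t) t) ∧
      (∀ t, Continuous fun y => k y * vort h₀ h₁ (w t) y) ∧
      ∀ t a, (w' t).toFun a =
        Qt α ℓ (fun y => k y * vort h₀ h₁ (w t) y) (flow (w t) a) • e (flow (w t) a) +
          e₀ (flow (w t) a) := by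
  have hM : 0 ≤ M := (abs_nonneg _).trans (h₁M 0)
  have hκ : 0 ≤ κ := (abs_nonneg _).trans (hk 0)
  have hβ : 0 ≤ β := (norm_nonneg _).trans (he.norm_le 0)
  have hcQ := cQ_nonneg hα hℓ
  set G : LagrangianSpace → ℝ × ℝ → ℝ := fun w y => k y * vort h₀ h₁ w y with hGdef
  set C := 2 * κ * M with hC
  set N := κ * (3 * Λ + 4 * M) with hN
  have hN0 : 0 ≤ N := by positivity
  have hC0 : 0 ≤ C := by positivity
  have hGC : ∀ w, ‖w‖ ≤ 1 / 2 → ∀ x, |G w x| ≤ C :=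
    fun w hw x => abs_mul_vort_le h₀M h₁M hk hw x
  have hGN : ∀ w w', ‖w‖ ≤ 1 / 2 → ‖w'‖ ≤ 1 / 2 → ∀ x x',
      |G w x - G w' x'| ≤ N * (‖x - x'‖ + ‖w - w'‖) := fun w w' hw hw' x x' =>
    abs_mul_vort_sub_le h₀M h₁M h₀Λ h₁Λ hΛ hk hkΛ hw hw' x x'
  have hGlip : ∀ w, ‖w‖ ≤ 1 / 2 → ∀ x x', |G w x - G w x'| ≤ N * ‖x - x'‖ := fun w hw x x' => by
    simpa using hGN w w hw hw x x'
  have hGcont : ∀ w, ‖w‖ ≤ 1 / 2 → Continuous (G w) := fun w hw =>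
    (LipschitzWith.of_dist_le_mul (K := ⟨N, hN0⟩) fun x y => by
      rw [dist_eq_norm, dist_eq_norm]
      exact hGlip w hw x y).continuous
  -- The velocity is `Q` times the direction field, and `e₀` supplies the production. The evolution
  -- equation is `w' = B w ∘ flow w`, so Lipschitz dependence in `C¹` requires `B w` to have a
  -- Lipschitz derivative.
  set B : LagrangianSpace → ℝ × ℝ → (ℝ × ℝ) × ℝ := fun w x => Qt α ℓ (G w) x • e x + e₀ x with hB
  set B' : LagrangianSpace → ℝ × ℝ → ℝ × ℝ →L[ℝ] (ℝ × ℝ) × ℝ :=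
    fun w => smulAddDer (Qt α ℓ (G w)) (dQt α ℓ (G w)) e e' e₀' with hB'
  set A := β * (2 * (cQ α ℓ * C) + 1) with hA
  have hA0 : 0 ≤ A := by positivity
  have hBder : ∀ w, ‖w‖ ≤ 1 / 2 → ∀ x, HasFDerivAt (B w) (B' w x) x := fun w hw =>
    hasFDerivAt_smul_add he he₀ (hasFDerivAt_Qt hα (hGcont w hw))
  have hBA : ∀ w, ‖w‖ ≤ 1 / 2 → ∀ x, ‖B w x‖ ≤ A := fun w hw =>
    norm_smul_add_le he he₀ (abs_Qt_le hα hℓ (hGC w hw))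
  have hB'A : ∀ w, ‖w‖ ≤ 1 / 2 → ∀ x, ‖B' w x‖ ≤ A := fun w hw =>
    norm_smulAddDer_le he he₀ (abs_Qt_le hα hℓ (hGC w hw)) (norm_dQt_le hα hℓ (hGC w hw))
  set D := β * (4 * (cQ α ℓ * (C + N)) + 1) with hD
  have hD0 : 0 ≤ D := by positivity
  have hB'D : ∀ w, ‖w‖ ≤ 1 / 2 → ∀ x y, ‖B' w x - B' w y‖ ≤ D * ‖x - y‖ := fun w hw =>
    norm_smulAddDer_sub_le he he₀ (c11With_Qt hα hℓ hN0 (hGcont w hw) (hGC w hw) (hGlip w hw))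
  set D' := β * (2 * (cQ α ℓ * N)) with hD'
  have hD'0 : 0 ≤ D' := by positivity
  have hGG : ∀ w w', ‖w‖ ≤ 1 / 2 → ‖w'‖ ≤ 1 / 2 → ∀ x, |G w x - G w' x| ≤ N * ‖w - w'‖ :=
    fun w w' hw hw' x => by simpa using hGN w w' hw hw' x x
  have hBB : ∀ w w', ‖w‖ ≤ 1 / 2 → ‖w'‖ ≤ 1 / 2 → ∀ x, ‖B w x - B w' x‖ ≤ D' * ‖w - w'‖ :=
    fun w w' hw hw' x => by
      refine (norm_smul_sub_smul_le he (γ := cQ α ℓ * (N * ‖w - w'‖)) (fun x => ?_) x).trans_eq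
        (by rw [hD']; ring)
      rw [← Qt_sub (hGcont w hw) (hGcont w' hw')]
      exact abs_Qt_le hα hℓ (hGG w w' hw hw') x
  have hB'B' : ∀ w w', ‖w‖ ≤ 1 / 2 → ‖w'‖ ≤ 1 / 2 → ∀ x, ‖B' w x - B' w' x‖ ≤ D' * ‖w - w'‖ :=
    fun w w' hw hw' x => by
      refine (norm_smulAddDer_sub_smulAddDer_le he (γ := cQ α ℓ * (N * ‖w - w'‖)) (fun x => ?_)
        (fun x => ?_) x).trans_eq (by rw [hD']; ring)
      · rw [← Qt_sub (hGcont w hw) (hGcont w' hw')]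
        exact abs_Qt_le hα hℓ (hGG w w' hw hw') x
      · rw [← dQt_sub (hGcont w hw) (hGcont w' hw')]
        exact norm_dQt_le hα hℓ (hGG w w' hw hw') x
  have hB'cont : ∀ w, ‖w‖ ≤ 1 / 2 → Continuous (B' w) := fun w hw =>
    (LipschitzWith.of_dist_le_mul (K := ⟨D, hD0⟩) fun x y => by
      rw [dist_eq_norm, dist_eq_norm]
      exact hB'D w hw x y).continuous
  -- Outside the ball of radius `1 / 2`, where the flow map need not be invertible, the value `0` is
  -- chosen; the curve never gets there.
  have hF : ∀ w : LagrangianSpace, ∃ f : LagrangianSpace, ‖w‖ ≤ 1 / 2 →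
      (∀ a, f.toFun a = B w (flow w a)) ∧ ∀ a, f.der a = (B' w (flow w a)).comp (flowDer w a) := by
    intro w
    by_cases hw : ‖w‖ ≤ 1 / 2
    · refine ⟨C1b.mk (fun a => B w (flow w a)) (fun a => (B' w (flow w a)).comp (flowDer w a))
        (2 * A) (fun a => (hBder w hw _).comp a (hasFDerivAt_flow w a)) ?_ (fun a => ?_)
        (fun a => ?_), fun _ => ⟨fun a => rfl, fun a => rfl⟩⟩
      · exact ((hB'cont w hw).comp (continuous_flow w)).clm_comp (continuous_flowDer w)
      · linarith [hBA w hw (flow w a)]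
      · refine (ContinuousLinearMap.opNorm_comp_le _ _).trans ?_
        rw [mul_comm]
        exact mul_le_mul (norm_flowDer_le hw a) (hB'A w hw _) (norm_nonneg _) (by norm_num)
    · exact ⟨0, fun h => absurd h hw⟩
  choose F hF using hF
  have hball : ∀ w ∈ Metric.closedBall (0 : LagrangianSpace) r, ‖w‖ ≤ 1 / 2 := fun w hw =>
    (mem_closedBall_zero_iff.1 hw).trans hr'
  -- The Lipschitz constant `Λ` of the data does not occur in `2 * A`. This bound alone fixes the
  -- existence time; `Λ` enters only the Lipschitz constant of `F`.
  have hFle : ∀ w ∈ Metric.closedBall (0 : LagrangianSpace) r, ‖F w‖ ≤ 2 * A := by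
    intro w hw
    have hw := hball w hw
    refine C1b.norm_le (by positivity) (fun a => ?_) fun a => ?_
    · rw [(hF w hw).1]
      linarith [hBA w hw (flow w a)]
    · rw [(hF w hw).2]
      refine (ContinuousLinearMap.opNorm_comp_le _ _).trans ?_
      rw [mul_comm]
      exact mul_le_mul (norm_flowDer_le hw a) (hB'A w hw _) (norm_nonneg _) (by norm_num)
  have hFlip : LipschitzOnWith (⟨2 * D + 2 * D' + A, by positivity⟩ : ℝ≥0) F
      (Metric.closedBall (0 : LagrangianSpace) r) := by
    refine LipschitzOnWith.of_dist_le_mul fun w hw w' hw' => ?_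
    have hw := hball w hw
    have hw' := hball w' hw'
    rw [dist_eq_norm, dist_eq_norm]
    change ‖F w - F w'‖ ≤ (2 * D + 2 * D' + A) * ‖w - w'‖
    refine C1b.norm_le (by positivity) (fun a => ?_) fun a => ?_
    · rw [C1b.sub_toFun, (hF w hw).1, (hF w' hw').1]
      have a1 := norm_sub_le_norm_sub_add_norm_sub (B w (flow w a)) (B w (flow w' a))
        (B w' (flow w' a))
      have a2 := hBB w w' hw hw' (flow w' a)
      have a3 := norm_sub_le_of_norm_hasFDerivAt_le (hBder w hw) (hB'A w hw) (flow w a) (flow w' a)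
      have a4 := mul_le_mul_of_nonneg_left (norm_flow_sub_flow_le w w' a) hA0
      have a5 : 0 ≤ (2 * D + D') * ‖w - w'‖ := by positivity
      linarith
    · rw [C1b.sub_der, (hF w hw).2, (hF w' hw').2]
      have heq : (B' w (flow w a)).comp (flowDer w a) - (B' w' (flow w' a)).comp (flowDer w' a) =
          (B' w (flow w a) - B' w (flow w' a)).comp (flowDer w a) +
          (B' w (flow w' a) - B' w' (flow w' a)).comp (flowDer w a) +
          (B' w' (flow w' a)).comp (flowDer w a - flowDer w' a) := by
        simp only [ContinuousLinearMap.comp_sub, ContinuousLinearMap.sub_comp]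
        abel
      have a1 : ‖(B' w (flow w a) - B' w (flow w' a)).comp (flowDer w a)‖ ≤
          D * ‖w - w'‖ * 2 :=
        (ContinuousLinearMap.opNorm_comp_le _ _).trans (mul_le_mul
          ((hB'D w hw _ _).trans (mul_le_mul_of_nonneg_left (norm_flow_sub_flow_le w w' a) hD0))
          (norm_flowDer_le hw a) (norm_nonneg _) (by positivity))
      have a2 : ‖(B' w (flow w' a) - B' w' (flow w' a)).comp (flowDer w a)‖ ≤
          D' * ‖w - w'‖ * 2 :=
        (ContinuousLinearMap.opNorm_comp_le _ _).trans (mul_le_mul (hB'B' w w' hw hw' _)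
          (norm_flowDer_le hw a) (norm_nonneg _) (by positivity))
      have a3 : ‖(B' w' (flow w' a)).comp (flowDer w a - flowDer w' a)‖ ≤ A * ‖w - w'‖ :=
        (ContinuousLinearMap.opNorm_comp_le _ _).trans (mul_le_mul (hB'A w' hw' _)
          (norm_flowDer_sub_le w w' a) (norm_nonneg _) hA0)
      rw [heq]
      refine norm_add₃_le.trans ?_
      linarith
  obtain ⟨w, hwc, hw0, hwr, hwd⟩ := exists_integral_curve hτ hr hFlip hFle hτr
  have hmem : ∀ t, w t ∈ Metric.closedBall (0 : LagrangianSpace) r := fun t =>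
    mem_closedBall_zero_iff.2 (hwr t)
  exact ⟨w, fun t => F (w t), hwc, hFlip.continuousOn.comp_continuous hwc hmem, hw0, hwr, hwd,
    fun t => hGcont _ (hball _ (hmem t)), fun t a => (hF (w t) (hball _ (hmem t))).1 a⟩


/-! ### Regularity of the Eulerian fields -/

section regularity

variable {a b : ℝ} {w w' : ℝ → LagrangianSpace}

theorem contDiffAt_curve (hw' : Continuous w') (hd : ∀ t ∈ Ioo a b, HasDerivAt w (w' t) t) {t : ℝ}
    (ht : t ∈ Ioo a b) : ContDiffAt ℝ 1 w t := by
  rw [contDiffAt_one_iff]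
  refine ⟨fun t => ContinuousLinearMap.toSpanSingleton ℝ (w' t), Ioo a b, isOpen_Ioo.mem_nhds ht,
    ?_, fun s hs => (hd s hs).hasFDerivAt⟩
  exact (((ContinuousLinearMap.toSpanSingletonCLE (𝕜 := ℝ)
    (E := LagrangianSpace)).continuous).comp hw').continuousOn

theorem contDiffAt_eval_curve (hw' : Continuous w')
    (hd : ∀ t ∈ Ioo a b, HasDerivAt w (w' t) t) {z : ℝ × (ℝ × ℝ)} (hz : z.1 ∈ Ioo a b) :
    ContDiffAt ℝ 1 (fun z : ℝ × (ℝ × ℝ) => (w z.1).toFun z.2) z :=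
  (C1b.contDiff_eval (V := ℝ × ℝ) (W := (ℝ × ℝ) × ℝ)).contDiffAt.comp
    (f := fun z : ℝ × (ℝ × ℝ) => (w z.1, z.2)) z
    (((contDiffAt_curve hw' hd hz).comp z contDiffAt_fst).prodMk contDiffAt_snd)

theorem hasFDerivAt_eval_curve (hd : ∀ t ∈ Ioo a b, HasDerivAt w (w' t) t) {z : ℝ × (ℝ × ℝ)}
    (hz : z.1 ∈ Ioo a b) :
    HasFDerivAt (fun z : ℝ × (ℝ × ℝ) => (w z.1).toFun z.2)
      ((ContinuousLinearMap.toSpanSingleton ℝ ((w' z.1).toFun z.2)).coprod ((w z.1).der z.2)) z := by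
  have h1 : HasFDerivAt (fun z : ℝ × (ℝ × ℝ) => (w z.1, z.2)) _ z :=
    ((hd z.1 hz).hasFDerivAt.comp z hasFDerivAt_fst).prodMk hasFDerivAt_snd
  refine ((C1b.hasFDerivAt_eval (w z.1, z.2)).comp z h1).congr_fderiv ?_
  ext <;> simp

theorem continuous_eval_curve (hw : Continuous w) :
    Continuous fun z : ℝ × (ℝ × ℝ) => (w z.1).toFun z.2 :=
  C1b.contDiff_eval.continuous.comp (f := fun z : ℝ × (ℝ × ℝ) => (w z.1, z.2)) (by fun_prop)

/-- The space-time flow `(t, a) ↦ (t, flow (w t) a)`. -/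
noncomputable def spaceTimeFlow (w : ℝ → LagrangianSpace) (hw : Continuous w)
    (hr : ∀ t, ‖w t‖ ≤ 1 / 2) : (ℝ × (ℝ × ℝ)) ≃ₜ (ℝ × (ℝ × ℝ)) where
  toFun z := (z.1, flow (w z.1) z.2)
  invFun z := (z.1, invFlow (w z.1) z.2)
  left_inv z := by simp only [invFlow_flow (hr z.1)]
  right_inv z := by simp only [flow_invFlow (hr z.1)]
  continuous_toFun := continuous_fst.prodMk
    (continuous_snd.add (continuous_fst.comp (continuous_eval_curve hw)))
  continuous_invFun := by
    refine continuous_fst.prodMk (continuous_iff_continuousAt.2 fun z => ?_)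
    rw [ContinuousAt, tendsto_iff_norm_sub_tendsto_zero]
    have hlim : Tendsto (fun y : ℝ × (ℝ × ℝ) => 2 * (‖y.2 - z.2‖ + ‖w y.1 - w z.1‖)) (𝓝 z)
        (𝓝 (2 * (‖z.2 - z.2‖ + ‖w z.1 - w z.1‖))) := Continuous.tendsto (by fun_prop) z
    rw [sub_self, sub_self, norm_zero, norm_zero, add_zero, mul_zero] at hlim
    exact squeeze_zero (fun y => norm_nonneg _)
      (fun y => norm_invFlow_sub_le (hr y.1) (hr z.1) y.2 z.2) hlim

/-- The inverse function theorem for `(t, a) ↦ (t, flow (w t) a)`: its derivative is block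
triangular with diagonal block `id + Dξ`, injective because `‖Dξ‖ ≤ 1 / 2`. Working in space-time
gives regularity in both variables at once. -/
theorem contDiffAt_invFlow (hw : Continuous w) (hw' : Continuous w') (hr : ∀ t, ‖w t‖ ≤ 1 / 2)
    (hd : ∀ t ∈ Ioo a b, HasDerivAt w (w' t) t) {z : ℝ × (ℝ × ℝ)} (hz : z.1 ∈ Ioo a b) :
    ContDiffAt ℝ 1 (fun z : ℝ × (ℝ × ℝ) => invFlow (w z.1) z.2) z := by
  set Θ := spaceTimeFlow w hw hr with hΘ
  set y := Θ.symm z with hy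
  have hy1 : y.1 ∈ Ioo a b := hz
  have hsmooth : ContDiffAt ℝ 1 Θ y :=
    contDiffAt_fst.prodMk (contDiffAt_snd.add ((contDiffAt_eval_curve hw' hd hy1).fst))
  set L : ℝ × (ℝ × ℝ) →L[ℝ] ℝ × (ℝ × ℝ) := (ContinuousLinearMap.fst ℝ ℝ (ℝ × ℝ)).prod
    (ContinuousLinearMap.snd ℝ ℝ (ℝ × ℝ) + (ContinuousLinearMap.fst ℝ (ℝ × ℝ) ℝ).comp
      ((ContinuousLinearMap.toSpanSingleton ℝ ((w' y.1).toFun y.2)).coprod ((w y.1).der y.2)))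
    with hL
  have hder : HasFDerivAt Θ L y :=
    hasFDerivAt_fst.prodMk (hasFDerivAt_snd.add (hasFDerivAt_eval_curve hd hy1).fst)
  have hinj : Function.Injective (L : ℝ × (ℝ × ℝ) →ₗ[ℝ] ℝ × (ℝ × ℝ)) := by
    rw [injective_iff_map_eq_zero]
    rintro ⟨s, v⟩ h0
    have h1 : s = 0 := congrArg Prod.fst h0
    subst h1
    have h2 : v + ((w y.1).der y.2 v).1 = 0 := by simpa [hL] using congrArg Prod.snd h0
    have h3 : ‖((w y.1).der y.2 v).1‖ ≤ 1 / 2 * ‖v‖ :=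
      (norm_fst_le _).trans (((w y.1).der y.2).le_of_opNorm_le
        (((w y.1).norm_der_le _).trans (hr _)) v)
    rw [← norm_neg, ← eq_neg_of_add_eq_zero_left h2] at h3
    have h4 : v = 0 := norm_le_zero_iff.1 (by linarith [norm_nonneg v])
    rw [h4]
    rfl
  have hf : HasFDerivAt Θ.toOpenPartialHomeomorph
      (((LinearEquiv.ofInjectiveEndo _ hinj).toContinuousLinearEquiv :
        (ℝ × (ℝ × ℝ)) ≃L[ℝ] (ℝ × (ℝ × ℝ))) : (ℝ × (ℝ × ℝ)) →L[ℝ] (ℝ × (ℝ × ℝ)))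
      (Θ.toOpenPartialHomeomorph.symm z) := by
    refine HasFDerivAt.congr_fderiv hder ?_
    ext <;> rfl
  have h5 := Θ.toOpenPartialHomeomorph.contDiffAt_symm (n := 1) (mem_univ z) hf hsmooth
  exact h5.snd

theorem contDiffAt_vort {g₀ g₁ : ℝ × ℝ → ℝ} (hg₀ : ContDiff ℝ 1 g₀) (hg₁ : ContDiff ℝ 1 g₁)
    (hw : Continuous w) (hw' : Continuous w') (hr : ∀ t, ‖w t‖ ≤ 1 / 2)
    (hd : ∀ t ∈ Ioo a b, HasDerivAt w (w' t) t) {z : ℝ × (ℝ × ℝ)} (hz : z.1 ∈ Ioo a b) :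
    ContDiffAt ℝ 1 (fun z : ℝ × (ℝ × ℝ) => vort g₀ g₁ (w z.1) z.2) z := by
  have hY := contDiffAt_invFlow hw hw' hr hd hz
  have hp : ContDiffAt ℝ 1 (fun z : ℝ × (ℝ × ℝ) => (w z.1).toFun (invFlow (w z.1) z.2)) z :=
    ContDiffAt.comp (g := fun z : ℝ × (ℝ × ℝ) => (w z.1).toFun z.2)
      (f := fun z : ℝ × (ℝ × ℝ) => (z.1, invFlow (w z.1) z.2)) z
      (contDiffAt_eval_curve hw' hd hz) (contDiffAt_fst.prodMk hY)
  exact (hg₀.contDiffAt.comp z hY).add ((hg₁.contDiffAt.comp z hY).mul hp.snd)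

/-- Along the flow, the vorticity changes by the accumulated production. -/
theorem hasDerivAt_vort {g₀ g₁ : ℝ × ℝ → ℝ} (hg₀ : ContDiff ℝ 1 g₀) (hg₁ : ContDiff ℝ 1 g₁)
    (hw : Continuous w) (hw' : Continuous w') (hr : ∀ t, ‖w t‖ ≤ 1 / 2)
    (hd : ∀ t ∈ Ioo a b, HasDerivAt w (w' t) t) {t : ℝ} (ht : t ∈ Ioo a b) (x : ℝ × ℝ) :
    HasDerivAt (fun s => vort g₀ g₁ (w s) x)
      (g₁ (invFlow (w t) x) * ((w' t).toFun (invFlow (w t) x)).2 -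
        fderiv ℝ (vort g₀ g₁ (w t)) x ((w' t).toFun (invFlow (w t) x)).1) t := by
  set Φ : ℝ × (ℝ × ℝ) → ℝ := fun z => vort g₀ g₁ (w z.1) z.2 with hΦ
  set y := invFlow (w t) x with hy
  have hflow : flow (w t) y = x := flow_invFlow (hr t) x
  have hΦd : HasFDerivAt Φ (fderiv ℝ Φ (t, x)) (t, x) :=
    ((contDiffAt_vort hg₀ hg₁ hw hw' hr hd (z := (t, x)) ht).differentiableAt
      (by norm_num)).hasFDerivAt
  have hcurve : HasDerivAt (fun s => (w s).toFun y) ((w' t).toFun y) t :=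
    (C1b.evalL y).hasFDerivAt.comp_hasDerivAt t (hd t ht)
  have hfst : HasDerivAt (fun s => ((w s).toFun y).1) ((w' t).toFun y).1 t :=
    (ContinuousLinearMap.fst ℝ (ℝ × ℝ) ℝ).hasFDerivAt.comp_hasDerivAt t hcurve
  have hsnd : HasDerivAt (fun s => ((w s).toFun y).2) ((w' t).toFun y).2 t :=
    (ContinuousLinearMap.snd ℝ (ℝ × ℝ) ℝ).hasFDerivAt.comp_hasDerivAt t hcurve
  have h1 : HasDerivAt (fun s => (s, flow (w s) y)) ((1 : ℝ), ((w' t).toFun y).1) t :=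
    (hasDerivAt_id t).prodMk (hfst.const_add y)
  have h2 : HasDerivAt (fun s => Φ (s, flow (w s) y))
      (fderiv ℝ Φ (t, x) ((1 : ℝ), ((w' t).toFun y).1)) t := by
    have h0 : HasFDerivAt Φ (fderiv ℝ Φ (t, x)) (t, flow (w t) y) := by rwa [hflow]
    exact (h0.comp_hasDerivAt t h1 :)
  -- Along the trajectory from `y` the inverse flow is constantly `y`, so only the accumulated
  -- production varies. Comparison with the chain rule isolates the time derivative at fixed `x`.
  have h3 : HasDerivAt (fun s => Φ (s, flow (w s) y)) (g₁ y * ((w' t).toFun y).2) t := by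
    have : (fun s => Φ (s, flow (w s) y)) = fun s => g₀ y + g₁ y * ((w s).toFun y).2 := by
      funext s
      simp only [hΦ, vort, invFlow_flow (hr s)]
    rw [this]
    exact (hsnd.const_mul _).const_add _
  have h4 : HasDerivAt (fun s => Φ (s, x)) (fderiv ℝ Φ (t, x) ((1 : ℝ), (0 : ℝ × ℝ))) t :=
    (HasFDerivAt.comp_hasDerivAt (f := fun s => (s, x)) t hΦd
      ((hasDerivAt_id t).prodMk (hasDerivAt_const t x)) :)
  have h5 : fderiv ℝ (vort g₀ g₁ (w t)) x =
      (fderiv ℝ Φ (t, x)).comp (ContinuousLinearMap.inr ℝ ℝ (ℝ × ℝ)) :=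
    (HasFDerivAt.comp x (f := fun x : ℝ × ℝ => (t, x)) hΦd (hasFDerivAt_prodMk_right t x)).fderiv
  convert h4 using 1
  rw [← h2.unique h3, h5, ContinuousLinearMap.comp_apply, ContinuousLinearMap.inr_apply, ← map_sub]
  simp

end regularity

/-- A jointly `C¹` family of functions with supports in a fixed compact subset of `{x₁ > 0}` is
continuous into `𝒳`. -/
theorem continuousIntoX_of_contDiffAt {a b : ℝ} {Φ : ℝ → ℝ × ℝ → ℝ} {S : Set (ℝ × ℝ)}
    (hΦ : ∀ z : ℝ × (ℝ × ℝ), z.1 ∈ Ioo a b →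
      ContDiffAt ℝ 1 (fun z : ℝ × (ℝ × ℝ) => Φ z.1 z.2) z)
    (hS : IsCompact S) (hpos : S ⊆ {x | 0 < x.1}) (hsupp : ∀ t ∈ Ioo a b, ∀ x ∉ S, Φ t x = 0) :
    ContinuousIntoX (Ioo a b) Φ := by
  set Ψ : ℝ × (ℝ × ℝ) → ℝ := fun z => Φ z.1 z.2 with hΨ
  have hsec : ∀ t ∈ Ioo a b, ∀ x, ContDiffAt ℝ 1 (Φ t) x := fun t ht x =>
    ContDiffAt.comp (g := Ψ) (f := fun x : ℝ × ℝ => (t, x)) x (hΦ (t, x) ht)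
      (contDiffAt_const.prodMk contDiffAt_id)
  have hder : ∀ t ∈ Ioo a b, ∀ x, fderiv ℝ (Φ t) x =
      (fderiv ℝ Ψ (t, x)).comp (ContinuousLinearMap.inr ℝ ℝ (ℝ × ℝ)) := fun t ht x =>
    (HasFDerivAt.comp x (f := fun x : ℝ × ℝ => (t, x))
      ((hΦ (t, x) ht).differentiableAt (by norm_num)).hasFDerivAt
      (hasFDerivAt_prodMk_right t x)).fderiv
  have hgrad : ∀ t ∈ Ioo a b, ∀ x ∈ quadrant, gradQ (Φ t) x = fderiv ℝ (Φ t) x := fun t ht x hx =>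
    gradQ_eq_fderiv_of_eqOn (fun y => (hsec t ht y).differentiableAt (by norm_num))
      (fun _ _ => rfl) hx
  have hder0 : ∀ t ∈ Ioo a b, ∀ x ∉ S, fderiv ℝ (Φ t) x = 0 := fun t ht x hx => by
    have : Φ t =ᶠ[𝓝 x] fun _ => 0 := by
      filter_upwards [hS.isClosed.isOpen_compl.mem_nhds hx] with y hy using hsupp t ht y hy
    rw [this.fderiv_eq]
    exact fderiv_const_apply 0
  have hcont : ContinuousOn (Function.uncurry Φ) (Ioo a b ×ˢ S) := fun z hz =>
    (hΦ z hz.1).continuousAt.continuousWithinAt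
  have hdcont : ContinuousOn (Function.uncurry fun t x => fderiv ℝ (Φ t) x) (Ioo a b ×ˢ S) := by
    have h1 : ContinuousOn (fun z => (fderiv ℝ Ψ z).comp (ContinuousLinearMap.inr ℝ ℝ (ℝ × ℝ)))
        (Ioo a b ×ˢ S) := fun z hz =>
      (((hΦ z hz.1).fderiv_right (m := 0) (by norm_num)).continuousAt.clm_comp
        continuousAt_const).continuousWithinAt
    exact h1.congr fun z hz => hder z.1 hz.1 z.2
  refine ⟨fun t ht => ⟨Φ t, contDiff_iff_contDiffAt.2 (hsec t ht),
    HasCompactSupport.intro hS (hsupp t ht), ?_, fun _ _ => rfl⟩, fun t ht => ⟨?_, ?_⟩⟩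
  · refine (closure_minimal ?_ hS.isClosed).trans hpos
    intro x hx
    by_contra h
    exact hx (hsupp t ht x h)
  · rw [Metric.tendstoUniformlyOn_iff]
    intro ε hε
    obtain ⟨v, hv, h⟩ := hS.mem_uniformity_of_prod hcont ht (Metric.dist_mem_uniformity hε)
    filter_upwards [hv, self_mem_nhdsWithin] with s hs hsI x _
    by_cases hxS : x ∈ S
    · rw [dist_comm]
      exact h s hs x hxS
    · rw [hsupp t ht x hxS, hsupp s hsI x hxS, dist_self]
      exact hε
  · rw [Metric.tendstoUniformlyOn_iff]
    intro ε hε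
    obtain ⟨v, hv, h⟩ := hS.mem_uniformity_of_prod hdcont ht (Metric.dist_mem_uniformity hε)
    filter_upwards [hv, self_mem_nhdsWithin] with s hs hsI x hx
    rw [hgrad t ht x hx, hgrad s hsI x hx]
    by_cases hxS : x ∈ S
    · rw [dist_comm]
      exact h s hs x hxS
    · rw [hder0 t ht x hxS, hder0 s hsI x hxS, dist_self]
      exact hε


/-! ### Cutoffs and the coefficients of the Lagrangian equation -/

/-- A smooth function that is `1` on `[a, b] × [c, d]` and `0` outside an `ε`-neighbourhood. -/
noncomputable def boxCutoff (ε a b c d : ℝ) (x : ℝ × ℝ) : ℝ :=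
  Real.smoothTransition ((x.1 - a) / ε + 1) * Real.smoothTransition ((b - x.1) / ε + 1) *
    (Real.smoothTransition ((x.2 - c) / ε + 1) * Real.smoothTransition ((d - x.2) / ε + 1))

section cutoff

variable {ε a b c d : ℝ}

theorem contDiff_boxCutoff {n : ℕ∞} : ContDiff ℝ n (boxCutoff ε a b c d) := by
  unfold boxCutoff
  have h : ContDiff ℝ n Real.smoothTransition := Real.smoothTransition.contDiff
  refine ((h.comp ?_).mul (h.comp ?_)).mul ((h.comp ?_).mul (h.comp ?_)) <;> fun_prop

theorem boxCutoff_nonneg (x : ℝ × ℝ) : 0 ≤ boxCutoff ε a b c d x :=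
  mul_nonneg (mul_nonneg (Real.smoothTransition.nonneg _) (Real.smoothTransition.nonneg _))
    (mul_nonneg (Real.smoothTransition.nonneg _) (Real.smoothTransition.nonneg _))

theorem boxCutoff_le_one (x : ℝ × ℝ) : boxCutoff ε a b c d x ≤ 1 :=
  mul_le_one₀ (mul_le_one₀ (Real.smoothTransition.le_one _) (Real.smoothTransition.nonneg _)
      (Real.smoothTransition.le_one _))
    (mul_nonneg (Real.smoothTransition.nonneg _) (Real.smoothTransition.nonneg _))
    (mul_le_one₀ (Real.smoothTransition.le_one _) (Real.smoothTransition.nonneg _)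
      (Real.smoothTransition.le_one _))

theorem boxCutoff_eq_one (hε : 0 < ε) {x : ℝ × ℝ} (hx : x ∈ Icc (a, c) (b, d)) :
    boxCutoff ε a b c d x = 1 := by
  have h : ∀ s, 0 ≤ s → Real.smoothTransition (s / ε + 1) = 1 := fun s hs =>
    Real.smoothTransition.one_of_one_le (by linarith [div_nonneg hs hε.le])
  have h1 : a ≤ x.1 := hx.1.1
  have h2 : c ≤ x.2 := hx.1.2
  have h3 : x.1 ≤ b := hx.2.1
  have h4 : x.2 ≤ d := hx.2.2
  rw [boxCutoff, h _ (by linarith), h _ (by linarith), h _ (by linarith), h _ (by linarith)]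
  norm_num

theorem boxCutoff_eq_zero (hε : 0 < ε) {x : ℝ × ℝ}
    (hx : x ∉ Icc (a - ε, c - ε) (b + ε, d + ε)) : boxCutoff ε a b c d x = 0 := by
  have h : ∀ s, s < -ε → Real.smoothTransition (s / ε + 1) = 0 := fun s hs =>
    Real.smoothTransition.zero_of_nonpos (by
      have := (div_lt_iff₀ hε).2 (show s < -1 * ε by linarith)
      linarith)
  rw [boxCutoff]
  by_cases h1 : x.1 < a - ε
  · rw [h (x.1 - a) (by linarith)]
    simp
  by_cases h2 : b + ε < x.1
  · rw [h (b - x.1) (by linarith)]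
    simp
  by_cases h3 : x.2 < c - ε
  · rw [h (x.2 - c) (by linarith)]
    simp
  by_cases h4 : d + ε < x.2
  · rw [h (d - x.2) (by linarith)]
    simp
  push Not at h1 h2 h3 h4
  exact absurd ⟨⟨h1, h3⟩, h2, h4⟩ hx

theorem boxCutoff_eventuallyEq_zero (hε : 0 < ε) (ha : 0 < a - ε) {x : ℝ × ℝ} (hx : x.1 ≤ 0) :
    boxCutoff ε a b c d =ᶠ[𝓝 x] fun _ => 0 := by
  have : ∀ᶠ y : ℝ × ℝ in 𝓝 x, y.1 < a - ε :=
    (continuous_fst.tendsto x).eventually (gt_mem_nhds (hx.trans_lt ha))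
  filter_upwards [this] with y hy
  exact boxCutoff_eq_zero hε fun h => absurd h.1.1 (not_le.2 hy)

/-- Smoothness of the product of a cutoff with a function that is smooth in `{x₁ > 0}`. -/
theorem contDiff_boxCutoff_mul (hε : 0 < ε) (ha : 0 < a - ε) {f : ℝ × ℝ → ℝ}
    (hf : ∀ x : ℝ × ℝ, 0 < x.1 → ContDiffAt ℝ 2 f x) :
    ContDiff ℝ 2 fun x => boxCutoff ε a b c d x * f x := by
  refine contDiff_iff_contDiffAt.2 fun x => ?_
  rcases lt_or_ge 0 x.1 with hx | hx
  · exact (contDiff_boxCutoff (n := 2)).contDiffAt.mul (hf x hx)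
  · refine (contDiffAt_const (c := (0 : ℝ))).congr_of_eventuallyEq ?_
    filter_upwards [boxCutoff_eventuallyEq_zero hε ha hx (b := b) (c := c) (d := d)] with y hy
    rw [hy, zero_mul]

theorem contDiffAt_kern {x : ℝ × ℝ} (hx : 0 < x.1) : ContDiffAt ℝ 2 kern x := by
  unfold kern
  refine ContDiffAt.div (by fun_prop) (by fun_prop) ?_
  positivity

theorem C11With.mono {V W : Type*} [NormedAddCommGroup V] [NormedSpace ℝ V]
    [NormedAddCommGroup W] [NormedSpace ℝ W] {β β' : ℝ} {f : V → W} {f' : V → V →L[ℝ] W}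
    (h : C11With β f f') (hβ : β ≤ β') : C11With β' f f' :=
  ⟨h.hasFDerivAt, fun x => (h.norm_le x).trans hβ, fun x => (h.norm_der_le x).trans hβ,
    fun x y => (h.norm_der_sub_le x y).trans (mul_le_mul_of_nonneg_right hβ (norm_nonneg _))⟩

/-- The direction of the truncated velocity field. -/
noncomputable def dirField (η : ℝ × ℝ → ℝ) (x : ℝ × ℝ) : (ℝ × ℝ) × ℝ :=
  ((-(η x * x.1), η x * x.2), 0)

/-- The truncated vorticity production per unit density. -/
noncomputable def prodField (η : ℝ × ℝ → ℝ) (x : ℝ × ℝ) : (ℝ × ℝ) × ℝ :=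
  ((0, 0), η x * x.1⁻¹)

/-- The positive part of the truncated kernel. -/
noncomputable def kernPos (η : ℝ × ℝ → ℝ) (x : ℝ × ℝ) : ℝ := max (η x * kern x) 0

/-- The cutoff lives in `{x₁ ≥ a - ε}`, where `1 / x₁` and the kernel are smooth. The positive part
leaves the kernel only Lipschitz, which suffices for the integrand of `Qt`; on the quadrant it
changes nothing. -/
theorem exists_coefficient_bounds (hε : 0 < ε) (ha : 0 < a - ε) : ∃ β κ : ℝ,
    C11With β (dirField (boxCutoff ε a b c d)) (fderiv ℝ (dirField (boxCutoff ε a b c d))) ∧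
    C11With β (prodField (boxCutoff ε a b c d)) (fderiv ℝ (prodField (boxCutoff ε a b c d))) ∧
    (∀ x, |kernPos (boxCutoff ε a b c d) x| ≤ κ) ∧
    ∀ x y, |kernPos (boxCutoff ε a b c d) x - kernPos (boxCutoff ε a b c d) y| ≤
      κ * ‖x - y‖ := by
  set η := boxCutoff ε a b c d with hη
  have hη2 : ContDiff ℝ 2 η := contDiff_boxCutoff (n := 2)
  have hηs : ∀ x ∉ Icc (a - ε, c - ε) (b + ε, d + ε), η x = 0 := fun x hx =>
    boxCutoff_eq_zero hε hx
  have hKc : IsCompact (Icc (a - ε, c - ε) (b + ε, d + ε)) := isCompact_Icc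
  have h1 : ContDiff ℝ 2 (dirField η) :=
    ((hη2.mul contDiff_fst).neg.prodMk (hη2.mul contDiff_snd)).prodMk contDiff_const
  have h2 : ContDiff ℝ 2 (prodField η) :=
    contDiff_const.prodMk (contDiff_boxCutoff_mul hε ha fun x hx =>
      contDiffAt_fst.inv hx.ne')
  have h3 : ContDiff ℝ 2 fun x => η x * kern x :=
    contDiff_boxCutoff_mul hε ha fun x hx => contDiffAt_kern hx
  obtain ⟨β₁, -, hβ₁⟩ := exists_c11With_of_contDiff h1
    (HasCompactSupport.intro hKc fun x hx => by simp [dirField, hηs x hx])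
  obtain ⟨β₂, -, hβ₂⟩ := exists_c11With_of_contDiff h2
    (HasCompactSupport.intro hKc fun x hx => by simp [prodField, hηs x hx])
  obtain ⟨κ, -, hκ⟩ := exists_c11With_of_contDiff h3
    (HasCompactSupport.intro hKc fun x hx => by simp [hηs x hx])
  refine ⟨max β₁ β₂, κ, hβ₁.mono (le_max_left _ _), hβ₂.mono (le_max_right _ _), fun x => ?_,
    fun x y => ?_⟩
  · rw [kernPos, abs_of_nonneg (le_max_right _ _)]
    exact max_le ((le_abs_self _).trans (hκ.norm_le x)) ((norm_nonneg _).trans (hκ.norm_le x))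
  · exact (abs_max_sub_max_le_abs _ _ _).trans
      (norm_sub_le_of_norm_hasFDerivAt_le hκ.hasFDerivAt hκ.norm_der_le x y)

end cutoff

/-! ### Extensions of the initial data -/

/-- A Lipschitz extension to the plane with the same bound. -/
theorem classX.exists_lipschitz_extension {f : ℝ × ℝ → ℝ} (hf : f ∈ classX) {M : ℝ}
    (hM : ∀ x ∈ quadrant, |f x| ≤ M) : ∃ (h : ℝ × ℝ → ℝ) (Λ : ℝ), 0 ≤ Λ ∧ EqOn h f quadrant ∧
      (∀ x, |h x| ≤ M) ∧ ∀ x y, |h x - h y| ≤ Λ * ‖x - y‖ := by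
  obtain ⟨g, hg, hgc, hgs, hfg⟩ := hf
  obtain ⟨Λ, hΛ⟩ := hg.lipschitzWith_of_hasCompactSupport hgc (by norm_num)
  -- Clamping the second coordinate takes all values from the quadrant, or from `{x₁ < 0}` where `g
  -- = 0`, so the bound `M` is kept.
  refine ⟨fun x => g (x.1, max x.2 0), Λ, Λ.2, fun x hx => ?_, fun x => ?_, fun x y => ?_⟩
  · simp only [max_eq_left hx.2]
    exact (hfg hx).symm
  · beta_reduce
    rcases le_or_gt 0 x.1 with h | h
    · have hx : ((x.1, max x.2 0) : ℝ × ℝ) ∈ quadrant := ⟨h, le_max_right _ _⟩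
      rw [← hfg hx]
      exact hM _ hx
    · have hx : ((x.1, max x.2 0) : ℝ × ℝ) ∉ tsupport g := fun h' =>
        absurd (hgs h') (not_lt.2 h.le)
      rw [image_eq_zero_of_notMem_tsupport hx, abs_zero]
      exact (abs_nonneg _).trans (hM 0 ⟨le_rfl, le_rfl⟩)
  · rw [← Real.dist_eq, ← dist_eq_norm]
    refine (hΛ.dist_le_mul _ _).trans (mul_le_mul_of_nonneg_left ?_ Λ.2)
    rw [Prod.dist_eq, Prod.dist_eq]
    exact max_le_max le_rfl (by simpa [Real.dist_eq] using abs_max_sub_max_le_abs x.2 y.2 0)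

/-- A `C¹` extension with a support close to that of the function on the quadrant. -/
theorem classX.exists_extension {f : ℝ × ℝ → ℝ} (hf : f ∈ classX) {δ R : ℝ} (hδ : 0 < δ)
    (hbox : ∀ x ∈ quadrant, ¬(δ ≤ x.1 ∧ x.1 ≤ R ∧ x.2 ≤ R) → f x = 0) :
    ∃ g : ℝ × ℝ → ℝ, ContDiff ℝ 1 g ∧ EqOn g f quadrant ∧
      ∀ x ∉ Icc (δ - δ / 4, 0 - δ / 4) (R + δ / 4, R + δ / 4), g x = 0 := by
  obtain ⟨g, hg, -, -, hfg⟩ := hf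
  refine ⟨fun x => boxCutoff (δ / 4) δ R 0 R x * g x,
    (contDiff_boxCutoff (n := 1)).mul hg, fun x hx => ?_, fun x hx => ?_⟩
  · simp only [← hfg hx]
    by_cases h : δ ≤ x.1 ∧ x.1 ≤ R ∧ x.2 ≤ R
    · rw [boxCutoff_eq_one (by positivity) ⟨⟨h.1, hx.2⟩, h.2⟩, one_mul]
    · rw [hbox x hx h, mul_zero]
  · beta_reduce
    rw [boxCutoff_eq_zero (by positivity) hx, zero_mul]


/-! ### Existence of solutions -/

/-- The sign of a function whose logarithmic derivative is bounded does not change. -/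
theorem nonneg_of_abs_deriv_le {f f' : ℝ → ℝ} {C t : ℝ} (ht : 0 ≤ t)
    (hd : ∀ s ∈ Icc 0 t, HasDerivAt f (f' s) s) (hb : ∀ s ∈ Icc 0 t, |f' s| ≤ C * |f s|)
    (h : 0 ≤ f t) : 0 ≤ f 0 := by
  by_contra hneg
  push Not at hneg
  have hc : ContinuousOn f (Icc 0 t) := fun s hs => (hd s hs).continuousAt.continuousWithinAt
  obtain ⟨s, hs, hs0⟩ := intermediate_value_Icc ht hc ⟨hneg.le, h⟩
  -- The function `e^{2Cu} f²` is nondecreasing, so a zero at `s` would force `f 0 = 0`.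
  have hg : ∀ u ∈ Icc 0 s, HasDerivAt (fun u => Real.exp (2 * C * u) * f u ^ 2)
      (Real.exp (2 * C * u) * (2 * C * f u ^ 2 + 2 * f u * f' u)) u := by
    intro u hu
    have h1 := (((hasDerivAt_id u).const_mul (2 * C)).exp).mul
      ((hd u ⟨hu.1, hu.2.trans hs.2⟩).pow 2)
    convert! h1 using 1
    simp
    ring
  have hmono : MonotoneOn (fun u => Real.exp (2 * C * u) * f u ^ 2) (Icc 0 s) := by
    refine monotoneOn_of_deriv_nonneg (convex_Icc 0 s)
      (fun u hu => (hg u hu).continuousAt.continuousWithinAt)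
      (fun u hu => (hg u (interior_subset hu)).differentiableAt.differentiableWithinAt)
      fun u hu => ?_
    have hu' := interior_subset hu
    rw [(hg u hu').deriv]
    refine mul_nonneg (Real.exp_pos _).le ?_
    have h1 := hb u ⟨hu'.1, hu'.2.trans hs.2⟩
    have h2 : |f u * f' u| ≤ C * f u ^ 2 := by
      rw [abs_mul, ← sq_abs (f u)]
      nlinarith [abs_nonneg (f u)]
    linarith [neg_abs_le (f u * f' u)]
  have h1 := hmono (left_mem_Icc.2 hs.1) (right_mem_Icc.2 hs.1) hs.1
  simp only [hs0, mul_zero, Real.exp_zero, one_mul] at h1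
  nlinarith [sq_nonneg (f 0), mul_pos_of_neg_of_neg hneg hneg]

/-- Solutions exist on a time interval that depends only on the support and the size of the
data. -/
theorem exists_solution {α δ R M : ℝ} (hα : 0 < α) (hδ : 0 < δ) (hδ1 : δ ≤ 1) (hR : 1 ≤ R)
    (hM : 0 ≤ M) : ∃ τ : ℝ, 0 < τ ∧ ∀ ω₀ ∈ classX, ∀ ρ₀ ∈ classX,
      (∀ x ∈ quadrant, |ω₀ x| ≤ M ∧ |ρ₀ x| ≤ M ∧
        (¬(δ ≤ x.1 ∧ x.1 ≤ R ∧ x.2 ≤ R) → ω₀ x = 0 ∧ ρ₀ x = 0)) →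
      ∃ ω ρ : ℝ → ℝ × ℝ → ℝ, IsSolution α (Icc 0 τ) ω ρ ∧ EqOn (ω 0) ω₀ quadrant ∧
        EqOn (ρ 0) ρ₀ quadrant := by
  -- The extended data live within `δ / 4` of the data box and the flow moves points by at most `δ /
  -- 4`. So the transported fields vanish off `K`, where the cutoff is `1`, while the cutoff itself
  -- stops at `x₁ = δ / 4`. The ray length `R + 2` exceeds the right end `R + 1 + δ / 4` of the
  -- cutoff.
  set η := boxCutoff (δ / 4) (δ / 2) (R + 1) (-1) (R + 1) with hη
  set K : Set (ℝ × ℝ) := Icc (δ / 2, -1) (R + 1, R + 1) with hK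
  obtain ⟨β, κ, he, he₀, hk, hkΛ⟩ := exists_coefficient_bounds (ε := δ / 4) (a := δ / 2)
    (b := R + 1) (c := -1) (d := R + 1) (by linarith) (by linarith)
  rw [← hη] at he he₀ hk hkΛ
  have hβ : 0 ≤ β := (norm_nonneg _).trans (he.norm_le 0)
  have hκ : 0 ≤ κ := (abs_nonneg _).trans (hk 0)
  have hℓ : 0 ≤ R + 2 := by linarith
  have hcQ := cQ_nonneg hα hℓ
  set C := cQ α (R + 2) * (2 * κ * M) with hC
  have hC0 : 0 ≤ C := by positivity
  set L := 2 * (β * (2 * C + 1)) with hL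
  have hL0 : 0 ≤ L := by positivity
  -- The denominator `L + 1` is positive even if `L = 0`. The solution is taken on `[0, τ / 2]`,
  -- inside the open interval where the fields are known to be regular.
  set τ := δ / 4 / (L + 1) with hτdef
  have hτ : 0 < τ := by positivity
  have hLτ : L * τ ≤ δ / 4 := by
    rw [hτdef, mul_div_assoc', div_le_iff₀ (by linarith)]
    nlinarith
  refine ⟨τ / 2, by linarith, fun ω₀ hω₀ ρ₀ hρ₀ hdata => ?_⟩
  -- Two extensions are used. The Lipschitz one keeps the bound `M` and drives the flow, so that `τ`
  -- depends on `M` only; the `C¹` one is transported and gives the regularity. They agree on the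
  -- quadrant, which the backward flow preserves, so both produce the same vorticity there.
  obtain ⟨h₀, Λ₀, hΛ₀, hh₀, h₀M, h₀Λ⟩ := classX.exists_lipschitz_extension hω₀ fun x hx => (hdata x hx).1
  obtain ⟨h₁, Λ₁, -, hh₁, h₁M, h₁Λ⟩ := classX.exists_lipschitz_extension hρ₀ fun x hx => (hdata x hx).2.1
  obtain ⟨g₀, hg₀, hgω, hg₀s⟩ := classX.exists_extension hω₀ hδ fun x hx h => ((hdata x hx).2.2 h).1
  obtain ⟨g₁, hg₁, hgρ, hg₁s⟩ := classX.exists_extension hρ₀ hδ fun x hx h => ((hdata x hx).2.2 h).2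
  obtain ⟨w, w', hw, hw', hw0, hwr, hwd, hGc, hwF⟩ := exists_lagrangian_solution hα hℓ he he₀
    h₀M h₁M (Λ := max Λ₀ Λ₁)
    (fun x y => (h₀Λ x y).trans (mul_le_mul_of_nonneg_right (le_max_left _ _) (norm_nonneg _)))
    (fun x y => (h₁Λ x y).trans (mul_le_mul_of_nonneg_right (le_max_right _ _) (norm_nonneg _)))
    (hΛ₀.trans (le_max_left _ _)) hk hkΛ (r := δ / 4) (by linarith) (by linarith) hτ hLτ
  have hwr' : ∀ t, ‖w t‖ ≤ 1 / 2 := fun t => (hwr t).trans (by linarith)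
  set q : ℝ → ℝ × ℝ → ℝ := fun t =>
    Qt α (R + 2) (fun y => kernPos η y * vort h₀ h₁ (w t) y) with hq
  have hqC : ∀ t x, |q t x| ≤ C := fun t =>
    abs_Qt_le hα hℓ (abs_mul_vort_le h₀M h₁M hk (hwr' t))
  have hsupp : ∀ t, ∀ x ∉ K, g₀ (invFlow (w t) x) = 0 ∧ g₁ (invFlow (w t) x) = 0 := by
    intro t x hx
    suffices h : invFlow (w t) x ∉ Icc (δ - δ / 4, 0 - δ / 4) (R + δ / 4, R + δ / 4) from
      ⟨hg₀s _ h, hg₁s _ h⟩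
    rintro ⟨⟨h1, h2⟩, h3, h4⟩
    have h5 := (norm_flow_sub_self_le (w t) (invFlow (w t) x)).trans (hwr t)
    rw [flow_invFlow (hwr' t)] at h5
    have h6 := abs_le.1 ((norm_fst_le (x - invFlow (w t) x)).trans h5)
    have h7 := abs_le.1 ((norm_snd_le (x - invFlow (w t) x)).trans h5)
    simp only [Prod.fst_sub, Prod.snd_sub] at h1 h2 h3 h4 h6 h7
    exact hx ⟨⟨by simp only; linarith, by simp only; linarith⟩, by simp only; linarith,
      by simp only; linarith⟩
  -- Each coordinate of a trajectory satisfies `|f'| ≤ C |f|`, because the truncated velocity is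
  -- still proportional to the coordinates; so no trajectory crosses an axis.
  have hquad : ∀ t ∈ Ico 0 τ, ∀ x ∈ quadrant, invFlow (w t) x ∈ quadrant := by
    intro t ht x hx
    set y := invFlow (w t) x with hy
    have hflow : flow (w t) y = x := flow_invFlow (hwr' t) x
    have hflow0 : flow (w 0) y = y := by simp [flow, hw0]
    have hcurve : ∀ s ∈ Icc 0 t, HasDerivAt (fun s => (w s).toFun y) ((w' s).toFun y) s :=
      fun s hs => (C1b.evalL y).hasFDerivAt.comp_hasDerivAt s
        (hwd s ⟨by linarith [hs.1], hs.2.trans_lt ht.2⟩)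
    have hbound : ∀ s (z : ℝ), |q s (flow (w s) y) * (η (flow (w s) y) * z)| ≤ C * |z| := by
      intro s z
      have hη1 : |η (flow (w s) y)| ≤ 1 := by
        rw [abs_of_nonneg (boxCutoff_nonneg _)]
        exact boxCutoff_le_one _
      rw [abs_mul, abs_mul]
      exact mul_le_mul (hqC _ _) (mul_le_of_le_one_left (abs_nonneg _) hη1) (by positivity) hC0
    constructor
    · have h1 : ∀ s ∈ Icc 0 t, HasDerivAt (fun s => (flow (w s) y).1) ((w' s).toFun y).1.1 s :=
        fun s hs => (((ContinuousLinearMap.fst ℝ ℝ ℝ).comp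
          (ContinuousLinearMap.fst ℝ (ℝ × ℝ) ℝ)).hasFDerivAt.comp_hasDerivAt s
            (hcurve s hs)).const_add y.1
      have h2 := nonneg_of_abs_deriv_le ht.1 h1 (C := C) (fun s _ => ?_)
        (by simp only [hflow]; exact hx.1)
      · simpa only [hflow0] using h2
      · rw [hwF]
        have := hbound s (flow (w s) y).1
        simpa [dirField, prodField] using! this
    · have h1 : ∀ s ∈ Icc 0 t, HasDerivAt (fun s => (flow (w s) y).2) ((w' s).toFun y).1.2 s :=
        fun s hs => (((ContinuousLinearMap.snd ℝ ℝ ℝ).comp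
          (ContinuousLinearMap.fst ℝ (ℝ × ℝ) ℝ)).hasFDerivAt.comp_hasDerivAt s
            (hcurve s hs)).const_add y.2
      have h2 := nonneg_of_abs_deriv_le ht.1 h1 (C := C) (fun s _ => ?_)
        (by simp only [hflow]; exact hx.2)
      · simpa only [hflow0] using h2
      · rw [hwF]
        have := hbound s (flow (w s) y).2
        simpa [dirField, prodField] using! this
  set Φ : ℝ → ℝ × ℝ → ℝ := fun t => vort g₀ g₁ (w t) with hΦ
  set Ρ : ℝ → ℝ × ℝ → ℝ := fun t => vort g₁ (fun _ => 0) (w t) with hΡ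
  have hΦ0 : ∀ t, ∀ x ∉ K, Φ t x = 0 := fun t x hx => by
    simp [hΦ, vort, hsupp t x hx]
  have hΡ0 : ∀ t, ∀ x ∉ K, Ρ t x = 0 := fun t x hx => by
    simp [hΡ, vort, hsupp t x hx]
  have hΡeq : ∀ t x, Ρ t x = g₁ (invFlow (w t) x) := fun t x => by simp [hΡ, vort]
  have hKpos : K ⊆ {x | 0 < x.1} := fun x hx => lt_of_lt_of_le (by positivity) hx.1.1
  have hΦreg : ∀ z : ℝ × (ℝ × ℝ), z.1 ∈ Ioo (-τ) τ →
      ContDiffAt ℝ 1 (fun z : ℝ × (ℝ × ℝ) => Φ z.1 z.2) z := fun z hz =>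
    contDiffAt_vort hg₀ hg₁ hw hw' hwr' hwd hz
  have hΡreg : ∀ z : ℝ × (ℝ × ℝ), z.1 ∈ Ioo (-τ) τ →
      ContDiffAt ℝ 1 (fun z : ℝ × (ℝ × ℝ) => Ρ z.1 z.2) z := fun z hz =>
    contDiffAt_vort hg₁ contDiff_const hw hw' hwr' hwd hz
  have hIcc : Icc 0 (τ / 2) ⊆ Ioo (-τ) τ := fun t ht => ⟨by linarith [ht.1], by linarith [ht.2]⟩
  have hIco : Icc 0 (τ / 2) ⊆ Ico 0 τ := fun t ht => ⟨ht.1, by linarith [ht.2]⟩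
  have hgrad : ∀ {Ψ : ℝ → ℝ × ℝ → ℝ}, (∀ z : ℝ × (ℝ × ℝ), z.1 ∈ Ioo (-τ) τ →
      ContDiffAt ℝ 1 (fun z : ℝ × (ℝ × ℝ) => Ψ z.1 z.2) z) → ∀ t ∈ Icc 0 (τ / 2),
      ∀ x ∈ quadrant, gradQ (Ψ t) x = fderiv ℝ (Ψ t) x := by
    intro Ψ hΨ t ht x hx
    refine gradQ_eq_fderiv_of_eqOn (fun y => ?_) (fun _ _ => rfl) hx
    exact (ContDiffAt.comp (g := fun z : ℝ × (ℝ × ℝ) => Ψ z.1 z.2)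
      (f := fun x : ℝ × ℝ => (t, x)) y (hΨ (t, y) (hIcc ht))
      (contDiffAt_const.prodMk contDiffAt_id)).differentiableAt (by norm_num)
  have hzero : ∀ {ψ : ℝ × ℝ → ℝ}, (∀ x ∉ K, ψ x = 0) → ∀ x ∉ K, fderiv ℝ ψ x = 0 := by
    intro ψ hψ x hx
    have : ψ =ᶠ[𝓝 x] fun _ => 0 := by
      filter_upwards [isClosed_Icc.isOpen_compl.mem_nhds hx] with y hy using hψ y hy
    rw [this.fderiv_eq]
    exact fderiv_const_apply 0
  have hvel : ∀ t ∈ Icc 0 (τ / 2), ∀ x ∈ quadrant, Q α (Φ t) x = q t x := by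
    intro t ht x hx
    refine Q_eq_Qt hα hℓ (hGc t) (fun y hy => ?_) (fun y hy => ?_) hx
    · have hy' := hquad t (hIco ht) y hy
      have h1 : vort h₀ h₁ (w t) y = Φ t y := by
        simp only [hΦ, vort, hh₀ hy', hh₁ hy', hgω hy', hgρ hy']
      rw [h1]
      by_cases hyK : y ∈ K
      · rw [kernPos, hη, boxCutoff_eq_one (by linarith) hyK, one_mul, max_eq_left (kern_nonneg hy)]
      · rw [hΦ0 t y hyK, mul_zero, mul_zero]
    · rw [kernPos, hη, boxCutoff_eq_zero (by linarith), zero_mul, max_self, zero_mul]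
      intro h
      have : y.1 ≤ R + 1 + δ / 4 := h.2.1
      linarith
  have hinv0 : ∀ x, invFlow (w 0) x = x := fun x => by
    have h1 : flow (w 0) x = x := by simp [flow, hw0]
    nth_rewrite 1 [← h1]
    exact invFlow_flow (hwr' 0) x
  -- On `K` the cutoff is `1`, so the truncated velocity and production are the true ones; off `K`
  -- both transported fields vanish, and nothing needs to be known about the velocity.
  have htransport : ∀ t ∈ Icc 0 (τ / 2), ∀ x ∈ K, x ∈ quadrant →
      (w' t).toFun (invFlow (w t) x) = (velocity α (Φ t) x, x.1⁻¹) := by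
    intro t ht x hxK hx
    rw [hwF, flow_invFlow (hwr' t), velocity, hvel t ht x hx, dirField, prodField, hη,
      boxCutoff_eq_one (by linarith) hxK]
    ext <;> simp [hq, hη, mul_comm]
  refine ⟨Φ, Ρ, ⟨(continuousIntoX_of_contDiffAt hΦreg isCompact_Icc hKpos
    fun t _ => hΦ0 t).mono hIcc, (continuousIntoX_of_contDiffAt hΡreg isCompact_Icc hKpos
    fun t _ => hΡ0 t).mono hIcc, fun t ht x hx => ?_, fun t ht x hx => ?_⟩, fun x hx => ?_,
    fun x hx => ?_⟩
  · have h1 := hasDerivAt_vort hg₀ hg₁ hw hw' hwr' hwd (hIcc ht) x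
    refine (h1.congr_deriv (Eq.symm ?_)).hasDerivWithinAt
    rw [hgrad hΦreg t ht x hx, hΡeq]
    by_cases hxK : x ∈ K
    · rw [htransport t ht x hxK hx, div_eq_mul_inv]
    · rw [hzero (hΦ0 t) x hxK, (hsupp t x hxK).2]
      simp
  · have h1 := hasDerivAt_vort hg₁ contDiff_const hw hw' hwr' hwd (g₁ := fun _ => 0) (hIcc ht) x
    refine (h1.congr_deriv (Eq.symm ?_)).hasDerivWithinAt
    rw [hgrad hΡreg t ht x hx]
    by_cases hxK : x ∈ K
    · rw [htransport t ht x hxK hx]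
      simp [hΡ]
    · rw [hzero (hΡ0 t) x hxK]
      simp
  · simp only [hΦ, vort, hw0, C1b.zero_toFun, Prod.snd_zero, mul_zero, add_zero]
    rw [show invFlow (0 : LagrangianSpace) x = x by rw [← hw0]; exact hinv0 x]
    exact hgω hx
  · rw [hΡeq, hinv0]
    exact hgρ hx


/-! ### Translation in time and gluing -/

theorem ContinuousIntoX.comp_add {I J : Set ℝ} {f : ℝ → ℝ × ℝ → ℝ} (hf : ContinuousIntoX I f)
    {c : ℝ} (hc : MapsTo (fun s => s + c) J I) : ContinuousIntoX J fun s => f (s + c) := by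
  refine ⟨fun t ht => hf.1 _ (hc ht), fun t ht => ?_⟩
  have hlim : Tendsto (fun s => s + c) (𝓝[J] t) (𝓝[I] (t + c)) :=
    ContinuousWithinAt.tendsto_nhdsWithin (f := fun s => s + c) (by fun_prop) hc
  exact ⟨fun u hu => hlim.eventually ((hf.2 _ (hc ht)).1 u hu),
    fun u hu => hlim.eventually ((hf.2 _ (hc ht)).2 u hu)⟩

theorem IsSolution.comp_add {α : ℝ} {I J : Set ℝ} {ω ρ : ℝ → ℝ × ℝ → ℝ}
    (h : IsSolution α I ω ρ) {c : ℝ} (hc : MapsTo (fun s => s + c) J I) :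
    IsSolution α J (fun s => ω (s + c)) fun s => ρ (s + c) := by
  have hder : ∀ t, HasDerivWithinAt (fun s => s + c) 1 J t := fun t =>
    ((hasDerivAt_id t).add_const c).hasDerivWithinAt
  refine ⟨h.vorticity_continuous.comp_add hc, h.density_continuous.comp_add hc,
    fun t ht x hx => ?_, fun t ht x hx => ?_⟩
  · have := HasDerivWithinAt.comp t (h.vorticity_eq _ (hc ht) x hx) (hder t) hc
    rwa [mul_one] at this
  · have := HasDerivWithinAt.comp t (h.density_eq _ (hc ht) x hx) (hder t) hc
    rwa [mul_one] at this

theorem classX.congr {f g : ℝ × ℝ → ℝ} (hf : f ∈ classX) (hfg : EqOn f g quadrant) :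
    g ∈ classX := by
  obtain ⟨k, h1, h2, h3, h4⟩ := hf
  exact ⟨k, h1, h2, h3, hfg.symm.trans h4⟩

theorem ContinuousIntoX.of_locally_eq {I : Set ℝ} {f : ℝ → ℝ × ℝ → ℝ}
    (h : ∀ t ∈ I, ∃ (J : Set ℝ) (g : ℝ → ℝ × ℝ → ℝ), ContinuousIntoX J g ∧ t ∈ J ∧ J ∈ 𝓝[I] t ∧
      ∀ s ∈ J, EqOn (g s) (f s) quadrant) : ContinuousIntoX I f := by
  refine ⟨fun t ht => ?_, fun t ht => ?_⟩
  · obtain ⟨J, g, hg, htJ, -, hfg⟩ := h t ht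
    exact classX.congr (hg.1 t htJ) (hfg t htJ)
  · obtain ⟨J, g, hg, htJ, hJ, hfg⟩ := h t ht
    have hle : 𝓝[I] t ≤ 𝓝[J] t :=
      le_inf inf_le_left (le_principal_iff.2 hJ)
    constructor
    · intro u hu
      filter_upwards [hle ((hg.2 t htJ).1 u hu), hJ] with s hs hsJ x hx
      rw [← hfg t htJ hx, ← hfg s hsJ hx]
      exact hs x hx
    · intro u hu
      filter_upwards [hle ((hg.2 t htJ).2 u hu), hJ] with s hs hsJ x hx
      rw [← gradQ_congr (hfg t htJ) hx, ← gradQ_congr (hfg s hsJ) hx]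
      exact hs x hx

/-- Being a solution is a local property in time. -/
theorem IsSolution.of_locally_eq {α : ℝ} {I : Set ℝ} {ω ρ : ℝ → ℝ × ℝ → ℝ}
    (h : ∀ t ∈ I, ∃ (J : Set ℝ) (ω' ρ' : ℝ → ℝ × ℝ → ℝ), IsSolution α J ω' ρ' ∧ t ∈ J ∧
      J ∈ 𝓝[I] t ∧ ∀ s ∈ J, EqOn (ω' s) (ω s) quadrant ∧ EqOn (ρ' s) (ρ s) quadrant) :
    IsSolution α I ω ρ := by
  refine ⟨.of_locally_eq fun t ht => ?_, .of_locally_eq fun t ht => ?_, fun t ht x hx => ?_,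
    fun t ht x hx => ?_⟩
  · obtain ⟨J, ω', ρ', hs, htJ, hJ, heq⟩ := h t ht
    exact ⟨J, ω', hs.vorticity_continuous, htJ, hJ, fun s hs => (heq s hs).1⟩
  · obtain ⟨J, ω', ρ', hs, htJ, hJ, heq⟩ := h t ht
    exact ⟨J, ρ', hs.density_continuous, htJ, hJ, fun s hs => (heq s hs).2⟩
  · obtain ⟨J, ω', ρ', hs, htJ, hJ, heq⟩ := h t ht
    have h1 := (hs.vorticity_eq t htJ x hx).mono_of_mem_nhdsWithin hJ
    rw [gradQ_congr (heq t htJ).1 hx, velocity_congr (heq t htJ).1 hx, (heq t htJ).2 hx] at h1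
    exact h1.congr_of_eventuallyEq (mem_of_superset hJ fun s hs => ((heq s hs).1 hx).symm)
      ((heq t htJ).1 hx).symm
  · obtain ⟨J, ω', ρ', hs, htJ, hJ, heq⟩ := h t ht
    have h1 := (hs.density_eq t htJ x hx).mono_of_mem_nhdsWithin hJ
    rw [gradQ_congr (heq t htJ).2 hx, velocity_congr (heq t htJ).1 hx] at h1
    exact h1.congr_of_eventuallyEq (mem_of_superset hJ fun s hs => ((heq s hs).2 hx).symm)
      ((heq t htJ).2 hx).symm

/-- Uniqueness identifies the shifted solution with the old one on `[t₀, T)`. The overlap makes the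
glued pair coincide with a single solution near every time, in particular on both sides of `T`. -/
theorem IsSolution.exists_extension {α T τ t₀ : ℝ} {ω ρ σ π : ℝ → ℝ × ℝ → ℝ}
    (h : IsSolution α (Ico 0 T) ω ρ) (ht₀ : t₀ ∈ Ico 0 T) (hτ : T < t₀ + τ)
    (h' : IsSolution α (Icc 0 τ) σ π) (hσ : EqOn (σ 0) (ω t₀) quadrant)
    (hπ : EqOn (π 0) (ρ t₀) quadrant) :
    ∃ ω' ρ' : ℝ → ℝ × ℝ → ℝ, IsSolution α (Ico 0 (t₀ + τ)) ω' ρ' ∧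
      ∀ t ∈ Ico 0 T, EqOn (ω' t) (ω t) quadrant ∧ EqOn (ρ' t) (ρ t) quadrant := by
  have hagree : ∀ t ∈ Ico t₀ T, EqOn (σ (t - t₀)) (ω t) quadrant ∧
      EqOn (π (t - t₀)) (ρ t) quadrant := by
    intro t ht
    have hmaps : MapsTo (fun s => s + t₀) (Icc 0 (t - t₀)) (Ico 0 T) := fun s hs => by
      have h1 : t < T := ht.2
      have h2 : s ≤ t - t₀ := hs.2
      have h3 : 0 ≤ s := hs.1
      have h4 : 0 ≤ t₀ := ht₀.1
      exact ⟨by beta_reduce; linarith, by beta_reduce; linarith⟩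
    have h1 := IsSolution.unique (sub_nonneg.2 ht.1)
      (h'.mono (Icc_subset_Icc_right (by linarith [ht.2]))) (h.comp_add hmaps)
      (by simpa using hσ) (by simpa using hπ) (t - t₀) (right_mem_Icc.2 (sub_nonneg.2 ht.1))
    simpa using h1
  have hshift : IsSolution α (Icc t₀ (t₀ + τ)) (fun s => σ (s + -t₀)) fun s => π (s + -t₀) :=
    h'.comp_add fun s hs => ⟨by beta_reduce; linarith [hs.1], by beta_reduce; linarith [hs.2]⟩
  refine ⟨fun t => if t < T then ω t else σ (t - t₀), fun t => if t < T then ρ t else π (t - t₀),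
    .of_locally_eq fun t ht => ?_, fun t ht => ?_⟩
  · rcases lt_or_ge t T with htT | htT
    · refine ⟨Ico 0 T, ω, ρ, h, ⟨ht.1, htT⟩, ?_, fun s hs => ?_⟩
      · filter_upwards [self_mem_nhdsWithin, mem_nhdsWithin_of_mem_nhds (Iio_mem_nhds htT)]
          with s hs hsT using ⟨hs.1, hsT⟩
      · simp only [if_pos hs.2]
        exact ⟨fun _ _ => rfl, fun _ _ => rfl⟩
    · refine ⟨Icc t₀ (t₀ + τ), _, _, hshift, ⟨ht₀.2.le.trans htT, ht.2.le⟩, ?_, fun s hs => ?_⟩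
      · filter_upwards [self_mem_nhdsWithin,
          mem_nhdsWithin_of_mem_nhds (Ioi_mem_nhds (ht₀.2.trans_le htT))] with s hs hst
          using ⟨le_of_lt hst, hs.2.le⟩
      · simp only [← sub_eq_add_neg]
        by_cases hsT : s < T
        · simp only [if_pos hsT]
          exact hagree s ⟨hs.1, hsT⟩
        · simp only [if_neg hsT]
          exact ⟨fun _ _ => rfl, fun _ _ => rfl⟩
  · simp only [if_pos ht.2]
    exact ⟨fun _ _ => rfl, fun _ _ => rfl⟩

end HyperbolicModel

/-! ### Local well-posedness and the continuation criterion -/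

theorem theorem1 (α : ℝ) (hα : 0 < α) :
    (∀ ω₀ ∈ HyperbolicModel.classX, ∀ ρ₀ ∈ HyperbolicModel.classX,
      ∃ T : ℝ, 0 < T ∧ ∃ ω ρ : ℝ → ℝ × ℝ → ℝ,
        HyperbolicModel.IsSolution α (Set.Icc 0 T) ω ρ ∧
        Set.EqOn (ω 0) ω₀ HyperbolicModel.quadrant ∧
        Set.EqOn (ρ 0) ρ₀ HyperbolicModel.quadrant ∧
        ∀ T' : ℝ, 0 < T' → T' ≤ T → ∀ ω' ρ' : ℝ → ℝ × ℝ → ℝ,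
          HyperbolicModel.IsSolution α (Set.Icc 0 T') ω' ρ' →
          Set.EqOn (ω' 0) ω₀ HyperbolicModel.quadrant →
          Set.EqOn (ρ' 0) ρ₀ HyperbolicModel.quadrant →
          ∀ t ∈ Set.Icc (0 : ℝ) T',
            Set.EqOn (ω' t) (ω t) HyperbolicModel.quadrant ∧
            Set.EqOn (ρ' t) (ρ t) HyperbolicModel.quadrant) ∧
    (∀ T : ℝ, 0 < T → ∀ ω ρ : ℝ → ℝ × ℝ → ℝ,
      HyperbolicModel.IsSolution α (Set.Ico 0 T) ω ρ →
      (∀ x ∈ HyperbolicModel.quadrant, 0 ≤ ω 0 x) →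
      (∀ x ∈ HyperbolicModel.quadrant, 0 ≤ ρ 0 x) →
      (∃ k : ℝ, 0 < k ∧
        ∫⁻ s in Set.Ico 0 T, MeasureTheory.eLpNorm (ω s) ⊤
          (MeasureTheory.volume.restrict (Set.Icc 0 k ×ˢ Set.Ici 0)) < ⊤) →
      ∃ ε : ℝ, 0 < ε ∧ ∃ ω' ρ' : ℝ → ℝ × ℝ → ℝ,
        HyperbolicModel.IsSolution α (Set.Ico 0 (T + ε)) ω' ρ' ∧
        ∀ t ∈ Set.Ico (0 : ℝ) T,
          Set.EqOn (ω' t) (ω t) HyperbolicModel.quadrant ∧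
          Set.EqOn (ρ' t) (ρ t) HyperbolicModel.quadrant) := by
  open HyperbolicModel Set in
  refine ⟨fun ω₀ hω₀ ρ₀ hρ₀ => ?_, fun T hT ω ρ h hω hρ hfin => ?_⟩
  · obtain ⟨δ, R, hδ, hδ1, hR, hbox⟩ := classX.exists_box_pair hω₀ hρ₀
    obtain ⟨Mω, hMω, hbω⟩ := classX.exists_bound hω₀
    obtain ⟨Mρ, -, hbρ⟩ := classX.exists_bound hρ₀
    obtain ⟨τ, hτ, hex⟩ := exists_solution hα hδ hδ1 hR (hMω.trans (le_max_left Mω Mρ))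
    obtain ⟨ω, ρ, h, h0, h1⟩ := hex ω₀ hω₀ ρ₀ hρ₀ fun x hx =>
      ⟨(hbω x hx).1.trans (le_max_left _ _), (hbρ x hx).1.trans (le_max_right _ _), hbox x hx⟩
    exact ⟨τ, hτ, ω, ρ, h, h0, h1, fun T' hT' hT'τ ω' ρ' h' h0' h1' =>
      IsSolution.unique hT'.le h' (h.mono (Icc_subset_Icc_right hT'τ)) (h0'.trans h0.symm)
        (h1'.trans h1.symm)⟩
  · obtain ⟨k, hk, hfin⟩ := hfin
    obtain ⟨δ, R, M, hδ, hδ1, hR, hM, hb⟩ := h.exists_bounds hT hk hω hρ hfin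
    -- The bounds hold at all times before `T`, so the same `τ` serves for every restart; starting
    -- within `τ / 2` of `T` carries the solution past `T`.
    obtain ⟨τ, hτ, hex⟩ := exists_solution hα hδ hδ1 hR hM
    obtain ⟨t₀, ht₀, hlt⟩ : ∃ t₀ ∈ Ico 0 T, T < t₀ + τ :=
      ⟨max 0 (T - τ / 2), ⟨le_max_left _ _, max_lt hT (by linarith)⟩, by
        linarith [le_max_right 0 (T - τ / 2)]⟩
    obtain ⟨σ, π, hs, hσ, hπ⟩ := hex (ω t₀) (h.vorticity_continuous.1 t₀ ht₀) (ρ t₀)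
      (h.density_continuous.1 t₀ ht₀) (hb t₀ ht₀)
    obtain ⟨ω', ρ', h', heq⟩ := h.exists_extension ht₀ hlt hs hσ hπ
    exact ⟨t₀ + τ - T, by linarith, ω', ρ', by rwa [add_sub_cancel], heq⟩
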